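/- **Conventions.** Let $\{\in\}$ be the signature of set theory. For a set $A$ of pairs $(\varphi,i)$, with $\varphi(x_0,\dots,x_n)$ an $\in$-formula and $i\in\{0,1\}$, the signature $\in_A$ adds to $\{\in\}$ an $(n+1)$-ary predicate symbol $R_\varphi$ for each $(\varphi,0)\in A$, an $n$-ary function symbol $f_\varphi$ for each $(\varphi,1)\in A$, and (if some $(\varphi,1)$ is in $A$) a constant $c$. The $\in_A$-theory $T_{\in,A}$ has the axioms $\forall\vec x\,(\varphi(\vec x)\leftrightarrow R_\varphi(\vec x))$ for $(\varphi,0)\in A$; for $(\varphi,1)\in A$ the axioms saying that for all $\vec x$, if there is exactly one $y$ with $\varphi(y,\vec x)$, then $\varphi(f_\varphi(\vec x),\vec x)$, and otherwise $f_\varphi(\vec x)=c$; and the axiom that $c$ is the empty set. We write $\in_{\Delta_0}$ for the signature $\in_A$ where $A$ consists of all $(\varphi,0)$ with $\varphi$ a $\Delta_0$-formula, together with $(\varphi,1)$ for $\varphi$ the formula defining $\omega$ and for $\varphi$ the formulas defining the ten Gödel operations $\{x,y\}$, $x\times y$, $\{(a,b):a\in x,b\in y,a\in b\}$, $x\setminus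 y$, $x\cap y$, $\bigcup x$, $\mathrm{dom}\,x$, $\{(a,b):(b,a)\in x\}$, $\{(a,b,c):(a,c,b)\in x\}$, $\{(a,b,c):(b,c,a)\in x\}$; inclusions such as $\in_{\Delta_0}\subseteq\in_A$ refer to these defining sets of pairs. $\Sigma_1$-formulas of a signature are the formulas $\exists\vec x\,\theta$ with $\theta$ quantifier free in that signature, and $\prec_1$ is elementarity for $\Sigma_1$-formulas. The replacement axiom for $\psi(x,y)$ (possibly with parameters) says: if $X$ is a set such that for all $x\in X$ there is $y$ with $\psi(x,y)$, then there is a function $f$ with domain $X$ such that $\psi(x,f(x))$ for all $x\in X$; $\mathsf{ZFC}$ is axiomatized with replacement in this form. A theory is model complete if all embeddings between its models are elementary. $S$ is a model companion of $T$ if $S$ is model complete and $S$, $T$ have the same universal consequences; $S$ is an absolute model companion (AMC) of $T$ if $S$ is model complete and the same boolean combinations of universal sentences follow from $S$ and from $T$. Both are unique up to logical equivalence. For an $\in$-theory $R$, $A$ is in the MC-spectrum (AMC-spectrum) of $R$ if $R+T_{\in,A}$ has a model companion $\mathsf{MC}(R,A)$ (an absolute model companion $\mathsf{AMC}(R,A)$).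 An $R$-definable (infinite) cardinal $\lambda$ is given by an $\in$-formula $\varphi_\lambda(x)$ such that $R$ proves that exactly one $x$ satisfies $\varphi_\lambda$, and that this $x$ is an (infinite) cardinal. For a model $\mathcal M$ of $R$, $\lambda^{\mathcal M}$ is the element satisfying $\varphi_\lambda$ in $\mathcal M$, and $H_{\lambda^+}^{\mathcal M}$ is the set of the $x\in\mathcal M$ whose transitive closure has, according to $\mathcal M$, size at most $\lambda^{\mathcal M}$; if $\mathcal M$ is an $\in_A$-structure and $H_{\lambda^+}^{\mathcal M}$ is closed under the functions of $\mathcal M$, it is regarded as a substructure of $\mathcal M$. **Theorem.** Let $R$ be an $\in$-theory extending $\mathsf{ZFC}$. (i) Let $A$ be in the MC-spectrum of $R$ with $\in_{\Delta_0}\subseteq\in_A$. Then every model of $\mathsf{MC}(R,A)$ satisfies extensionality, foundation and choice, is closed under the Gödel operations, and satisfies the replacement axiom for every $\Sigma_1$-formula $\psi(x,y)$ of $\in_{\Delta_0}$ such that $R+T_{\in,A}\models\forall x\exists y\,\psi(x,y)$. (ii) Let $A$ be in the MC-spectrum of $R$ with $\in_{\Delta_0}\subseteq\in_A$, and let $\lambda$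 be an $R$-definable cardinal with $(\varphi_\lambda,1)\in A$, so that $\lambda$ is represented by the constant symbol $f_{\varphi_\lambda}$ of $\in_A$. Assume that for every model $\mathcal M$ of $R+T_{\in,A}$, $H_{\lambda^+}^{\mathcal M}$ is a substructure of $\mathcal M$ and $H_{\lambda^+}^{\mathcal M}\prec_1\mathcal M$. Then the sentence "for every nonempty $x$ there is a surjection $f:\lambda\to x$" is in $\mathsf{MC}(R,A)$. (iii) To every $R$-definable infinite cardinal $\lambda$ one can assign a set $A_\lambda$ in the AMC-spectrum of $R$ with $\in_{\Delta_0}\subseteq\in_{A_\lambda}$ such that, for every model $\mathcal M$ of $R+T_{\in,A_\lambda}$, $H_{\lambda^+}^{\mathcal M}$ is a substructure of $\mathcal M$, and $\mathsf{AMC}(R,A_\lambda)$ is the $\in_{A_\lambda}$-theory common to the structures $H_{\lambda^+}^{\mathcal M}$, as $\mathcal M$ ranges over the models of $R+T_{\in,A_\lambda}$. Moreover the assignment can be chosen so that, whenever $\lambda,\kappa$ are $R$-definable infinite cardinals and $\mathcal M$ is a model of $R$ (expanded to a model of $T_{\in,A_\lambda}$ and of $T_{\in,A_\kappa}$) with $\mathcal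 M\models\lambda<\kappa$, then $H_{\lambda^+}^{\mathcal M}\subseteq H_{\kappa^+}^{\mathcal M}$, and the set $H_{\lambda^+}^{\mathcal M}$ and the interpretation on it of every symbol of $\in_{A_\lambda}$ are definable without parameters in the $\in_{A_\kappa}$-structure $H_{\kappa^+}^{\mathcal M}$. -/

import Mathlib

open FirstOrder FirstOrder.Language

universe u

namespace AMCSpectrum

/-! ## Model companions and absolute model companions -/

section ModelTheory

/-- The universal sentences that follow from `T`. -/
def univConsequences {L : FirstOrder.Language.{0, 0}} (T : L.Theory) : Set L.Sentence :=
  {σ | BoundedFormula.IsUniversal σ ∧ T ⊨ᵇ σ}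

/-- Boolean combinations of universal sentences (all connectives are built from `⊥` and `⟹`, and
`⊥` is itself universal). -/
inductive IsBoolUniversal {L : FirstOrder.Language.{0, 0}} : L.Sentence → Prop
  | univ {σ : L.Sentence} : BoundedFormula.IsUniversal σ → IsBoolUniversal σ
  | imp {σ τ : L.Sentence} : IsBoolUniversal σ → IsBoolUniversal τ → IsBoolUniversal (σ.imp τ)

/-- The boolean combinations of universal sentences that follow from `T`. -/
def boolUnivConsequences {L : FirstOrder.Language.{0, 0}} (T : L.Theory) : Set L.Sentence :=
  {σ | IsBoolUniversal σ ∧ T ⊨ᵇ σ}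

/-- `T` is model complete: embeddings between (nonempty) models of `T` are elementary. -/
def IsModelComplete {L : FirstOrder.Language.{0, 0}} (T : L.Theory) : Prop :=
  ∀ (M N : Type u) [L.Structure M] [L.Structure N] [Nonempty M] [Nonempty N],
    M ⊨ T → N ⊨ T → ∀ (f : M ↪[L] N) (n : ℕ) (φ : L.Formula (Fin n)) (v : Fin n → M),
      φ.Realize (f ∘ v) ↔ φ.Realize v

/-- `S` is the model companion of `T`. -/
def IsModelCompanion {L : FirstOrder.Language.{0, 0}} (S T : L.Theory) : Prop :=
  univConsequences S = univConsequences T ∧ IsModelComplete.{u} S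

/-- `S` is the absolute model companion of `T`. -/
def IsAbsoluteModelCompanion {L : FirstOrder.Language.{0, 0}} (S T : L.Theory) : Prop :=
  boolUnivConsequences S = boolUnivConsequences T ∧ IsModelComplete.{u} S

/-- `N ≺₁ M`: existential formulas with parameters in `N` have the same truth value in `N` and
`M`. -/
def IsSigmaOneElementary {L : FirstOrder.Language.{0, 0}} {M : Type*} [L.Structure M]
    (N : L.Substructure M) : Prop :=
  ∀ (n : ℕ) (φ : L.Formula (Fin n)), BoundedFormula.IsExistential φ → ∀ v : Fin n → N,
    φ.Realize v ↔ φ.Realize (fun i => (v i : M))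

end ModelTheory

/-! ## Writing formulas

A variable of a formula in `L.BoundedFormula α n` is an element of `α ⊕ Fin n`. -/

section Syntactic

variable {L : FirstOrder.Language.{0, 0}} {α β : Type} {n : ℕ}

/-- A variable, seen in the scope of one more quantifier. -/
def up (x : α ⊕ Fin n) : α ⊕ Fin (n + 1) := Sum.map id Fin.castSucc x

postfix:max "↟" => AMCSpectrum.up

/-- `∀ x, f x`. -/
def allF (f : α ⊕ Fin (n + 1) → L.BoundedFormula α (n + 1)) : L.BoundedFormula α n :=
  ∀' (f (Sum.inr (Fin.last n)))

/-- `∃ x, f x`. -/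
def exF (f : α ⊕ Fin (n + 1) → L.BoundedFormula α (n + 1)) : L.BoundedFormula α n :=
  ∃' (f (Sum.inr (Fin.last n)))

/-- `x = y`. -/
def eqF (x y : α ⊕ Fin n) : L.BoundedFormula α n := (Term.var x) =' (Term.var y)

/-- The formula `φ`, with the variables `g` put in the place of its own free variables. -/
def plug (φ : L.Formula β) (g : β → α ⊕ Fin n) : L.BoundedFormula α n :=
  BoundedFormula.relabel g φ

/-- `∃! y, φ(y, x₁, …, xₙ)`, the variables `x₁, …, xₙ` being `g`. -/
def exUniqueF {k : ℕ} (φ : L.Formula (Fin (k + 1))) (g : Fin k → α ⊕ Fin n) :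
    L.BoundedFormula α n :=
  exF fun z => allF fun y => plug φ (Fin.cons y fun i => (g i)↟↟) ⇔ eqF y z↟

end Syntactic

/-! ## Partial Morleyizations -/

section Morley

/-- The formulas `φ(x₀, …, xₙ)` of a signature. -/
abbrev Form (L : FirstOrder.Language.{0, 0}) : Type := Σ n : ℕ, L.Formula (Fin (n + 1))

/-- Function symbols of `L_A`: those of `L`, an `n`-ary symbol `f_φ` for each `(φ, 1) ∈ A`, and
the constant `c` if there is at least one such pair. -/
inductive MorleyFunctions (L : FirstOrder.Language.{0, 0}) (A : Set (Form L × Fin 2)) : ℕ → Type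
  | base {n : ℕ} (f : L.Functions n) : MorleyFunctions L A n
  | funSymb {n : ℕ} (φ : L.Formula (Fin (n + 1))) (h : ((⟨n, φ⟩ : Form L), (1 : Fin 2)) ∈ A) :
      MorleyFunctions L A n
  | default (h : ∃ φ : Form L, (φ, (1 : Fin 2)) ∈ A) : MorleyFunctions L A 0

/-- Relation symbols of `L_A`: those of `L`, and an `(n+1)`-ary symbol `R_φ` for each
`(φ, 0) ∈ A`. -/
inductive MorleyRelations (L : FirstOrder.Language.{0, 0}) (A : Set (Form L × Fin 2)) : ℕ → Type
  | base {n : ℕ} (r : L.Relations n) : MorleyRelations L A n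
  | relSymb {n : ℕ} (φ : L.Formula (Fin (n + 1))) (h : ((⟨n, φ⟩ : Form L), (0 : Fin 2)) ∈ A) :
      MorleyRelations L A (n + 1)

/-- The signature `L_A`. -/
def morley (L : FirstOrder.Language.{0, 0}) (A : Set (Form L × Fin 2)) : FirstOrder.Language.{0, 0} :=
  ⟨MorleyFunctions L A, MorleyRelations L A⟩

/-- The inclusion of `L` in `L_A`. -/
def incl {L : FirstOrder.Language.{0, 0}} (A : Set (Form L × Fin 2)) : L →ᴸ morley L A where
  onFunction := fun _ f => MorleyFunctions.base f
  onRelation := fun _ r => MorleyRelations.base r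

/-- The inclusion of `L_A` in `L_B`, for `A ⊆ B`. -/
def morleyMono {L : FirstOrder.Language.{0, 0}} {A B : Set (Form L × Fin 2)} (h : A ⊆ B) :
    morley L A →ᴸ morley L B where
  onFunction := fun _ f => match f with
    | MorleyFunctions.base f => MorleyFunctions.base f
    | MorleyFunctions.funSymb φ hφ => MorleyFunctions.funSymb φ (h hφ)
    | MorleyFunctions.default hA => MorleyFunctions.default (hA.imp fun _ hφ => h hφ)
  onRelation := fun _ r => match r with
    | MorleyRelations.base r => MorleyRelations.base r
    | MorleyRelations.relSymb φ hφ => MorleyRelations.relSymb φ (h hφ)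

/-- The constant `c` of `L_A`. -/
def defaultConst {L : FirstOrder.Language.{0, 0}} {A : Set (Form L × Fin 2)}
    (h : ∃ φ : Form L, (φ, (1 : Fin 2)) ∈ A) : (morley L A).Constants :=
  MorleyFunctions.default h

/-- `∀ x₀ … xₙ, φ(x₀, …, xₙ) ↔ R_φ(x₀, …, xₙ)`. -/
def axZero {L : FirstOrder.Language.{0, 0}} {A : Set (Form L × Fin 2)} {n : ℕ} (φ : L.Formula (Fin (n + 1)))
    (h : ((⟨n, φ⟩ : Form L), (0 : Fin 2)) ∈ A) : (morley L A).Sentence :=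
  BoundedFormula.alls (n := n + 1)
    (plug ((incl A).onFormula φ) Sum.inr ⇔
      Relations.boundedFormula (L := morley L A) (MorleyRelations.relSymb φ h)
        (fun i => Term.var (Sum.inr i)))

/-- The term `f_φ(x₁, …, xₙ)`. -/
def funTerm {L : FirstOrder.Language.{0, 0}} {A : Set (Form L × Fin 2)} {n : ℕ} (φ : L.Formula (Fin (n + 1)))
    (h : ((⟨n, φ⟩ : Form L), (1 : Fin 2)) ∈ A) {α : Type} {k : ℕ} (g : Fin n → α ⊕ Fin k) :
    (morley L A).Term (α ⊕ Fin k) :=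
  Term.func (L := morley L A) (MorleyFunctions.funSymb φ h) (fun i => Term.var (g i))

/-- `∀ x₁ … xₙ, (∃! y, φ(y, x₁, …, xₙ)) → φ(f_φ(x₁, …, xₙ), x₁, …, xₙ)` and
`¬ (∃! y, φ(y, x₁, …, xₙ)) → f_φ(x₁, …, xₙ) = c`. -/
def axOne {L : FirstOrder.Language.{0, 0}} {A : Set (Form L × Fin 2)} {n : ℕ} (φ : L.Formula (Fin (n + 1)))
    (h : ((⟨n, φ⟩ : Form L), (1 : Fin 2)) ∈ A) : (morley L A).Sentence :=
  BoundedFormula.alls (n := n)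
    ((exUniqueF ((incl A).onFormula φ) Sum.inr ⟹
        allF fun y => (Term.var y =' funTerm φ h fun i => (Sum.inr i)↟) ⟹
          plug ((incl A).onFormula φ) (Fin.cons y fun i => (Sum.inr i)↟)) ⊓
      (∼(exUniqueF ((incl A).onFormula φ) Sum.inr) ⟹
        (funTerm φ h Sum.inr =' (defaultConst ⟨_, h⟩).term)))

/-- The theory of the partial Morleyization of `L` along `A`. -/
def morleyTheory {L : FirstOrder.Language.{0, 0}} (A : Set (Form L × Fin 2)) : (morley L A).Theory :=
  {σ | (∃ (n : ℕ) (φ : L.Formula (Fin (n + 1))) (h : ((⟨n, φ⟩ : Form L), (0 : Fin 2)) ∈ A),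
      σ = axZero φ h) ∨
    (∃ (n : ℕ) (φ : L.Formula (Fin (n + 1))) (h : ((⟨n, φ⟩ : Form L), (1 : Fin 2)) ∈ A),
      σ = axOne φ h)}

end Morley

/-! ## The language of set theory -/

/-- The only symbol is the binary relation symbol `∈`. -/
inductive SetRel : ℕ → Type
  | mem : SetRel 2

/-- The signature `{∈}`. -/
def LSet : FirstOrder.Language.{0, 0} := ⟨fun _ => Empty, SetRel⟩

section Vocabulary

variable {α : Type} {n : ℕ}

/-- `x ∈ y`. -/
def mem (x y : α ⊕ Fin n) : LSet.BoundedFormula α n :=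
  Relations.boundedFormula₂ (L := LSet) SetRel.mem (Term.var x) (Term.var y)

/-- `Δ₀`-formulas: all quantifiers are bounded. -/
inductive IsDeltaZero {α : Type} : ∀ {n : ℕ}, LSet.BoundedFormula α n → Prop
  | falsum {n : ℕ} : IsDeltaZero (⊥ : LSet.BoundedFormula α n)
  | eq {n : ℕ} (x y : α ⊕ Fin n) : IsDeltaZero (eqF x y)
  | mem {n : ℕ} (x y : α ⊕ Fin n) : IsDeltaZero (mem x y)
  | imp {n : ℕ} {φ ψ : LSet.BoundedFormula α n} :
      IsDeltaZero φ → IsDeltaZero ψ → IsDeltaZero (φ ⟹ ψ)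
  | ball {n : ℕ} (x : α ⊕ Fin n) {φ : LSet.BoundedFormula α (n + 1)} :
      IsDeltaZero φ → IsDeltaZero (allF fun y => AMCSpectrum.mem y x↟ ⟹ φ)
  | bex {n : ℕ} (x : α ⊕ Fin n) {φ : LSet.BoundedFormula α (n + 1)} :
      IsDeltaZero φ → IsDeltaZero (exF fun y => AMCSpectrum.mem y x↟ ⊓ φ)

/-- `x` has an element. -/
def nonemptyF (x : α ⊕ Fin n) : LSet.BoundedFormula α n := exF fun y => mem y x↟

/-- `x ⊆ y`. -/
def subsetF (x y : α ⊕ Fin n) : LSet.BoundedFormula α n :=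
  allF fun z => mem z x↟ ⟹ mem z y↟

/-- `z = {x, y}`. -/
def isUPair (z x y : α ⊕ Fin n) : LSet.BoundedFormula α n :=
  allF fun w => mem w z↟ ⇔ (eqF w x↟ ⊔ eqF w y↟)

/-- `p = (x, y) = {{x}, {x, y}}`. -/
def isPair (p x y : α ⊕ Fin n) : LSet.BoundedFormula α n :=
  exF fun a => exF fun b =>
    isUPair a↟ x↟↟ x↟↟ ⊓ isUPair b x↟↟ y↟↟ ⊓ isUPair p↟↟ a↟ b

/-- `p = (x, y, z) = ((x, y), z)`. -/
def isTriple (p x y z : α ⊕ Fin n) : LSet.BoundedFormula α n :=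
  exF fun q => isPair q x↟ y↟ ⊓ isPair p↟ q z↟

/-- `(x, y) ∈ r`. -/
def pairIn (r x y : α ⊕ Fin n) : LSet.BoundedFormula α n :=
  exF fun p => isPair p x↟ y↟ ⊓ mem p r↟

/-- `(x, y, z) ∈ r`. -/
def tripleIn (r x y z : α ⊕ Fin n) : LSet.BoundedFormula α n :=
  exF fun p => isTriple p x↟ y↟ z↟ ⊓ mem p r↟

/-- `f` is a function with domain `x`. -/
def isFunOn (f x : α ⊕ Fin n) : LSet.BoundedFormula α n :=
  (allF fun p => mem p f↟ ⟹ exF fun a => exF fun b => mem a↟ x↟↟↟ ⊓ isPair p↟↟ a↟ b) ⊓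
  (allF fun a => mem a x↟ ⟹ exF fun b => allF fun b₁ => pairIn f↟↟↟ a↟↟ b₁ ⇔ eqF b₁ b↟)

/-- `f : x → y`. -/
def isFun (f x y : α ⊕ Fin n) : LSet.BoundedFormula α n :=
  isFunOn f x ⊓ allF fun a => allF fun b => pairIn f↟↟ a↟ b ⟹ mem b y↟↟

/-- `f : x → y` is a surjection. -/
def isSurj (f x y : α ⊕ Fin n) : LSet.BoundedFormula α n :=
  isFun f x y ⊓ allF fun b => mem b y↟ ⟹ exF fun a => mem a x↟↟ ⊓ pairIn f↟↟ a b↟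

/-- `f : x → y` is an injection. -/
def isInj (f x y : α ⊕ Fin n) : LSet.BoundedFormula α n :=
  isFun f x y ⊓ allF fun a => allF fun a₁ => allF fun b =>
    (pairIn f↟↟↟ a↟↟ b ⊓ pairIn f↟↟↟ a₁↟ b) ⟹ eqF a↟↟ a₁↟

/-- `x` is transitive. -/
def isTransitive (x : α ⊕ Fin n) : LSet.BoundedFormula α n :=
  allF fun y => mem y x↟ ⟹ subsetF y x↟

/-- `x` is an ordinal: transitive and linearly ordered by `∈`. -/
def isOrd (x : α ⊕ Fin n) : LSet.BoundedFormula α n :=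
  isTransitive x ⊓ allF fun y => allF fun z =>
    (mem y↟ x↟↟ ⊓ mem z x↟↟) ⟹ (mem y↟ z ⊔ eqF y↟ z ⊔ mem z y↟)

/-- `x` is a cardinal: an ordinal which is not the surjective image of one of its elements. -/
def isCard (x : α ⊕ Fin n) : LSet.BoundedFormula α n :=
  isOrd x ⊓ allF fun d => allF fun f => mem d↟ x↟↟ ⟹ ∼(isSurj f d↟ x↟↟)

/-- `x` is nonempty without `∈`-maximal element; for ordinals: `x` is a nonzero limit. -/
def isLimitLike (x : α ⊕ Fin n) : LSet.BoundedFormula α n :=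
  nonemptyF x ⊓ allF fun y => mem y x↟ ⟹ exF fun z => mem z x↟↟ ⊓ mem y↟ z

/-- `x = ω`: the least nonzero limit ordinal. -/
def isOmega (x : α ⊕ Fin n) : LSet.BoundedFormula α n :=
  isOrd x ⊓ isLimitLike x ⊓ allF fun y => mem y x↟ ⟹ ∼(isLimitLike y)

/-- `ω ⊆ x`. -/
def isInfinite (x : α ⊕ Fin n) : LSet.BoundedFormula α n :=
  exF fun w => isOmega w ⊓ subsetF w x↟

/-- `t` is the transitive closure of `x`. -/
def isTrcl (t x : α ⊕ Fin n) : LSet.BoundedFormula α n :=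
  isTransitive t ⊓ subsetF x t ⊓
    allF fun s => (isTransitive s ⊓ subsetF x↟ s) ⟹ subsetF t↟ s

/-- `x ∈ H_{l⁺}`: the transitive closure of `x` has size at most `l`. -/
def inHPlus (l x : α ⊕ Fin n) : LSet.BoundedFormula α n :=
  exF fun t => isTrcl t x↟ ⊓ exF fun f => isInj f t↟ l↟↟

end Vocabulary

/-! ## Axioms -/

section Axioms

def extensionality : LSet.Sentence :=
  allF fun x => allF fun y => (allF fun z => mem z x↟↟ ⇔ mem z y↟) ⟹ eqF x↟ y

def foundation : LSet.Sentence :=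
  allF fun x => nonemptyF x ⟹
    exF fun y => mem y x↟ ⊓ ∼(exF fun z => mem z x↟↟ ⊓ mem z y↟)

def pairing : LSet.Sentence :=
  allF fun x => allF fun y => exF fun z => isUPair z x↟↟ y↟

def union : LSet.Sentence :=
  allF fun x => exF fun u => allF fun z =>
    mem z u↟ ⇔ exF fun y => mem y x↟↟↟ ⊓ mem z↟ y

def powerset : LSet.Sentence :=
  allF fun x => exF fun p => allF fun z => mem z p↟ ⇔ subsetF z x↟↟

/-- There is a set that contains the empty set and, with `x`, also `x ∪ {x}`. -/
def infinity : LSet.Sentence :=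
  exF fun w => (exF fun e => ∼(nonemptyF e) ⊓ mem e w↟) ⊓
    allF fun x => mem x w↟ ⟹ exF fun y =>
      (allF fun z => mem z y↟ ⇔ (mem z x↟↟ ⊔ eqF z x↟↟)) ⊓ mem y w↟↟

/-- Every set of nonempty sets has a choice function. -/
def choice : LSet.Sentence :=
  allF fun x => (allF fun y => mem y x↟ ⟹ nonemptyF y) ⟹
    exF fun f => isFunOn f x↟ ⊓
      allF fun y => mem y x↟↟ ⟹ exF fun z => mem z y↟ ⊓ pairIn f↟↟ y↟ z

/-- Separation for `φ(z, p₁, …, pₙ)`. -/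
def separation {n : ℕ} (φ : LSet.Formula (Fin (n + 1))) : LSet.Sentence :=
  BoundedFormula.alls (n := n) (allF fun x => exF fun y => allF fun z =>
    mem z y↟ ⇔ (mem z x↟↟ ⊓ plug φ (Fin.cons z fun i => (Sum.inr i)↟↟↟)))

/-- Replacement for a formula `φ(x, y, p₁, …, pₙ)` of a signature `L` containing `∈`: for every
set `X`, if for all `x ∈ X` there is `y` with `φ(x, y, p)`, then there is a function `f` with
domain `X` such that `φ(x, f(x), p)` for all `x ∈ X`. -/
def replacement {L : FirstOrder.Language.{0, 0}} (ι : LSet →ᴸ L) {n : ℕ} (φ : L.Formula (Fin (n + 2))) :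
    L.Sentence :=
  BoundedFormula.alls (n := n) (allF fun X =>
    (allF fun x => ι.onBoundedFormula (mem x X↟) ⟹
      exF fun y => plug φ (Fin.cons x↟ (Fin.cons y fun i => (Sum.inr i)↟↟↟))) ⟹
    exF fun f => ι.onBoundedFormula (isFunOn f X↟) ⊓
      allF fun x => allF fun y => ι.onBoundedFormula (pairIn f↟↟ x↟ y) ⟹
        plug φ (Fin.cons x↟ (Fin.cons y fun i => (Sum.inr i)↟↟↟↟)))

def ZFC : LSet.Theory :=
  {extensionality, foundation, pairing, union, powerset, infinity, choice} ∪
  {σ | ∃ (n : ℕ) (φ : LSet.Formula (Fin (n + 1))), σ = separation φ} ∪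
  {σ | ∃ (n : ℕ) (φ : LSet.Formula (Fin (n + 2))), σ = replacement (LHom.id LSet) φ}

end Axioms

/-! ## Gödel operations -/

section Goedel

/-- The graphs `z = G(x, y)` of the binary Gödel operations `{x, y}`, `x × y`,
`{(a, b) : a ∈ x, b ∈ y, a ∈ b}`, `x \ y`, `x ∩ y`; the variables `z, x, y` are `0, 1, 2`. -/
def goedelBinary : Fin 5 → LSet.Formula (Fin 3) :=
  let z : Fin 3 ⊕ Fin 0 := Sum.inl 0
  let x : Fin 3 ⊕ Fin 0 := Sum.inl 1
  let y : Fin 3 ⊕ Fin 0 := Sum.inl 2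
  ![isUPair z x y,
    allF fun w => mem w z↟ ⇔ exF fun a => exF fun b =>
      mem a↟ x↟↟↟ ⊓ mem b y↟↟↟ ⊓ isPair w↟↟ a↟ b,
    allF fun w => mem w z↟ ⇔ exF fun a => exF fun b =>
      mem a↟ x↟↟↟ ⊓ mem b y↟↟↟ ⊓ mem a↟ b ⊓ isPair w↟↟ a↟ b,
    allF fun w => mem w z↟ ⇔ (mem w x↟ ⊓ ∼(mem w y↟)),
    allF fun w => mem w z↟ ⇔ (mem w x↟ ⊓ mem w y↟)]

/-- The graphs `z = G(x)` of the unary Gödel operations `⋃ x`, `dom x`, `{(a, b) : (b, a) ∈ x}`,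
`{(a, b, c) : (a, c, b) ∈ x}`, `{(a, b, c) : (b, c, a) ∈ x}`; the variables `z, x` are `0, 1`. -/
def goedelUnary : Fin 5 → LSet.Formula (Fin 2) :=
  let z : Fin 2 ⊕ Fin 0 := Sum.inl 0
  let x : Fin 2 ⊕ Fin 0 := Sum.inl 1
  ![allF fun w => mem w z↟ ⇔ exF fun a => mem a x↟↟ ⊓ mem w↟ a,
    allF fun w => mem w z↟ ⇔ exF fun b => pairIn x↟↟ w↟ b,
    allF fun w => mem w z↟ ⇔ exF fun a => exF fun b =>
      isPair w↟↟ a↟ b ⊓ pairIn x↟↟↟ b a↟,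
    allF fun w => mem w z↟ ⇔ exF fun a => exF fun b => exF fun c =>
      isTriple w↟↟↟ a↟↟ b↟ c ⊓ tripleIn x↟↟↟↟ a↟↟ c b↟,
    allF fun w => mem w z↟ ⇔ exF fun a => exF fun b => exF fun c =>
      isTriple w↟↟↟ a↟↟ b↟ c ⊓ tripleIn x↟↟↟↟ b↟ c a↟↟]

/-- Every two sets have an image under the `i`-th binary Gödel operation. -/
def closedBinary (i : Fin 5) : LSet.Sentence :=
  allF fun x => allF fun y => exF fun z => plug (goedelBinary i) ![z, x↟↟, y↟]

/-- Every set has an image under the `i`-th unary Gödel operation. -/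
def closedUnary (i : Fin 5) : LSet.Sentence :=
  allF fun x => exF fun z => plug (goedelUnary i) ![z, x↟]

end Goedel

/-! ## Expanded signatures for set theory -/

section Expanded

/-- The pairs giving the signature `∈_{Δ₀}`: predicate symbols for the `Δ₀`-formulas, a constant
symbol for `ω`, and function symbols for the Gödel operations. -/
def deltaZero : Set (Form LSet × Fin 2) :=
  {a | ∃ (n : ℕ) (φ : LSet.Formula (Fin (n + 1))), IsDeltaZero φ ∧ a = (⟨n, φ⟩, 0)} ∪
  {(⟨0, isOmega (Sum.inl 0)⟩, 1)} ∪
  {a | ∃ i, a = (⟨2, goedelBinary i⟩, 1)} ∪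
  {a | ∃ i, a = (⟨1, goedelUnary i⟩, 1)}

/-- The theory `T_{∈,A}`: the Morleyization axioms, and the axiom `∀ x, (∀ y, y ∉ x) ↔ c = x` if
`c` is a symbol of `∈_A`. -/
def setMorleyTheory (A : Set (Form LSet × Fin 2)) : (morley LSet A).Theory :=
  morleyTheory A ∪
  {σ | ∃ h : ∃ φ : Form LSet, (φ, (1 : Fin 2)) ∈ A,
    σ = allF fun x => (incl A).onBoundedFormula (∼(nonemptyF x)) ⇔
      ((defaultConst h).term =' Term.var x)}

/-- The theory `R + T_{∈,A}`. -/
def expand (R : LSet.Theory) (A : Set (Form LSet × Fin 2)) : (morley LSet A).Theory :=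
  (incl A).onTheory R ∪ setMorleyTheory A

/-- `φ` defines a cardinal in `R`. -/
def IsDefinableCardinal (R : LSet.Theory) (φ : LSet.Formula (Fin 1)) : Prop :=
  R ⊨ᵇ (exUniqueF φ Fin.elim0 : LSet.Sentence) ∧
  R ⊨ᵇ (allF fun x => plug φ (fun _ => x) ⟹ isCard x : LSet.Sentence)

/-- `φ` defines an infinite cardinal in `R`. -/
def IsDefinableInfiniteCardinal (R : LSet.Theory) (φ : LSet.Formula (Fin 1)) : Prop :=
  IsDefinableCardinal R φ ∧
  R ⊨ᵇ (allF fun x => plug φ (fun _ => x) ⟹ isInfinite x : LSet.Sentence)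

/-- Satisfaction of a formula of the signature `{∈}` in an `∈_A`-structure. -/
def holds {A : Set (Form LSet × Fin 2)} {M : Type*} [(morley LSet A).Structure M] {β : Type}
    (φ : LSet.Formula β) (v : β → M) : Prop :=
  ((incl A).onFormula φ).Realize v

/-- `H_{λ⁺}` as computed in the `∈_A`-structure `M`, where `λ` is the cardinal defined by `φ`. -/
def hPlus (A : Set (Form LSet × Fin 2)) (φ : LSet.Formula (Fin 1)) (M : Type*)
    [(morley LSet A).Structure M] : Set M :=
  {x | ∃ l : M, holds (A := A) φ ![l] ∧
    holds (A := A) (inHPlus (Sum.inl 0) (Sum.inl 1) : LSet.Formula (Fin 2)) ![l, x]}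

/-- The `∈_A`-theory common to the structures `H_{λ⁺}` of the models of `R + T_{∈,A}`. -/
def hPlusTheory (R : LSet.Theory) (A : Set (Form LSet × Fin 2)) (φ : LSet.Formula (Fin 1)) :
    (morley LSet A).Theory :=
  {σ | ∀ (M : Type u) [(morley LSet A).Structure M] [Nonempty M], M ⊨ expand R A →
    ∀ N : (morley LSet A).Substructure M, (N : Set M) = hPlus A φ M → N ⊨ σ}

/-- `∀ x ≠ ∅, ∃ f, f : λ → x is a surjection`, where `λ` is a constant symbol of `∈_A`. -/
def surjectiveImages {A : Set (Form LSet × Fin 2)} (c : (morley LSet A).Constants) :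
    (morley LSet A).Sentence :=
  allF fun l => (Term.var l =' c.term) ⟹ (incl A).onBoundedFormula
    (allF fun x => nonemptyF x ⟹ exF fun f => isSurj f l↟↟ x↟)

/-- The substructure with domain `D₁` of an `∈_A`-structure `M` is definable, without parameters,
in the substructure `N₂` of an `∈_B`-structure on the same set `M`. -/
def IsDefinableIn {A B : Set (Form LSet × Fin 2)} {M : Type*} [(morley LSet A).Structure M]
    [(morley LSet B).Structure M] (D₁ : Set M) (N₂ : (morley LSet B).Substructure M) : Prop :=
  D₁ ⊆ N₂ ∧
  (∅ : Set N₂).Definable (morley LSet B) {v : Fin 1 → N₂ | (v 0 : M) ∈ D₁} ∧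
  (∀ (n : ℕ) (r : (morley LSet A).Relations n),
    (∅ : Set N₂).Definable (morley LSet B)
      {v : Fin n → N₂ | (∀ i, (v i : M) ∈ D₁) ∧ Structure.RelMap r (fun i => (v i : M))}) ∧
  (∀ (n : ℕ) (f : (morley LSet A).Functions n),
    (∅ : Set N₂).Definable (morley LSet B)
      {v : Fin (n + 1) → N₂ | (∀ i, (v i : M) ∈ D₁) ∧
        Structure.funMap f (fun i => (v i.succ : M)) = (v 0 : M)})

end Expanded

end AMCSpectrum

open AMCSpectrum

/-! Everything rests on maps `j : M → K` that reflect the formulas `∃ ys, χ` with `χ` a Δ₀-formula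
(`DeltaEmb`). Along such a map Δ₀-formulas are absolute (`DeltaEmb.absolute`), so any "for every `x`
there is `y` with a Δ₀-property" that holds in `K` holds in `M`.

For (i), let `M` be a model of the model companion `S` of `T`. Since `S` and `T` have the same
universal consequences, compactness embeds `M` into a model `K` of `T`, and `K` into a model `N` of
`S`. By model completeness `M → N` is elementary, so an existential formula true in `K` goes up to
`N` and comes back to `M` (`IsModelCompanion.exists_embedding`). As `∈_A` has a predicate for each
Δ₀-formula, `M → K` is a `DeltaEmb`. For replacement, a Σ₁-formula of `∈_{Δ₀}` is rewritten as `∃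
Δ₀` over `∈` by naming the values of its terms (`BoolClass`); in `K` there are a function `f` on `X`
and a set `D` bounding all witnesses, and the statement about `X, f, D` is Δ₀, so such `f, D` exist
in `M` (`DeltaEmb.replacement`).

For (ii), Σ₁-elementarity gives the common theory of the structures `H_{λ⁺}` the same universal
consequences as `R + T_{∈,A}`. Hence `S` is also its model companion, and the argument above applies
with `K` a model of that common theory.

For (iii), the signature `coverSet` adds to `∈_{Δ₀}`, for every ∈-formula `χ`, a predicate saying
that the `xᵢ` lie in a transitive set `s` enumerated by `f` on `λ`, and that `χ(x)` holds in the
whole universe. Tuples in `H_{λ⁺}` always have such `s` and `f` there, so `∃ s f` expresses truth of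
`χ` in the universe by an existential formula over `H_{λ⁺}`. A formula interpreted in `H_{λ⁺}` is a
formula about the universe, so all formulas become existential, and model completeness follows. The
same coding defines in `H_{κ⁺}` every relation on it that is definable in the universe, in
particular `H_{λ⁺}` for `λ < κ`.

A universal sentence failing in `M` fails in `H_{λ⁺}`: inside a transitive set, take a hull of size
`λ` that contains `λ ∪ {λ}` and the failing tuple and has witnesses for finitely many formulas
(`InfCard.exists_hull`), and collapse it. The collapse lands in `H_{λ⁺}` and preserves the relevant
Δ₀-formulas; it preserves the new predicates because `s` is contained in the hull, so that its
elements are not moved (`reflectClass_cover`).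

The models of ZFC are arbitrary, so ordinals, recursion, the collapse and `λ · λ = λ` are developed
internally, with definability with parameters tracked by instances. -/

namespace AMCSpectrum

/-! ## Predicates definable with parameters -/

section Definability

variable {M : Type u} [LSet.Structure M]

/-- Membership in a structure for the language of set theory. -/
def E (x y : M) : Prop := Structure.RelMap (L := LSet) SetRel.mem ![x, y]

infix:50 "∊" => E

/-- Contexts: types of assignments, with the functions that count as variables or parameters. -/
class Ctx (M : Type u) (Γ : Type u) where
  vars : Set (Γ → M)
  const_mem : ∀ c : M, (fun _ => c) ∈ vars

instance Ctx.base : Ctx M PUnit.{u + 1} where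
  vars := {f | ∃ c, f = fun _ => c}
  const_mem c := ⟨c, rfl⟩

instance Ctx.ext {Γ : Type u} [Ctx M Γ] : Ctx M (Γ × M) where
  vars := {f | f = Prod.snd ∨ ∃ g ∈ Ctx.vars (M := M) (Γ := Γ), f = fun p => g p.1}
  const_mem c := Or.inr ⟨_, Ctx.const_mem c, rfl⟩

/-- The predicate `P` is first-order definable with parameters. -/
class Dfn (M : Type u) [LSet.Structure M] {Γ : Type u} [Ctx M Γ] (P : Γ → Prop) : Prop where
  out : ∃ φ : LSet.Formula (Ctx.vars (M := M) (Γ := Γ)), ∀ γ, P γ ↔ φ.Realize fun f => f.1 γ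

/-- The function `f` is first-order definable with parameters. -/
class DF {M : Type u} [LSet.Structure M] {Γ : Type u} [Ctx M Γ] (f : Γ → M) : Prop where
  out : Dfn M fun p : Γ × M => p.2 = f p.1

/-- Definability of unary predicates. -/
abbrev Dfn₁ {M : Type u} [LSet.Structure M] (P : M → Prop) : Prop :=
  Dfn M fun p : PUnit.{u + 1} × M => P p.2

/-- Definability of binary predicates. -/
abbrev Dfn₂ {M : Type u} [LSet.Structure M] (P : M → M → Prop) : Prop :=
  Dfn M fun p : (PUnit.{u + 1} × M) × M => P p.1.2 p.2

/-- Definability of unary functions. -/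
abbrev DF₁ {M : Type u} [LSet.Structure M] (F : M → M) : Prop :=
  DF fun p : PUnit.{u + 1} × M => F p.2

variable {Γ Δ : Type u} [Ctx M Γ] [Ctx M Δ]

theorem Dfn.congr {P Q : Γ → Prop} (h : Dfn M P) (hPQ : ∀ γ, Q γ ↔ P γ) : Dfn M Q := by
  obtain ⟨φ, hφ⟩ := h.out
  exact ⟨φ, fun γ => (hPQ γ).trans (hφ γ)⟩

theorem Dfn.reindex {P : Δ → Prop} (hP : Dfn M P) (h : Γ → Δ)
    (hh : ∀ f ∈ Ctx.vars (M := M) (Γ := Δ), (fun γ => f (h γ)) ∈ Ctx.vars (M := M) (Γ := Γ)) :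
    Dfn M fun γ => P (h γ) := by
  obtain ⟨φ, hφ⟩ := hP.out
  refine ⟨φ.relabel fun f => ⟨_, hh f.1 f.2⟩, fun γ => ?_⟩
  rw [hφ, Formula.realize_relabel]
  rfl

instance Dfn.fst {P : Γ → Prop} [hP : Dfn M P] : Dfn M fun p : Γ × M => P p.1 :=
  hP.reindex Prod.fst fun f hf => Or.inr ⟨f, hf, rfl⟩

instance Dfn.const (p : Prop) : Dfn M fun _ : Γ => p := by
  by_cases h : p
  · exact ⟨⊤, fun γ => by simp [h]⟩
  · exact ⟨⊥, fun γ => by simp [h]⟩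

instance Dfn.not {P : Γ → Prop} [hP : Dfn M P] : Dfn M fun γ => ¬ P γ := by
  obtain ⟨φ, hφ⟩ := hP.out
  exact ⟨φ.not, fun γ => by rw [Formula.realize_not, hφ]⟩

instance Dfn.imp {P Q : Γ → Prop} [hP : Dfn M P] [hQ : Dfn M Q] : Dfn M fun γ => P γ → Q γ := by
  obtain ⟨φ, hφ⟩ := hP.out
  obtain ⟨ψ, hψ⟩ := hQ.out
  exact ⟨φ.imp ψ, fun γ => by rw [Formula.realize_imp, hφ, hψ]⟩

instance Dfn.and {P Q : Γ → Prop} [hP : Dfn M P] [hQ : Dfn M Q] : Dfn M fun γ => P γ ∧ Q γ := by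
  obtain ⟨φ, hφ⟩ := hP.out
  obtain ⟨ψ, hψ⟩ := hQ.out
  exact ⟨φ ⊓ ψ, fun γ => by rw [Formula.realize_inf, hφ, hψ]⟩

instance Dfn.or {P Q : Γ → Prop} [hP : Dfn M P] [hQ : Dfn M Q] : Dfn M fun γ => P γ ∨ Q γ := by
  obtain ⟨φ, hφ⟩ := hP.out
  obtain ⟨ψ, hψ⟩ := hQ.out
  exact ⟨φ ⊔ ψ, fun γ => by rw [Formula.realize_sup, hφ, hψ]⟩

instance Dfn.iff {P Q : Γ → Prop} [hP : Dfn M P] [hQ : Dfn M Q] : Dfn M fun γ => P γ ↔ Q γ := by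
  obtain ⟨φ, hφ⟩ := hP.out
  obtain ⟨ψ, hψ⟩ := hQ.out
  exact ⟨φ.iff ψ, fun γ => by rw [Formula.realize_iff, hφ, hψ]⟩

instance Dfn.ex {P : Γ → M → Prop} [hP : Dfn M fun p : Γ × M => P p.1 p.2] :
    Dfn M fun γ => ∃ y, P γ y := by
  classical
  obtain ⟨φ, hφ⟩ := hP.out
  -- A variable of the extended context is either the new coordinate, which gets quantified, or a
  -- variable of the old context.
  have hr : ∀ f : Ctx.vars (M := M) (Γ := Γ × M), ∃ r : Ctx.vars (M := M) (Γ := Γ) ⊕ Unit,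
      ∀ γ y, f.1 (γ, y) = Sum.elim (fun g => g.1 γ) (fun _ => y) r := by
    rintro ⟨f, rfl | ⟨g, hg, rfl⟩⟩
    · exact ⟨Sum.inr (), fun _ _ => rfl⟩
    · exact ⟨Sum.inl ⟨g, hg⟩, fun _ _ => rfl⟩
  choose r hr using hr
  refine ⟨(φ.relabel r).iExs Unit, fun γ => ?_⟩
  rw [Formula.realize_iExs]
  constructor
  · rintro ⟨y, hy⟩
    refine ⟨fun _ => y, ?_⟩
    rw [Formula.realize_relabel]
    have := (hφ (γ, y)).1 hy
    convert this using 1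
    funext f
    exact (hr f γ y).symm
  · rintro ⟨y, hy⟩
    refine ⟨y (), (hφ (γ, y ())).2 ?_⟩
    rw [Formula.realize_relabel] at hy
    convert hy using 1
    funext f
    exact hr f γ (y ())

instance Dfn.all {P : Γ → M → Prop} [hP : Dfn M fun p : Γ × M => P p.1 p.2] :
    Dfn M fun γ => ∀ y, P γ y :=
  (inferInstance : Dfn M fun γ => ¬ ∃ y, ¬ P γ y).congr fun γ => by simp

theorem realize_memFormula {α : Type*} (s t : LSet.Term α) (v : α → M) :
    (Relations.formula₂ (L := LSet) SetRel.mem s t).Realize v ↔ s.realize v ∊ t.realize v :=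
  Formula.realize_rel₂

theorem Dfn.mem_var {f g : Γ → M} (hf : f ∈ Ctx.vars (M := M) (Γ := Γ))
    (hg : g ∈ Ctx.vars (M := M) (Γ := Γ)) : Dfn M fun γ => f γ ∊ g γ :=
  ⟨⟨Relations.formula₂ (L := LSet) SetRel.mem (Term.var ⟨f, hf⟩) (Term.var ⟨g, hg⟩), fun γ =>
    (realize_memFormula (α := Ctx.vars (M := M) (Γ := Γ)) (Term.var ⟨f, hf⟩) (Term.var ⟨g, hg⟩)
      fun f => f.1 γ).symm⟩⟩

theorem Dfn.eq_var {f g : Γ → M} (hf : f ∈ Ctx.vars (M := M) (Γ := Γ))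
    (hg : g ∈ Ctx.vars (M := M) (Γ := Γ)) : Dfn M fun γ => f γ = g γ :=
  ⟨⟨(Term.var ⟨f, hf⟩).equal (Term.var ⟨g, hg⟩), fun γ => by simp⟩⟩

theorem DF.var {f : Γ → M} (hf : f ∈ Ctx.vars (M := M) (Γ := Γ)) : DF f :=
  ⟨Dfn.eq_var (Or.inl rfl) (Or.inr ⟨f, hf, rfl⟩)⟩

instance DF.fst {f : Γ → M} [hf : DF f] : DF fun p : Γ × M => f p.1 := by
  refine ⟨hf.out.reindex (fun q : (Γ × M) × M => (q.1.1, q.2)) fun g hg => ?_⟩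
  rcases hg with rfl | ⟨g, hg, rfl⟩
  · exact Or.inl rfl
  · exact Or.inr ⟨_, Or.inr ⟨g, hg, rfl⟩, rfl⟩

instance DF.fst₂ {f : Γ → M} [hf : DF f] : DF fun p : (Γ × M) × M => f p.1.1 :=
  DF.fst (f := fun p : Γ × M => f p.1)

instance DF.fst₃ {f : Γ → M} [hf : DF f] : DF fun p : ((Γ × M) × M) × M => f p.1.1.1 :=
  DF.fst (f := fun p : (Γ × M) × M => f p.1.1)

theorem Dfn.snd {P : M → Prop} (hP : Dfn₁ P) : Dfn M fun p : Γ × M => P p.2 :=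
  hP.reindex (fun p : Γ × M => (PUnit.unit, p.2)) (by
    rintro f (rfl | ⟨g, ⟨c, rfl⟩, rfl⟩)
    · exact Or.inl rfl
    · exact Ctx.const_mem c)

theorem Dfn.snd_snd {P : M → M → Prop} (hP : Dfn₂ P) :
    Dfn M fun p : (Γ × M) × M => P p.1.2 p.2 :=
  hP.reindex (fun p : (Γ × M) × M => ((PUnit.unit, p.1.2), p.2)) (by
    rintro f (rfl | ⟨f, (rfl | ⟨g, ⟨c, rfl⟩, rfl⟩), rfl⟩)
    · exact Or.inl rfl
    · exact Or.inr ⟨_, Or.inl rfl, rfl⟩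
    · exact Ctx.const_mem c)

/-- Only the graph of `f` is definable, so the substitution is expressed by quantifying over the
value: `∃ y, y = f γ ∧ P y`. -/
instance Dfn.comp {P : M → Prop} [hP : Dfn₁ P] {f : Γ → M} [hf : DF f] : Dfn M fun γ => P (f γ) := by
  have h1 : Dfn M fun p : Γ × M => p.2 = f p.1 := hf.out
  have h2 : Dfn M fun p : Γ × M => P p.2 := hP.snd
  exact (inferInstance : Dfn M fun γ => ∃ y, y = f γ ∧ P y).congr fun γ => by simp

instance Dfn.comp₂ {P : M → M → Prop} [hP : Dfn₂ P] {f g : Γ → M}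
    [hf : DF f] [hg : DF g] : Dfn M fun γ => P (f γ) (g γ) := by
  have h1 : Dfn M fun p : (Γ × M) × M => p.1.2 = f p.1.1 := Dfn.fst (hP := hf.out)
  have h2 : Dfn M fun p : (Γ × M) × M => p.2 = g p.1.1 := (DF.fst (hf := hg)).out
  have h3 := hP.snd_snd (Γ := Γ)
  exact (inferInstance : Dfn M fun γ => ∃ y z, y = f γ ∧ z = g γ ∧ P y z).congr fun γ => by simp

instance Dfn.mem {f g : Γ → M} [hf : DF f] [hg : DF g] : Dfn M fun γ => f γ ∊ g γ :=
  Dfn.comp₂ (P := E) (hP := Dfn.mem_var (Or.inr ⟨_, Or.inl rfl, rfl⟩) (Or.inl rfl))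

instance Dfn.eq {f g : Γ → M} [hf : DF f] [hg : DF g] : Dfn M fun γ => f γ = g γ :=
  Dfn.comp₂ (P := Eq) (hP := Dfn.eq_var (Or.inr ⟨_, Or.inl rfl, rfl⟩) (Or.inl rfl))

instance DF.const (c : M) : DF fun _ : Γ => c := DF.var (Ctx.const_mem c)
instance DF.var₀ : DF fun p : Γ × M => p.2 := DF.var (Or.inl rfl)
instance DF.var₁ : DF fun p : (Γ × M) × M => p.1.2 := DF.fst (hf := DF.var₀)
instance DF.var₂ : DF fun p : ((Γ × M) × M) × M => p.1.1.2 := DF.fst (hf := DF.var₁)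
instance DF.var₃ : DF fun p : (((Γ × M) × M) × M) × M => p.1.1.1.2 := DF.fst (hf := DF.var₂)
instance DF.var₄ : DF fun p : ((((Γ × M) × M) × M) × M) × M => p.1.1.1.1.2 := DF.fst (hf := DF.var₃)

instance DF.comp {F : M → M} [hF : DF₁ F] {f : Γ → M} [hf : DF f] : DF fun γ => F (f γ) :=
  ⟨(Dfn.comp₂ (Γ := Γ × M) (P := fun x y => y = F x) (hP := hF.out) (f := fun p => f p.1))⟩

/-- Only finitely many variables occur in a formula. This turns formulas over an infinite set of
variables and parameters into the finite-arity formulas of the axiom schemes and of the diagram. -/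
theorem exists_formula_fin {L : FirstOrder.Language.{0, 0}} {α : Type*} (φ : L.Formula α) :
    ∃ (k : ℕ) (ψ : L.Formula (Fin k)) (s : Fin k → α), ∀ (N : Type u) [L.Structure N] (v : α → N),
      φ.Realize v ↔ ψ.Realize (v ∘ s) := by
  classical
  let e := Fintype.equivFin φ.freeVarFinset
  refine ⟨_, BoundedFormula.restrictFreeVar φ e, fun i => (e.symm i).1, fun N _ v => ?_⟩
  exact (BoundedFormula.realize_restrictFreeVar v (by simp)).symm

/-- A formula whose assignment is definable. -/
theorem Dfn.realize {α : Type} {n : ℕ} (φ : LSet.BoundedFormula α n) :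
    ∀ {Γ : Type u} [Ctx M Γ] (f : α → Γ → M) (g : Fin n → Γ → M), (∀ i, DF (f i)) →
      (∀ i, DF (g i)) → Dfn M fun γ => φ.Realize (fun i => f i γ) fun i => g i γ := by
  -- The signature has no function symbols, so every term is a variable.
  have hterm : ∀ {n : ℕ} (t : LSet.Term (α ⊕ Fin n)), ∃ x, t = Term.var x := by
    rintro n (x | ⟨F, _⟩)
    · exact ⟨x, rfl⟩
    · exact F.elim
  induction φ with
  | falsum => intros; exact Dfn.const False
  | equal t₁ t₂ =>
    intro Γ _ f g hf hg
    obtain ⟨x, rfl⟩ := hterm t₁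
    obtain ⟨y, rfl⟩ := hterm t₂
    have h : ∀ x, DF fun γ => Sum.elim (fun i => f i γ) (fun i => g i γ) x := by
      rintro (x | x)
      exacts [hf x, hg x]
    have := h x
    have := h y
    exact (inferInstance : Dfn M fun γ => Sum.elim (fun i => f i γ) (fun i => g i γ) x =
      Sum.elim (fun i => f i γ) (fun i => g i γ) y)
  | rel R ts =>
    intro Γ _ f g hf hg
    cases R
    have h : ∀ i, DF fun γ => (ts i).realize (Sum.elim (fun i => f i γ) fun i => g i γ) := by
      intro i
      obtain ⟨x, hx⟩ := hterm (ts i)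
      rw [hx]
      rcases x with x | x
      exacts [hf x, hg x]
    have := h 0
    have := h 1
    refine (inferInstance : Dfn M fun γ =>
      (ts 0).realize (Sum.elim (fun i => f i γ) fun i => g i γ) ∊
      (ts 1).realize (Sum.elim (fun i => f i γ) fun i => g i γ)).congr fun γ => ?_
    change Structure.RelMap _ _ ↔ Structure.RelMap _ _
    refine iff_of_eq (congrArg _ ?_)
    funext i
    refine Fin.cases rfl (fun i => ?_) i
    rw [Subsingleton.elim i 0]
    rfl
  | imp _ _ ih₁ ih₂ =>
    intro Γ _ f g hf hg
    have := ih₁ f g hf hg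
    have := ih₂ f g hf hg
    exact Dfn.imp
  | all φ ih =>
    intro Γ _ f g hf hg
    have := ih (Γ := Γ × M) (fun i p => f i p.1) (Fin.snoc (α := fun _ => Γ × M → M)
      (fun i p => g i p.1) fun p => p.2)
      (fun i => inferInstance) (fun i => by
        refine Fin.lastCases ?_ (fun i => ?_) i
        · simp only [Fin.snoc_last]
          infer_instance
        · simp only [Fin.snoc_castSucc]
          infer_instance)
    have h : Dfn M fun p : Γ × M => φ.Realize (fun i => f i p.1)
        (Fin.snoc (fun i => g i p.1) p.2 : Fin _ → M) := by
      refine this.congr fun p => iff_of_eq (congrArg _ ?_)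
      funext i
      refine Fin.lastCases ?_ (fun i => ?_) i <;> simp
    exact Dfn.all (P := fun γ y => φ.Realize (fun i => f i γ) (Fin.snoc (fun i => g i γ) y))

end Definability

end AMCSpectrum

namespace AMCSpectrum

/-! ## Set theory inside a model of ZFC -/

section Semantic

variable {M : Type u} [LSet.Structure M]

/-- `z = {x, y}` in the structure `M`. -/
def UPairS (z x y : M) : Prop := ∀ w, w ∊ z ↔ (w = x ∨ w = y)

/-- `p = (x, y)` in the structure `M`. -/
def PairS (p x y : M) : Prop := ∃ a b, (UPairS a x x ∧ UPairS b x y) ∧ UPairS p a b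

/-- `(x, y) ∈ r` in the structure `M`. -/
def PairInS (r x y : M) : Prop := ∃ p, PairS p x y ∧ p ∊ r

/-- `f` is a function with domain `x` in the structure `M`. -/
def FunOnS (f x : M) : Prop :=
  (∀ p, p ∊ f → ∃ a b, a ∊ x ∧ PairS p a b) ∧
    ∀ a, a ∊ x → ∃ b, ∀ b₁, PairInS f a b₁ ↔ b₁ = b

end Semantic

/-- The structures which satisfy the axioms of ZFC. -/
class ZF (M : Type u) [LSet.Structure M] : Prop where
  nonempty : Nonempty M
  ext : ∀ x y : M, (∀ z, z ∊ x ↔ z ∊ y) → x = y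
  found : ∀ x : M, (∃ y, y ∊ x) → ∃ y, y ∊ x ∧ ¬ ∃ z, z ∊ x ∧ z ∊ y
  pairing : ∀ x y : M, ∃ z, UPairS z x y
  union : ∀ x : M, ∃ u, ∀ z, z ∊ u ↔ ∃ y, y ∊ x ∧ z ∊ y
  power : ∀ x : M, ∃ p, ∀ z, z ∊ p ↔ ∀ w, w ∊ z → w ∊ x
  infinity : ∃ w : M, (∃ e, (¬ ∃ y, y ∊ e) ∧ e ∊ w) ∧
    ∀ x, x ∊ w → ∃ y, (∀ z, z ∊ y ↔ (z ∊ x ∨ z = x)) ∧ y ∊ w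
  sep : ∀ (P : M → Prop) [Dfn₁ P] (x : M), ∃ y, ∀ z, z ∊ y ↔ (z ∊ x ∧ P z)
  repl : ∀ (P : M → M → Prop) [Dfn₂ P] (X : M),
    (∀ x, x ∊ X → ∃ y, P x y) → ∃ f, FunOnS f X ∧ ∀ x y, PairInS f x y → P x y

/-! ### Set-theoretic operations as definable functions -/

section Terms

variable {M : Type u} [LSet.Structure M] [ZF M] {Γ : Type u} [Ctx M Γ]

open Classical in
/-- The unique element with the property `Q`, or a default value. -/
noncomputable def iota (Q : M → Prop) : M :=
  if h : ∃ y, ∀ w, Q w ↔ w = y then h.choose else Classical.choice ZF.nonempty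

theorem iota_eq {Q : M → Prop} {y : M} (h : ∀ w, Q w ↔ w = y) : iota Q = y := by
  have h' : ∃ y, ∀ w, Q w ↔ w = y := ⟨y, h⟩
  rw [iota, dif_pos h']
  exact (h _).1 ((h'.choose_spec _).2 rfl)

instance DF.iota {Q : Γ → M → Prop} [Dfn M fun p : Γ × M => Q p.1 p.2] :
    DF fun γ => iota (Q γ) := by
  have h1 : Dfn M fun p : Γ × M => Q p.1 p.2 := inferInstance
  have h2 : Dfn M fun p : Γ × M => ∀ w, Q p.1 w ↔ w = p.2 := by
    have : Dfn M fun p : (Γ × M) × M => Q p.1.1 p.2 := by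
      refine h1.reindex (fun p : (Γ × M) × M => (p.1.1, p.2)) fun g hg => ?_
      rcases hg with rfl | ⟨g, hg, rfl⟩
      · exact Or.inl rfl
      · exact Or.inr ⟨_, Or.inr ⟨g, hg, rfl⟩, rfl⟩
    infer_instance
  have h3 : Dfn M fun γ => ∃ y, ∀ w, Q γ w ↔ w = y := inferInstance
  have h4 := Dfn.fst (hP := h3)
  -- The graph is a disjunction: either the value is the unique element with the property, or there
  -- is none and the value is the default.
  refine ⟨(inferInstance : Dfn M fun p : Γ × M => ((∀ w, Q p.1 w ↔ w = p.2) ∨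
    (¬ (∃ y, ∀ w, Q p.1 w ↔ w = y)) ∧ p.2 = Classical.choice ZF.nonempty)).congr fun p => ?_⟩
  constructor
  · intro h
    by_cases hp : ∃ y, ∀ w, Q p.1 w ↔ w = y
    · left
      obtain ⟨y, hy⟩ := hp
      rw [h, iota_eq hy]
      exact hy
    · right
      exact ⟨hp, by rw [h, AMCSpectrum.iota, dif_neg hp]⟩
  · rintro (h | ⟨h, h'⟩)
    · rw [iota_eq h]
    · rw [h', AMCSpectrum.iota, dif_neg h]

/-- The set of the `z` with the property `Q`, if it exists. -/
noncomputable def cls (Q : M → Prop) : M := iota fun u => ∀ z, z ∊ u ↔ Q z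

instance DF.cls {Q : Γ → M → Prop} [Dfn M fun p : Γ × M => Q p.1 p.2] : DF fun γ => cls (Q γ) := by
  have h1 : Dfn M fun p : Γ × M => Q p.1 p.2 := inferInstance
  have : Dfn M fun p : (Γ × M) × M => Q p.1.1 p.2 := by
    refine h1.reindex (fun p : (Γ × M) × M => (p.1.1, p.2)) fun g hg => ?_
    rcases hg with rfl | ⟨g, hg, rfl⟩
    · exact Or.inl rfl
    · exact Or.inr ⟨_, Or.inr ⟨g, hg, rfl⟩, rfl⟩
  unfold AMCSpectrum.cls
  infer_instance

theorem mem_cls {Q : M → Prop} (h : ∃ u, ∀ z, z ∊ u ↔ Q z) (z : M) : z ∊ cls Q ↔ Q z := by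
  obtain ⟨u, hu⟩ := h
  have : cls Q = u := iota_eq fun w =>
    ⟨fun hw => ZF.ext _ _ fun z => (hw z).trans (hu z).symm, by rintro rfl; exact hu⟩
  rw [this, hu]

theorem mem_cls_sep {P : M → Prop} [Dfn₁ P] {x : M} (z : M) :
    z ∊ cls (fun z => z ∊ x ∧ P z) ↔ z ∊ x ∧ P z := mem_cls (ZF.sep P x) z

theorem mem_cls_of_subset {P : M → Prop} [Dfn₁ P] (x : M) (h : ∀ z, P z → z ∊ x) (z : M) :
    z ∊ cls P ↔ P z := by
  refine mem_cls ?_ z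
  obtain ⟨y, hy⟩ := ZF.sep P x
  exact ⟨y, fun z => (hy z).trans (and_iff_right_of_imp (h z))⟩

open Classical in
instance DF.ite {P : Γ → Prop} {f g : Γ → M} [hP : Dfn M P] [hf : DF f] [hg : DF g] :
    DF fun γ => if P γ then f γ else g γ := by
  refine ⟨(inferInstance : Dfn M fun p : Γ × M =>
    (P p.1 ∧ p.2 = f p.1) ∨ (¬ P p.1 ∧ p.2 = g p.1)).congr fun p => ?_⟩
  by_cases h : P p.1 <;> simp [h]

/-- The empty set. -/
noncomputable def emp : M := cls fun _ => False

@[simp] theorem not_mem_emp (x : M) : ¬ x ∊ (emp : M) := by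
  obtain ⟨w⟩ := ZF.nonempty (M := M)
  exact (mem_cls_of_subset (P := fun _ => False) w (fun _ => False.elim) x).1

theorem eq_emp {x : M} : x = emp ↔ ∀ y, ¬ y ∊ x :=
  ⟨by rintro rfl; exact not_mem_emp, fun h => ZF.ext _ _ fun z => by simp [h]⟩

theorem exists_mem_of_ne_emp {x : M} (h : x ≠ emp) : ∃ y, y ∊ x := by
  by_contra hne
  exact h (eq_emp.2 (not_exists.1 hne))

/-- The unordered pair. -/
noncomputable def upair (x y : M) : M := cls fun z => z = x ∨ z = y

instance DF.upair {f g : Γ → M} [hf : DF f] [hg : DF g] : DF fun γ => upair (f γ) (g γ) := by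
  unfold AMCSpectrum.upair
  infer_instance

@[simp] theorem mem_upair {x y z : M} : z ∊ upair x y ↔ z = x ∨ z = y :=
  mem_cls (ZF.pairing x y) z

/-- The union of the elements of `x`. -/
noncomputable def sUn (x : M) : M := cls fun z => ∃ y, y ∊ x ∧ z ∊ y

instance DF.sUn {f : Γ → M} [hf : DF f] : DF fun γ => sUn (f γ) := by
  unfold AMCSpectrum.sUn
  infer_instance

@[simp] theorem mem_sUn {x z : M} : z ∊ sUn x ↔ ∃ y, y ∊ x ∧ z ∊ y := mem_cls (ZF.union x) z

/-- The union of two sets. -/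
noncomputable def cup (x y : M) : M := sUn (upair x y)

instance DF.cup {f g : Γ → M} [DF f] [DF g] : DF fun γ => cup (f γ) (g γ) := by
  unfold AMCSpectrum.cup
  infer_instance

@[simp] theorem mem_cup {x y z : M} : z ∊ cup x y ↔ z ∊ x ∨ z ∊ y := by
  simp [cup, or_and_right, exists_or]

/-- The power set. -/
noncomputable def pow (x : M) : M := cls fun z => ∀ w, w ∊ z → w ∊ x

@[simp] theorem mem_pow {x z : M} : z ∊ pow x ↔ ∀ w, w ∊ z → w ∊ x := mem_cls (ZF.power x) z

/-- The set `x ∪ {x}`. -/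
noncomputable def suc (x : M) : M := cup x (upair x x)

instance DF.suc {f : Γ → M} [DF f] : DF fun γ => suc (f γ) := by
  unfold AMCSpectrum.suc
  infer_instance

@[simp] theorem mem_suc {x z : M} : z ∊ suc x ↔ z ∊ x ∨ z = x := by simp [suc]

/-- The ordered pair. -/
noncomputable def op (x y : M) : M := upair (upair x x) (upair x y)

instance DF.op {f g : Γ → M} [DF f] [DF g] : DF fun γ => op (f γ) (g γ) := by
  unfold AMCSpectrum.op
  infer_instance

theorem upairS_iff {z x y : M} : UPairS z x y ↔ z = upair x y :=
  ⟨fun h => ZF.ext _ _ fun w => by rw [h w, mem_upair], by rintro rfl w; exact mem_upair⟩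

theorem pairS_iff {p x y : M} : PairS p x y ↔ p = op x y := by
  simp [PairS, upairS_iff, op]

theorem pairInS_iff {r x y : M} : PairInS r x y ↔ op x y ∊ r := by
  simp [PairInS, pairS_iff]

theorem upair_eq_upair_left {x y z : M} (h : upair x y = upair x z) : y = z := by
  have h1 : z ∊ upair x y := by rw [h]; simp
  have h2 : y ∊ upair x z := by rw [← h]; simp
  simp only [mem_upair] at h1 h2
  grind

theorem op_inj {x y x' y' : M} : op x y = op x' y' ↔ x = x' ∧ y = y' := by
  refine ⟨fun h => ?_, by rintro ⟨rfl, rfl⟩; rfl⟩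
  have hx : x = x' := by
    have h1 : upair x x ∊ op x' y' := by rw [← h, op, mem_upair]; exact Or.inl rfl
    rw [op, mem_upair] at h1
    have h2 : x' ∊ upair x x := by rcases h1 with h1 | h1 <;> rw [h1, mem_upair] <;> simp
    simpa using (show x' = x by simpa using h2).symm
  subst hx
  exact ⟨rfl, upair_eq_upair_left (upair_eq_upair_left h)⟩

/-- The value of the function `f` at `a`. -/
noncomputable def app (f a : M) : M := iota fun b => op a b ∊ f

instance DF.app {f g : Γ → M} [hf : DF f] [hg : DF g] : DF fun γ => app (f γ) (g γ) := by
  unfold AMCSpectrum.app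
  infer_instance

/-- Unique existence of a value at `a` is what makes the description defining `app f a` succeed;
conversely a set of pairs `op a (app f a)` is single-valued. -/
theorem funOnS_iff {f x : M} : FunOnS f x ↔ (∀ p, p ∊ f → ∃ a, a ∊ x ∧ p = op a (app f a)) ∧
    ∀ a, a ∊ x → op a (app f a) ∊ f := by
  simp only [FunOnS, pairS_iff, pairInS_iff]
  constructor
  · rintro ⟨h1, h2⟩
    have h3 : ∀ a, a ∊ x → ∀ b, op a b ∊ f ↔ b = app f a := by
      intro a ha
      obtain ⟨b, hb⟩ := h2 a ha
      have : app f a = b := iota_eq hb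
      rw [this]
      exact hb
    refine ⟨fun p hp => ?_, fun a ha => (h3 a ha _).2 rfl⟩
    obtain ⟨a, b, ha, rfl⟩ := h1 p hp
    exact ⟨a, ha, by rw [(h3 a ha b).1 hp]⟩
  · rintro ⟨h1, h2⟩
    refine ⟨fun p hp => ?_, fun a ha => ⟨app f a, fun b => ⟨fun hb => ?_, ?_⟩⟩⟩
    · obtain ⟨a, ha, e⟩ := h1 p hp
      exact ⟨a, _, ha, e⟩
    · obtain ⟨a', ha', e⟩ := h1 _ hb
      rw [op_inj] at e
      rw [e.2, e.1]
    · rintro rfl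
      exact h2 a ha

theorem FunOnS.op_mem_iff {f x : M} (h : FunOnS f x) {a b : M} :
    op a b ∊ f ↔ a ∊ x ∧ b = app f a := by
  rw [funOnS_iff] at h
  constructor
  · intro hb
    obtain ⟨a', ha', e⟩ := h.1 _ hb
    rw [op_inj] at e
    rw [e.1]
    exact ⟨ha', e.1 ▸ e.2⟩
  · rintro ⟨ha, rfl⟩
    exact h.2 a ha

/-- Replacement together with choice. -/
theorem exists_fun (P : M → M → Prop) [Dfn₂ P] (X : M)
    (h : ∀ x, x ∊ X → ∃ y, P x y) : ∃ f, FunOnS f X ∧ ∀ x, x ∊ X → P x (app f x) := by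
  obtain ⟨f, hf, hP⟩ := ZF.repl P X h
  refine ⟨f, hf, fun x hx => hP _ _ ?_⟩
  rw [pairInS_iff, hf.op_mem_iff]
  exact ⟨hx, rfl⟩

/-- The component `{a, b}` of the Kuratowski pair belongs to `⋃ f`. This bounds domains and ranges,
so that separation yields them. -/
theorem mem_sUn_sUn_of_op {a b f : M} (h : op a b ∊ f) : a ∊ sUn (sUn f) ∧ b ∊ sUn (sUn f) := by
  constructor <;>
  · rw [mem_sUn]
    refine ⟨upair a b, ?_, by simp⟩
    rw [mem_sUn]
    exact ⟨_, h, by simp [op]⟩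

/-- The image of `X` under `F`. -/
noncomputable def img (F : M → M) (X : M) : M := cls fun y => ∃ x, x ∊ X ∧ y = F x

/-- Replacement provides the function as a set `f`, and the image is then separated from `⋃⋃f`. -/
theorem mem_img {F : M → M} [hF : DF₁ F] {X y : M} : y ∊ img F X ↔ ∃ x, x ∊ X ∧ y = F x := by
  obtain ⟨f, hf, hP⟩ := exists_fun (fun x y => y = F x) X fun x _ => ⟨_, rfl⟩
  refine mem_cls_of_subset (sUn (sUn f)) (fun z => ?_) y
  rintro ⟨x, hx, rfl⟩
  exact (mem_sUn_sUn_of_op (hf.op_mem_iff.2 ⟨hx, (hP x hx).symm⟩)).2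

/-- The restriction of `F` to `X`, as a set of pairs. -/
noncomputable def lam (F : M → M) (X : M) : M := img (fun x => op x (F x)) X

theorem mem_lam {F : M → M} [DF₁ F] {X p : M} : p ∊ lam F X ↔ ∃ x, x ∊ X ∧ p = op x (F x) := mem_img

theorem app_lam {F : M → M} [DF₁ F] {X x : M} (hx : x ∊ X) : app (lam F X) x = F x := by
  refine iota_eq fun w => ?_
  rw [mem_lam]
  constructor
  · rintro ⟨y, _, e⟩
    rw [op_inj] at e
    rw [e.1, e.2]
  · rintro rfl
    exact ⟨x, hx, rfl⟩

theorem funOnS_lam {F : M → M} [DF₁ F] {X : M} : FunOnS (lam F X) X := by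
  rw [funOnS_iff]
  refine ⟨fun p hp => ?_, fun a ha => ?_⟩
  · obtain ⟨x, hx, rfl⟩ := mem_lam.1 hp
    exact ⟨x, hx, by rw [app_lam hx]⟩
  · rw [app_lam ha, mem_lam]
    exact ⟨a, ha, rfl⟩

/-- The cartesian product. -/
noncomputable def prd (x y : M) : M := cls fun p => ∃ a b, a ∊ x ∧ b ∊ y ∧ p = op a b

theorem mem_prd {x y p : M} : p ∊ prd x y ↔ ∃ a b, a ∊ x ∧ b ∊ y ∧ p = op a b := by
  refine mem_cls_of_subset (pow (pow (cup x y))) (fun p => ?_) p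
  rintro ⟨a, b, ha, hb, rfl⟩
  simp only [mem_pow, op, mem_upair, mem_cup]
  grind [mem_upair]

theorem op_mem_prd {x y a b : M} : op a b ∊ prd x y ↔ a ∊ x ∧ b ∊ y := by
  rw [mem_prd]
  simp only [op_inj]
  grind

/-- Foundation for the subset of `X` cut out by `P`. It serves as the induction principle for
definable predicates. -/
theorem exists_minimal {P : M → Prop} [Dfn₁ P] {X : M} (h : ∃ x, x ∊ X ∧ P x) :
    ∃ x, x ∊ X ∧ P x ∧ ∀ y, y ∊ x → y ∊ X → ¬ P y := by
  obtain ⟨x, hx⟩ := h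
  obtain ⟨y, hy, h⟩ := ZF.found (cls fun z => z ∊ X ∧ P z) ⟨x, mem_cls_sep x |>.2 hx⟩
  rw [mem_cls_sep] at hy
  refine ⟨y, hy.1, hy.2, fun z hz hzX hPz => h ⟨z, (mem_cls_sep z).2 ⟨hzX, hPz⟩, hz⟩⟩

theorem not_mem_self (x : M) : ¬ x ∊ x := by
  intro h
  obtain ⟨y, hy, _, hmin⟩ := exists_minimal (P := fun _ => True) (X := upair x x) ⟨x, by simp⟩
  have : y = x := by simpa using hy
  subst this
  exact hmin y h (by simp) trivial

theorem not_mem_mem {x y : M} (h : x ∊ y) (h' : y ∊ x) : False := by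
  obtain ⟨z, hz, _, hmin⟩ := exists_minimal (P := fun _ => True) (X := upair x y) ⟨x, by simp⟩
  rcases mem_upair.1 hz with rfl | rfl
  · exact hmin y h' (by simp) trivial
  · exact hmin x h (by simp) trivial

end Terms

end AMCSpectrum

namespace AMCSpectrum

/-! ### Ordinals, natural numbers and recursion along `ω` -/

section Semantic

variable {M : Type u} [LSet.Structure M]

/-- `x` is transitive in the structure `M`. -/
def TransS (x : M) : Prop := ∀ y, y ∊ x → ∀ z, z ∊ y → z ∊ x

/-- `x` is an ordinal in the structure `M`. -/
def OrdS (x : M) : Prop := TransS x ∧ ∀ y z, y ∊ x ∧ z ∊ x → (y ∊ z ∨ y = z) ∨ z ∊ y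

/-- `x` is nonempty without maximal element in the structure `M`. -/
def LimS (x : M) : Prop := (∃ y, y ∊ x) ∧ ∀ y, y ∊ x → ∃ z, z ∊ x ∧ y ∊ z

/-- `x = ω` in the structure `M`. -/
def OmegaS (x : M) : Prop := (OrdS x ∧ LimS x) ∧ ∀ y, y ∊ x → ¬ LimS y

variable {Γ : Type u} [Ctx M Γ]

instance Dfn.transS {f : Γ → M} [DF f] : Dfn M fun γ => TransS (f γ) := by
  unfold TransS
  infer_instance

instance Dfn.ordS {f : Γ → M} [DF f] : Dfn M fun γ => OrdS (f γ) := by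
  unfold OrdS
  infer_instance

end Semantic

section Omega

variable {M : Type u} [LSet.Structure M] [ZF M]

theorem OrdS.mem {x y : M} (hx : OrdS x) (hy : y ∊ x) : OrdS y := by
  have ht : TransS y := by
    intro z hz w hw
    have hzx := hx.1 y hy z hz
    have hwx := hx.1 z hzx w hw
    rcases hx.2 w y ⟨hwx, hy⟩ with (h | h) | h
    · exact h
    · subst h
      exact (not_mem_mem hz hw).elim
    · exfalso
      -- What remains is the cycle `y ∊ w ∊ z ∊ y`; it contradicts foundation for `{y, z, w}`.
      obtain ⟨a, ha, _, hmin⟩ := exists_minimal (P := fun _ => True)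
        (X := cup (upair y z) (upair w w)) ⟨y, by simp⟩
      simp only [mem_cup, mem_upair] at ha hmin
      grind
  exact ⟨ht, fun a b h => hx.2 a b ⟨hx.1 y hy a h.1, hx.1 y hy b h.2⟩⟩

theorem ordS_suc {x : M} (hx : OrdS x) : OrdS (suc x) := by
  constructor
  · intro y hy z hz
    rw [mem_suc] at hy ⊢
    rcases hy with hy | rfl
    · exact Or.inl (hx.1 y hy z hz)
    · exact Or.inl hz
  · rintro y z ⟨hy, hz⟩
    rw [mem_suc] at hy hz
    have := hx.2 y z
    grind

theorem ordS_emp : OrdS (emp : M) :=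
  ⟨fun y hy => (not_mem_emp y hy).elim, fun y _ h => (not_mem_emp y h.1).elim⟩

/-- An inductive set. -/
def Inductive (I : M) : Prop := emp ∊ I ∧ ∀ x, x ∊ I → suc x ∊ I

instance : Dfn₁ fun I : M => Inductive I := by
  unfold Inductive
  infer_instance

/-- The set of natural numbers. -/
noncomputable def om : M := cls fun n => ∀ I, Inductive I → n ∊ I

theorem mem_om {n : M} : n ∊ (om : M) ↔ ∀ I, Inductive I → n ∊ I := by
  obtain ⟨w, ⟨e, he, hew⟩, hw⟩ := ZF.infinity (M := M)
  refine mem_cls_of_subset w (fun n hn => hn w ⟨?_, fun x hx => ?_⟩) n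
  · rwa [← eq_emp.2 (not_exists.1 he)]
  · obtain ⟨y, hy, hyw⟩ := hw x hx
    rwa [show suc x = y from ZF.ext _ _ fun z => by rw [hy, mem_suc] ]

theorem emp_mem_om : emp ∊ (om : M) := mem_om.2 fun _ hI => hI.1

theorem suc_mem_om {n : M} (h : n ∊ (om : M)) : suc n ∊ (om : M) :=
  mem_om.2 fun I hI => hI.2 n (mem_om.1 h I hI)

theorem om_induction {P : M → Prop} [Dfn₁ P] (h0 : P emp)
    (hs : ∀ n, n ∊ (om : M) → P n → P (suc n)) {n : M} (hn : n ∊ (om : M)) : P n := by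
  have := mem_om.1 hn (cls fun z => z ∊ om ∧ P z) ⟨?_, fun x hx => ?_⟩
  · exact ((mem_cls_sep n).1 this).2
  · exact (mem_cls_sep _).2 ⟨emp_mem_om, h0⟩
  · rw [mem_cls_sep] at hx ⊢
    exact ⟨suc_mem_om hx.1, hs x hx.1 hx.2⟩

theorem om_cases {n : M} (hn : n ∊ (om : M)) : n = emp ∨ ∃ m, m ∊ (om : M) ∧ n = suc m :=
  om_induction (P := fun n => n = emp ∨ ∃ m, m ∊ (om : M) ∧ n = suc m) (Or.inl rfl)
    (fun m hm _ => Or.inr ⟨m, hm, rfl⟩) hn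

theorem ordS_of_mem_om {n : M} (hn : n ∊ (om : M)) : OrdS n :=
  om_induction (P := fun n => OrdS n) ordS_emp (fun _ _ h => ordS_suc h) hn

theorem transS_om : TransS (om : M) := by
  intro y hy
  refine om_induction (P := fun n => ∀ z, z ∊ n → z ∊ (om : M)) (by simp) (fun n hn h z hz => ?_) hy
  rcases mem_suc.1 hz with hz | rfl
  exacts [h z hz, hn]

theorem suc_subset_of_mem {x y : M} (hy : TransS y) (h : x ∊ y) {z : M} (hz : z ∊ suc x) : z ∊ y := by
  rcases mem_suc.1 hz with hz | rfl
  exacts [hy x h z hz, h]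

/-- A member of an ordinal above `x` is `suc x` or lies above it. -/
theorem OrdS.suc_mem_or_eq {x y : M} (hy : OrdS y) (h : x ∊ y) : suc x ∊ y ∨ suc x = y := by
  by_cases he : ∃ z, z ∊ y ∧ x ∊ z
  · obtain ⟨z, hz, hxz, hmin⟩ := exists_minimal (P := fun z => x ∊ z) he
    left
    have hzo := hy.mem hz
    have : suc x = z := by
      refine ZF.ext _ _ fun w => ⟨suc_subset_of_mem hzo.1 hxz, fun hw => ?_⟩
      have hwy := hy.1 z hz w hw
      rw [mem_suc]
      rcases hy.2 w x ⟨hwy, h⟩ with h' | h'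
      · exact h'
      · exact (hmin w hw hwy h').elim
    rwa [this]
  · right
    refine ZF.ext _ _ fun w => ⟨suc_subset_of_mem hy.1 h, fun hw => ?_⟩
    rw [mem_suc]
    rcases hy.2 w x ⟨hw, h⟩ with h' | h'
    · exact h'
    · exact (he ⟨w, hw, h'⟩).elim

theorem suc_inj {x y : M} (h : suc x = suc y) : x = y := by
  have h1 : x ∊ suc y := by rw [← h]; simp
  have h2 : y ∊ suc x := by rw [h]; simp
  rw [mem_suc] at h1 h2
  rcases h1 with h1 | h1
  · rcases h2 with h2 | h2
    · exact (not_mem_mem h1 h2).elim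
    · exact h2.symm
  · exact h1

theorem emp_mem_of_ordS {x : M} (hx : OrdS x) (h : ∃ y, y ∊ x) : emp ∊ x := by
  obtain ⟨y, hy⟩ := h
  obtain ⟨z, hz, _, hmin⟩ := exists_minimal (P := fun _ => True) (X := x) ⟨y, hy, trivial⟩
  have : z = emp := eq_emp.2 fun w hw => hmin w hw (hx.1 z hz w hw) trivial
  rwa [← this]

theorem ordS_om : OrdS (om : M) := by
  refine ⟨transS_om, ?_⟩
  rintro y z ⟨hy, hz⟩
  refine om_induction (P := fun y => (y ∊ z ∨ y = z) ∨ z ∊ y) ?_ (fun n hn h => ?_) hy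
  · by_cases h : z = emp
    · exact Or.inl (Or.inr h.symm)
    · exact Or.inl (Or.inl (emp_mem_of_ordS (ordS_of_mem_om hz) (exists_mem_of_ne_emp h)))
  · rcases h with (h | rfl) | h
    · exact Or.inl ((ordS_of_mem_om hz).suc_mem_or_eq h)
    · exact Or.inr (by simp)
    · exact Or.inr (by simp [h])

theorem omegaS_om : OmegaS (om : M) := by
  refine ⟨⟨ordS_om, ⟨emp, emp_mem_om⟩, fun y hy => ⟨suc y, suc_mem_om hy, by simp⟩⟩, ?_⟩
  rintro y hy ⟨⟨z, hz⟩, h⟩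
  rcases om_cases hy with rfl | ⟨m, hm, rfl⟩
  · exact not_mem_emp z hz
  · obtain ⟨w, hw, hmw⟩ := h m (by simp)
    rcases mem_suc.1 hw with hw | rfl
    · exact not_mem_mem hw hmw
    · exact not_mem_self _ hmw

/-- A limit ordinal is inductive, hence contains `om`. A least element outside `om` could be neither
empty nor the successor of a smaller element, so it would be a limit below `w`, which the definition
forbids. -/
theorem omegaS_iff {w : M} : OmegaS w ↔ w = om := by
  refine ⟨fun ⟨⟨ho, hl⟩, hn⟩ => ?_, by rintro rfl; exact omegaS_om⟩
  have hind : Inductive w := by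
    refine ⟨emp_mem_of_ordS ho hl.1, fun x hx => ?_⟩
    obtain ⟨z, hz, hxz⟩ := hl.2 x hx
    rcases (ho.mem hz).suc_mem_or_eq hxz with h | h
    · exact ho.1 z hz _ h
    · rwa [h]
  refine ZF.ext _ _ fun z => ⟨fun hz => ?_, fun hz => mem_om.1 hz w hind⟩
  by_contra hzo
  obtain ⟨x, hx, hxo, hmin⟩ := exists_minimal (P := fun z => ¬ z ∊ (om : M)) ⟨z, hz, hzo⟩
  have hxt := ho.mem hx
  by_cases he : ∃ y, y ∊ x
  · have := hn x hx
    rw [LimS, not_and] at this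
    have := this he
    push Not at this
    obtain ⟨y, hy, hmax⟩ := this
    rcases hxt.suc_mem_or_eq hy with h | h
    · exact hmax _ h (by simp)
    · refine hxo (h ▸ suc_mem_om ?_)
      by_contra hyo
      exact hmin y hy (ho.1 x hx y hy) hyo
  · exact hxo (eq_emp.2 (not_exists.1 he) ▸ emp_mem_om)

theorem mem_suc_of_mem_om {m n : M} (hn : n ∊ (om : M)) (h : m ∊ n) : suc m ∊ suc n := by
  rw [mem_suc]
  exact (ordS_of_mem_om hn).suc_mem_or_eq h

/-- Recursion along `ω`. -/
theorem om_recursion (G : M → M) [DF₁ G] (a : M) :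
    ∃ s : M, app s emp = a ∧ ∀ n, n ∊ (om : M) → app s (suc n) = G (app s n) := by
  classical
  -- `A p n` says that `p` is correct at all arguments up to and including `n`.
  let A : M → M → Prop := fun p n => app p emp = a ∧ ∀ m, m ∊ n → app p (suc m) = G (app p m)
  have hA : Dfn₂ A := by
    change Dfn₂ fun p d : M => app p emp = a ∧ ∀ m, m ∊ d → app p (suc m) = G (app p m)
    infer_instance
  have huniq : ∀ p q n, n ∊ (om : M) → A p n → A q n → app p n = app q n := by
    intro p q n hn
    have := om_induction (P := fun n => A p n → A q n → app p n = app q n)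
      (fun h1 h2 => h1.1.trans h2.1.symm)
      (fun n hn ih h1 h2 => by
        rw [h1.2 n (by simp), h2.2 n (by simp), ih ⟨h1.1, fun m hm => h1.2 m (by simp [hm])⟩
          ⟨h2.1, fun m hm => h2.2 m (by simp [hm])⟩]) hn
    exact this
  have hex : ∀ n, n ∊ (om : M) → ∃ p, A p n := by
    intro n hn
    refine om_induction (P := fun n => ∃ p, A p n) ⟨lam (fun _ => a) (upair emp emp), ?_, by simp⟩
      (fun n hn ih => ?_) hn
    · rw [app_lam (by simp)]
    · obtain ⟨p, hp⟩ := ih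
      have hno := ordS_of_mem_om hn
      -- The domain `suc (suc n)` contains the arguments up to `suc n`; only the value at `suc n` is
      -- new.
      refine ⟨lam (fun x => if x = suc n then G (app p n) else app p x) (suc (suc n)), ?_, ?_⟩
      · rw [app_lam (emp_mem_of_ordS (ordS_suc (ordS_suc hno)) ⟨n, by simp⟩),
          if_neg, hp.1]
        intro h
        have : n ∊ (emp : M) := by rw [h]; simp
        exact not_mem_emp _ this
      · intro m hm
        have hm' : m ∊ suc (suc n) := by rw [mem_suc]; exact Or.inl hm
        have hne : m ≠ suc n := by rintro rfl; exact not_mem_self _ hm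
        rw [app_lam (mem_suc_of_mem_om (suc_mem_om hn) hm), app_lam hm', if_neg hne]
        rcases mem_suc.1 hm with hm | rfl
        · rw [if_neg, hp.2 m hm]
          intro h
          rw [suc_inj h] at hm
          exact not_mem_self _ hm
        · rw [if_pos rfl]
  let F : M → M := fun n => iota fun y => ∃ p, A p n ∧ y = app p n
  have hF : DF₁ F := by
    change DF₁ fun n => iota fun y => ∃ p, A p n ∧ y = app p n
    infer_instance
  have hFv : ∀ n p, n ∊ (om : M) → A p n → F n = app p n := by
    intro n p hn hp
    refine iota_eq fun w => ⟨?_, fun h => ⟨p, hp, h⟩⟩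
    rintro ⟨q, hq, rfl⟩
    exact huniq q p n hn hq hp
  refine ⟨lam F om, ?_, fun n hn => ?_⟩
  · rw [app_lam emp_mem_om]
    obtain ⟨p, hp⟩ := hex emp emp_mem_om
    rw [hFv _ p emp_mem_om hp, hp.1]
  · rw [app_lam (suc_mem_om hn), app_lam hn]
    obtain ⟨p, hp⟩ := hex _ (suc_mem_om hn)
    rw [hFv _ p (suc_mem_om hn) hp, hp.2 n (by simp), hFv n p hn
      ⟨hp.1, fun m hm => hp.2 m (by simp [hm])⟩]

/-- Every set is a subset of a transitive set. -/
theorem exists_transS (x : M) : ∃ t, TransS t ∧ ∀ y, y ∊ x → y ∊ t := by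
  -- `s n` is the `n`-fold union of `x`; the union of all stages is transitive.
  obtain ⟨s, h0, hs⟩ := om_recursion (fun y : M => sUn y) x
  have hmem : ∀ y, y ∊ sUn (img (fun n => app s n) (om : M)) ↔ ∃ n, n ∊ (om : M) ∧ y ∊ app s n := by
    intro y
    simp only [mem_sUn, mem_img]
    constructor
    · rintro ⟨_, ⟨n, hn, rfl⟩, h⟩
      exact ⟨n, hn, h⟩
    · rintro ⟨n, hn, h⟩
      exact ⟨_, ⟨n, hn, rfl⟩, h⟩
  refine ⟨sUn (img (fun n => app s n) om), fun y hy z hz => ?_, fun y hy => ?_⟩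
  · rw [hmem] at hy ⊢
    obtain ⟨n, hn, hy⟩ := hy
    refine ⟨suc n, suc_mem_om hn, ?_⟩
    rw [hs n hn, mem_sUn]
    exact ⟨y, hy, hz⟩
  · exact (hmem y).2 ⟨emp, emp_mem_om, by rwa [h0]⟩

end Omega

/-! ### The Mostowski collapse -/

section Mostowski

variable {M : Type u} [LSet.Structure M] [ZF M]

/-- The Mostowski collapse of a well-founded definable relation `r` on a set `X`. -/
theorem exists_collapse (X : M) (r : M → M → Prop) [Dfn₂ r]
    (wf : ∀ Y : M, (∀ y, y ∊ Y → y ∊ X) → (∃ y, y ∊ Y) → ∃ y, y ∊ Y ∧ ∀ z, z ∊ Y → ¬ r z y) :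
    ∃ p : M, ∀ x, x ∊ X → ∀ z, z ∊ app p x ↔ ∃ y, y ∊ X ∧ r y x ∧ z = app p y := by
  classical
  -- Approximations are correct on a subset `d` of `X` closed under `r`-predecessors; any two agree
  -- where both are defined.
  let A : M → M → Prop := fun p d => (∀ x, x ∊ d → x ∊ X) ∧
    (∀ x, x ∊ d → ∀ y, y ∊ X → r y x → y ∊ d) ∧
    ∀ x, x ∊ d → ∀ z, z ∊ app p x ↔ ∃ y, y ∊ X ∧ r y x ∧ z = app p y
  have hA : Dfn₂ A := by
    change Dfn₂ fun p d : M => (∀ x, x ∊ d → x ∊ X) ∧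
      (∀ x, x ∊ d → ∀ y, y ∊ X → r y x → y ∊ d) ∧
      ∀ x, x ∊ d → ∀ z, z ∊ app p x ↔ ∃ y, y ∊ X ∧ r y x ∧ z = app p y
    infer_instance
  have wfP : ∀ (P : M → Prop) [Dfn₁ P], (∃ y, y ∊ X ∧ P y) →
      ∃ y, y ∊ X ∧ P y ∧ ∀ z, z ∊ X → r z y → ¬ P z := by
    rintro P _ ⟨y, hy⟩
    obtain ⟨y, hy, hmin⟩ := wf (cls fun z => z ∊ X ∧ P z) (fun z hz => ((mem_cls_sep z).1 hz).1)
      ⟨y, (mem_cls_sep y).2 hy⟩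
    rw [mem_cls_sep] at hy
    exact ⟨y, hy.1, hy.2, fun z hz hr hP => hmin z ((mem_cls_sep z).2 ⟨hz, hP⟩) hr⟩
  have huniq : ∀ p d q e, A p d → A q e → ∀ x, x ∊ d → x ∊ e → app p x = app q x := by
    intro p d q e hp hq x hxd hxe
    by_contra hne
    obtain ⟨y, hyX, ⟨hyd, hye, hyne⟩, hmin⟩ := wfP (fun y => y ∊ d ∧ y ∊ e ∧ ¬ app p y = app q y)
      ⟨x, hp.1 x hxd, hxd, hxe, hne⟩
    refine hyne (ZF.ext _ _ fun z => ?_)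
    rw [hp.2.2 y hyd, hq.2.2 y hye]
    refine exists_congr fun w => and_congr_right fun hw => and_congr_right fun hr => ?_
    have : app p w = app q w := by
      by_contra h
      exact hmin w hw hr ⟨hp.2.1 y hyd w hw hr, hq.2.1 y hye w hw hr, h⟩
    rw [this]
  let D : M := cls fun x => x ∊ X ∧ ∃ p d, A p d ∧ x ∊ d
  have hD : ∀ x, x ∊ D ↔ x ∊ X ∧ ∃ p d, A p d ∧ x ∊ d := fun x => mem_cls_sep x
  let F : M → M := fun x => iota fun y => ∃ p d, A p d ∧ x ∊ d ∧ y = app p x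
  have hF : DF₁ F := by
    change DF₁ fun x => iota fun y => ∃ p d, A p d ∧ x ∊ d ∧ y = app p x
    infer_instance
  have hFv : ∀ p d x, A p d → x ∊ d → F x = app p x := by
    intro p d x hp hx
    refine iota_eq fun w => ⟨?_, fun h => ⟨p, d, hp, hx, h⟩⟩
    rintro ⟨q, e, hq, hxe, rfl⟩
    exact huniq q e p d hq hp x hxe hx
  have hclosed : ∀ x, x ∊ D → ∀ y, y ∊ X → r y x → y ∊ D := by
    intro x hx y hy hr
    obtain ⟨_, p, d, hp, hxd⟩ := (hD x).1 hx
    exact (hD y).2 ⟨hy, p, d, hp, hp.2.1 x hxd y hy hr⟩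
  have hFD : ∀ x, x ∊ D → ∀ z, z ∊ F x ↔ ∃ y, y ∊ X ∧ r y x ∧ z = F y := by
    intro x hx z
    obtain ⟨_, p, d, hp, hxd⟩ := (hD x).1 hx
    rw [hFv p d x hp hxd, hp.2.2 x hxd]
    refine exists_congr fun w => and_congr_right fun hw => and_congr_right fun hr => ?_
    rw [hFv p d w hp (hp.2.1 x hxd w hw hr)]
  have hall : ∀ x, x ∊ X → x ∊ D := by
    intro x hx
    by_contra hxD
    obtain ⟨y, hyX, hyD, hmin⟩ := wfP (fun y => ¬ y ∊ D) ⟨x, hx, hxD⟩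
    have hpred : ∀ z, z ∊ X → r z y → z ∊ D := fun z hz hr => by
      by_contra h
      exact hmin z hz hr h
    -- At an `r`-minimal `y` outside the domain reached so far, all predecessors have values.
    -- Sending `y` to the set `v` of these values gives an approximation on `D ∪ {y}`, a
    -- contradiction.
    let v : M := img F (cls fun z => z ∊ X ∧ r z y)
    have hv : ∀ z, z ∊ v ↔ ∃ w, w ∊ X ∧ r w y ∧ z = F w := by
      intro z
      change z ∊ img F _ ↔ _
      rw [mem_img]
      simp only [mem_cls_sep, and_assoc]
    let q : M := lam (fun z => if z = y then v else F z) (cup D (upair y y))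
    have hqy : app q y = v := by
      change app (lam _ _) y = v
      rw [app_lam (by simp), if_pos rfl]
    have hqD : ∀ z, z ∊ D → app q z = F z := by
      intro z hz
      change app (lam _ _) z = F z
      rw [app_lam (by simp [hz]), if_neg]
      rintro rfl
      exact hyD hz
    refine hyD ((hD y).2 ⟨hyX, q, cup D (upair y y), ⟨?_, ?_, ?_⟩, by simp⟩)
    · intro z hz
      rcases mem_cup.1 hz with hz | hz
      · exact ((hD z).1 hz).1
      · rw [mem_upair, or_self] at hz
        rwa [hz]
    · intro z hz w hw hr
      rw [mem_cup] at hz ⊢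
      left
      rcases hz with hz | hz
      · exact hclosed z hz w hw hr
      · rw [mem_upair, or_self] at hz
        exact hpred w hw (hz ▸ hr)
    · intro z hz u
      rcases mem_cup.1 hz with hz | hz
      · rw [hqD z hz, hFD z hz]
        refine exists_congr fun w => and_congr_right fun hw => and_congr_right fun hr => ?_
        rw [hqD w (hclosed z hz w hw hr)]
      · rw [mem_upair, or_self] at hz
        subst hz
        rw [hqy, hv]
        refine exists_congr fun w => and_congr_right fun hw => and_congr_right fun hr => ?_
        rw [hqD w (hpred w hw hr)]
  refine ⟨lam F X, fun x hx z => ?_⟩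
  rw [app_lam hx, hFD x (hall x hx)]
  refine exists_congr fun w => and_congr_right fun hw => and_congr_right fun hr => ?_
  rw [app_lam hw]

end Mostowski

end AMCSpectrum

namespace AMCSpectrum

/-! ### Cardinality inside a model -/

section Semantic

variable {M : Type u} [LSet.Structure M]

/-- `f : x → y` in the structure `M`. -/
def FunS (f x y : M) : Prop := FunOnS f x ∧ ∀ a b, PairInS f a b → b ∊ y

/-- `f : x → y` is a surjection in the structure `M`. -/
def SurjS (f x y : M) : Prop := FunS f x y ∧ ∀ b, b ∊ y → ∃ a, a ∊ x ∧ PairInS f a b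

/-- `f : x → y` is an injection in the structure `M`. -/
def InjS (f x y : M) : Prop :=
  FunS f x y ∧ ∀ a a₁ b, PairInS f a b ∧ PairInS f a₁ b → a = a₁

/-- `x` is a cardinal in the structure `M`. -/
def CardS (x : M) : Prop := OrdS x ∧ ∀ d f, d ∊ x → ¬ SurjS f d x

/-- `t` is the transitive closure of `x` in the structure `M`. -/
def TrclS (t x : M) : Prop := (TransS t ∧ ∀ y, y ∊ x → y ∊ t) ∧
  ∀ s, (TransS s ∧ ∀ y, y ∊ x → y ∊ s) → ∀ y, y ∊ t → y ∊ s

/-- `x ∈ H_{l⁺}` in the structure `M`. -/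
def InHPlusS (l x : M) : Prop := ∃ t, TrclS t x ∧ ∃ f, InjS f t l

end Semantic

section Small

variable {M : Type u} [LSet.Structure M] [ZF M] {Γ : Type u} [Ctx M Γ]

/-- The set `x` is covered by a function on `k`. -/
def Sm (k x : M) : Prop := ∃ f, ∀ y, y ∊ x → ∃ a, a ∊ k ∧ y = app f a

instance Dfn.sm {f g : Γ → M} [DF f] [DF g] : Dfn M fun γ => Sm (f γ) (g γ) := by
  unfold Sm
  infer_instance

instance DF.prd {f g : Γ → M} [DF f] [DF g] : DF fun γ => prd (f γ) (g γ) := by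
  unfold AMCSpectrum.prd
  infer_instance

theorem Sm.of_fun {k x : M} (F : M → M) [DF₁ F] (h : ∀ y, y ∊ x → ∃ a, a ∊ k ∧ y = F a) : Sm k x := by
  refine ⟨lam F k, fun y hy => ?_⟩
  obtain ⟨a, ha, e⟩ := h y hy
  exact ⟨a, ha, by rw [app_lam ha, e]⟩

theorem Sm.subset {k x y : M} (h : Sm k x) (hy : ∀ z, z ∊ y → z ∊ x) : Sm k y :=
  h.imp fun _ hf z hz => hf z (hy z hz)

theorem Sm.mono {k k' x : M} (h : Sm k x) (hk : ∀ z, z ∊ k → z ∊ k') : Sm k' x :=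
  h.imp fun _ hf z hz => (hf z hz).imp fun _ ha => ⟨hk _ ha.1, ha.2⟩

theorem Sm.refl (k : M) : Sm k k := Sm.of_fun (fun x => x) fun _ hy => ⟨_, hy, rfl⟩

theorem Sm.trans {x y z : M} (h : Sm x y) (h' : Sm y z) : Sm x z := by
  obtain ⟨f, hf⟩ := h
  obtain ⟨g, hg⟩ := h'
  refine Sm.of_fun (fun a => app g (app f a)) fun w hw => ?_
  obtain ⟨b, hb, rfl⟩ := hg w hw
  obtain ⟨a, ha, rfl⟩ := hf b hb
  exact ⟨a, ha, rfl⟩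

theorem Sm.img {k x : M} (h : Sm k x) (F : M → M) [DF₁ F] : Sm k (img F x) :=
  h.trans (Sm.of_fun F fun _ hy => mem_img.1 hy)

theorem Sm.prd {x y : M} (h : Sm x y) : Sm (prd x x) (prd y y) := by
  obtain ⟨f, hf⟩ := h
  refine Sm.of_fun (fun p => iota fun q => ∃ a b, p = op a b ∧ q = op (app f a) (app f b)) ?_
  intro q hq
  obtain ⟨c, d, hc, hd, rfl⟩ := mem_prd.1 hq
  obtain ⟨a, ha, rfl⟩ := hf c hc
  obtain ⟨b, hb, rfl⟩ := hf d hd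
  refine ⟨op a b, op_mem_prd.2 ⟨ha, hb⟩, (iota_eq fun w => ⟨?_, ?_⟩).symm⟩
  · rintro ⟨a', b', e, rfl⟩
    rw [op_inj] at e
    rw [e.1, e.2]
  · rintro rfl
    exact ⟨a, b, rfl, rfl⟩

/-- Values of the covering function outside `x` are redirected to a fixed element of `x`, which is
why `x` has to be nonempty. -/
theorem Sm.exists_surjS {d x : M} (h : Sm d x) (hx : ∃ y, y ∊ x) : ∃ f, SurjS f d x := by
  classical
  obtain ⟨f, hf⟩ := h
  obtain ⟨y₀, hy₀⟩ := hx
  have hfun := funOnS_lam (F := fun a => if app f a ∊ x then app f a else y₀) (X := d)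
  refine ⟨lam (fun a => if app f a ∊ x then app f a else y₀) d, ⟨hfun, fun a b hab => ?_⟩,
    fun b hb => ?_⟩
  · rw [pairInS_iff, hfun.op_mem_iff] at hab
    rw [hab.2, app_lam hab.1]
    split_ifs with h
    exacts [h, hy₀]
  · obtain ⟨a, ha, e⟩ := hf b hb
    refine ⟨a, ha, ?_⟩
    rw [pairInS_iff, hfun.op_mem_iff, app_lam ha, if_pos (e ▸ hb)]
    exact ⟨ha, e⟩

theorem SurjS.sm {f d x : M} (h : SurjS f d x) : Sm d x := by
  refine ⟨f, fun y hy => ?_⟩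
  obtain ⟨a, ha, e⟩ := h.2 y hy
  rw [pairInS_iff, h.1.1.op_mem_iff] at e
  exact ⟨a, e⟩

theorem CardS.not_sm {k d : M} (h : CardS k) (hd : d ∊ k) : ¬ Sm d k := fun hs => by
  obtain ⟨f, hf⟩ := hs.exists_surjS ⟨d, hd⟩
  exact h.2 d f hd hf

theorem cardS_iff {k : M} : CardS k ↔ OrdS k ∧ ∀ d, d ∊ k → ¬ Sm d k :=
  ⟨fun h => ⟨h.1, fun _ => h.not_sm⟩, fun h => ⟨h.1, fun d _ hd hf => h.2 d hd hf.sm⟩⟩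

/-! ### Ordinals are comparable -/

theorem OrdS.eq_or_mem_of_subset {a b : M} (ha : OrdS a) (hb : OrdS b) (h : ∀ x, x ∊ a → x ∊ b) :
    a = b ∨ a ∊ b := by
  by_cases he : ∃ x, x ∊ b ∧ ¬ x ∊ a
  · right
    obtain ⟨m, hm, hma, hmin⟩ := exists_minimal (P := fun x => ¬ x ∊ a) he
    have : a = m := by
      refine ZF.ext _ _ fun x => ⟨fun hx => ?_, fun hx => ?_⟩
      · rcases hb.2 x m ⟨h x hx, hm⟩ with (h' | rfl) | h'
        · exact h'
        · exact (hma hx).elim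
        · exact (hma (ha.1 x hx m h')).elim
      · by_contra hxa
        exact hmin x hx (hb.1 m hm x hx) hxa
    rwa [this]
  · left
    push Not at he
    exact ZF.ext _ _ fun x => ⟨h x, he x⟩

/-- The intersection is an ordinal contained in both, so it equals or belongs to each. If it
belonged to both it would be its own element. -/
theorem OrdS.total {a b : M} (ha : OrdS a) (hb : OrdS b) : a ∊ b ∨ a = b ∨ b ∊ a := by
  have hd : ∀ x, x ∊ cls (fun x => x ∊ a ∧ x ∊ b) ↔ x ∊ a ∧ x ∊ b := fun x => mem_cls_sep x
  have hdo : OrdS (cls fun x => x ∊ a ∧ x ∊ b) := by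
    refine ⟨fun y hy z hz => ?_, fun y z h => ha.2 y z ⟨((hd y).1 h.1).1, ((hd z).1 h.2).1⟩⟩
    rw [hd] at hy ⊢
    exact ⟨ha.1 y hy.1 z hz, hb.1 y hy.2 z hz⟩
  rcases hdo.eq_or_mem_of_subset ha fun x hx => ((hd x).1 hx).1 with h1 | h1
  · have : ∀ x, x ∊ a → x ∊ b := fun x hx => ((hd x).1 (by rwa [h1])).2
    rcases ha.eq_or_mem_of_subset hb this with h | h
    exacts [Or.inr (Or.inl h), Or.inl h]
  · rcases hdo.eq_or_mem_of_subset hb fun x hx => ((hd x).1 hx).2 with h2 | h2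
    · have : ∀ x, x ∊ b → x ∊ a := fun x hx => ((hd x).1 (by rwa [h2])).1
      rcases hb.eq_or_mem_of_subset ha this with h | h
      exacts [Or.inr (Or.inl h.symm), Or.inr (Or.inr h)]
    · exact (not_mem_self _ ((hd _).2 ⟨h1, h2⟩)).elim

/-! ### Finite sets do not cover `ω` -/

-- If `f a` is a natural number, remove it from the range and close the gap: smaller values are kept
-- and larger ones replaced by their predecessors, so `x` alone covers `ω`. If `f a` is not a
-- natural number, then `a` was not needed.
open Classical in
theorem not_sm_om_insert {x a : M} (h : ¬ Sm x om) : ¬ Sm (cup x (upair a a)) om := by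
  rintro ⟨f, hf⟩
  by_cases hc : app f a ∊ (om : M)
  · refine h (Sm.of_fun (fun z => if app f z ∊ app f a then app f z
      else iota fun w => app f z = suc w) fun n hn => ?_)
    by_cases hna : n ∊ app f a
    · obtain ⟨z, hz, rfl⟩ := hf n hn
      rcases mem_cup.1 hz with hz | hz
      · exact ⟨z, hz, by rw [if_pos hna]⟩
      · rw [mem_upair, or_self] at hz
        subst hz
        exact (not_mem_self _ hna).elim
    · obtain ⟨z, hz, e⟩ := hf (suc n) (suc_mem_om hn)
      rcases mem_cup.1 hz with hz | hz
      · refine ⟨z, hz, ?_⟩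
        rw [if_neg]
        · refine (iota_eq fun w => ?_).symm
          rw [← e]
          exact ⟨fun h => (suc_inj h).symm, fun h => by rw [h]⟩
        · rw [← e]
          exact fun h' => hna ((ordS_of_mem_om hc).1 _ h' n (by simp))
      · rw [mem_upair, or_self] at hz
        subst hz
        exact (hna (by rw [← e]; simp)).elim
  · refine h ⟨f, fun n hn => ?_⟩
    obtain ⟨z, hz, e⟩ := hf n hn
    rcases mem_cup.1 hz with hz | hz
    · exact ⟨z, hz, e⟩
    · rw [mem_upair, or_self] at hz
      subst hz
      exact (hc (e ▸ hn)).elim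

theorem not_sm_om_of_empty {x : M} (h : ∀ y, ¬ y ∊ x) : ¬ Sm x om := by
  rintro ⟨f, hf⟩
  obtain ⟨a, ha, _⟩ := hf emp emp_mem_om
  exact h a ha

theorem not_sm_om_of_mem {n : M} (hn : n ∊ (om : M)) : ¬ Sm n om :=
  om_induction (P := fun n => ¬ Sm n om) (not_sm_om_of_empty not_mem_emp)
    (fun _ _ h => not_sm_om_insert h) hn

/-- Passing from `n` to `suc n` adds a row, and the row is added one pair at a time by an inner
induction on its length `k`. -/
theorem not_sm_om_prd {n m : M} (hn : n ∊ (om : M)) (hm : m ∊ (om : M)) : ¬ Sm (prd n m) om := by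
  refine om_induction (P := fun n => ¬ Sm (prd n m) om) (not_sm_om_of_empty fun y hy => ?_)
    (fun n hn ih => ?_) hn
  · obtain ⟨a, _, ha, _⟩ := mem_prd.1 hy
    exact not_mem_emp a ha
  · have key : ∀ k, k ∊ (om : M) → ¬ Sm (cup (prd n m) (prd (upair n n) k)) om := by
      intro k hk
      refine om_induction (P := fun k => ¬ Sm (cup (prd n m) (prd (upair n n) k)) om)
        (fun h => ih (h.mono fun z hz => ?_))
        (fun k _ ih' h => not_sm_om_insert (a := op n k) ih' (h.mono fun z hz => ?_)) hk
      · rcases mem_cup.1 hz with hz | hz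
        · exact hz
        · obtain ⟨_, b, _, hb, _⟩ := mem_prd.1 hz
          exact (not_mem_emp b hb).elim
      · simp only [mem_cup, mem_upair] at hz ⊢
        rcases hz with hz | hz
        · exact Or.inl (Or.inl hz)
        · obtain ⟨a, b, ha, hb, rfl⟩ := mem_prd.1 hz
          rw [mem_upair, or_self] at ha
          subst ha
          rcases mem_suc.1 hb with hb | rfl
          · exact Or.inl (Or.inr (op_mem_prd.2 ⟨by simp, hb⟩))
          · exact Or.inr (Or.inl rfl)
    refine fun h => key m hm (h.mono fun z hz => ?_)
    obtain ⟨a, b, ha, hb, rfl⟩ := mem_prd.1 hz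
    rw [mem_cup, op_mem_prd, op_mem_prd]
    rcases mem_suc.1 ha with ha | rfl
    · exact Or.inl ⟨ha, hb⟩
    · exact Or.inr ⟨by simp, hb⟩

/-! ### Infinite cardinals -/

/-- `k` is an infinite cardinal. -/
def InfCard (k : M) : Prop := CardS k ∧ ∀ n, n ∊ (om : M) → n ∊ k

theorem InfCard.ordS {k : M} (h : InfCard k) : OrdS k := h.1.1

theorem om_subset_of_not_mem {a : M} (ha : OrdS a) (h : ¬ a ∊ (om : M)) {n : M}
    (hn : n ∊ (om : M)) : n ∊ a := by
  rcases ha.total ordS_om with h' | rfl | h'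
  · exact (h h').elim
  · exact hn
  · exact ha.1 _ h' n hn

-- Infinite cardinals are limits: if `suc g` were `k`, then `0 ↦ g`, `n + 1 ↦ n`, with everything
-- from `ω` on fixed, would map the smaller ordinal `g` onto `k`.
open Classical in
theorem InfCard.suc_mem {k g : M} (h : InfCard k) (hg : g ∊ k) : suc g ∊ k := by
  rcases h.ordS.suc_mem_or_eq hg with h' | rfl
  · exact h'
  exfalso
  have hgo : ¬ g ∊ (om : M) := fun hgo => not_mem_self _ (h.2 _ (suc_mem_om hgo))
  have hsub : ∀ n, n ∊ (om : M) → n ∊ g := fun n => om_subset_of_not_mem (h.ordS.mem hg) hgo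
  refine h.1.not_sm hg (Sm.of_fun (fun x => if x = emp then g else
    if x ∊ om then iota fun w => x = suc w else x) fun y hy => ?_)
  rcases mem_suc.1 hy with hy | rfl
  · by_cases hyo : y ∊ (om : M)
    · refine ⟨suc y, hsub _ (suc_mem_om hyo), ?_⟩
      rw [if_neg, if_pos (suc_mem_om hyo)]
      · exact (iota_eq fun w => ⟨fun h => (suc_inj h).symm, fun h => by rw [h]⟩).symm
      · intro h
        exact not_mem_emp y (by rw [← h]; simp)
    · refine ⟨y, hy, ?_⟩
      rw [if_neg, if_neg hyo]
      rintro rfl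
      exact hyo emp_mem_om
  · exact ⟨emp, hsub _ emp_mem_om, by rw [if_pos rfl]⟩

/-- The canonical well-ordering of pairs of ordinals. -/
def CanLt (p q : M) : Prop := ∃ a b, p = op a b ∧ ∃ c d, q = op c d ∧
  (cup a b ∊ cup c d ∨ (cup a b = cup c d ∧ (a ∊ c ∨ (a = c ∧ b ∊ d))))

instance : Dfn₂ (CanLt (M := M)) := by
  unfold CanLt
  infer_instance

theorem canLt_op {a b c d : M} : CanLt (op a b) (op c d) ↔
    (cup a b ∊ cup c d ∨ (cup a b = cup c d ∧ (a ∊ c ∨ (a = c ∧ b ∊ d)))) := by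
  constructor
  · rintro ⟨a', b', e, c', d', e', h⟩
    rw [op_inj] at e e'
    rw [e.1, e.2, e'.1, e'.2]
    exact h
  · exact fun h => ⟨a, b, rfl, c, d, rfl, h⟩

theorem OrdS.cup_eq {k a b : M} (h : OrdS k) (ha : a ∊ k) (hb : b ∊ k) :
    (a ∊ b ∨ a = b) ∧ cup a b = b ∨ b ∊ a ∧ cup a b = a := by
  rcases h.2 a b ⟨ha, hb⟩ with (h' | rfl) | h'
  · exact Or.inl ⟨Or.inl h', ZF.ext _ _ fun z => by
      rw [mem_cup]
      exact ⟨fun hz => hz.elim ((h.mem hb).1 a h' z) id, Or.inr⟩⟩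
  · exact Or.inl ⟨Or.inr rfl, ZF.ext _ _ fun z => by simp⟩
  · exact Or.inr ⟨h', ZF.ext _ _ fun z => by
      rw [mem_cup]
      exact ⟨fun hz => hz.elim id ((h.mem ha).1 b h' z), Or.inl⟩⟩

theorem OrdS.cup_mem {k a b : M} (h : OrdS k) (ha : a ∊ k) (hb : b ∊ k) : cup a b ∊ k := by
  rcases h.cup_eq ha hb with ⟨_, e⟩ | ⟨_, e⟩ <;> rwa [e]

theorem OrdS.mem_suc_cup {k a b : M} (h : OrdS k) (ha : a ∊ k) (hb : b ∊ k) :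
    a ∊ suc (cup a b) ∧ b ∊ suc (cup a b) := by
  rcases h.cup_eq ha hb with ⟨h', e⟩ | ⟨h', e⟩ <;> rw [e] <;> simp [h']

/-- On ordinals `cup` is the maximum. A minimal pair is found by minimizing in turn the maximum, the
first coordinate and the second coordinate. -/
theorem canLt_wf {k : M} (hk : OrdS k) (Y : M) (hY : ∀ y, y ∊ Y → y ∊ prd k k)
    (hne : ∃ y, y ∊ Y) : ∃ y, y ∊ Y ∧ ∀ z, z ∊ Y → ¬ CanLt z y := by
  obtain ⟨y, hy⟩ := hne
  obtain ⟨a₀, b₀, ha₀, hb₀, rfl⟩ := mem_prd.1 (hY y hy)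
  obtain ⟨m, hm, ⟨a₁, b₁, hab₁, e₁⟩, hmin⟩ := exists_minimal (X := k)
    (P := fun m => ∃ a b, op a b ∊ Y ∧ cup a b = m) ⟨_, hk.cup_mem ha₀ hb₀, a₀, b₀, hy, rfl⟩
  have h1 := op_mem_prd.1 (hY _ hab₁)
  obtain ⟨a, ha, ⟨b₂, hab₂, e₂⟩, hamin⟩ := exists_minimal (X := k)
    (P := fun a => ∃ b, op a b ∊ Y ∧ cup a b = m) ⟨a₁, h1.1, b₁, hab₁, e₁⟩
  have h2 := op_mem_prd.1 (hY _ hab₂)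
  obtain ⟨b, hb, ⟨hab, e⟩, hbmin⟩ := exists_minimal (X := k)
    (P := fun b => op a b ∊ Y ∧ cup a b = m) ⟨b₂, h2.2, hab₂, e₂⟩
  refine ⟨op a b, hab, fun z hz hlt => ?_⟩
  obtain ⟨c, d, hc, hd, rfl⟩ := mem_prd.1 (hY z hz)
  rw [canLt_op, e] at hlt
  rcases hlt with hlt | ⟨e', hlt | ⟨rfl, hlt⟩⟩
  · exact hmin _ hlt (hk.cup_mem hc hd) ⟨c, d, hz, rfl⟩
  · exact hamin c hlt hc ⟨d, hz, e'⟩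
  · exact hbmin d hlt hd ⟨hz, e'⟩

theorem canLt_total {k : M} (hk : OrdS k) {p q : M} (hp : p ∊ prd k k) (hq : q ∊ prd k k) :
    CanLt p q ∨ p = q ∨ CanLt q p := by
  obtain ⟨a, b, ha, hb, rfl⟩ := mem_prd.1 hp
  obtain ⟨c, d, hc, hd, rfl⟩ := mem_prd.1 hq
  rw [canLt_op, canLt_op, op_inj]
  have h1 := hk.2 _ _ ⟨hk.cup_mem ha hb, hk.cup_mem hc hd⟩
  have h2 := hk.2 a c ⟨ha, hc⟩
  have h3 := hk.2 b d ⟨hb, hd⟩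
  grind

theorem canLt_trans {k : M} (hk : OrdS k) {p q r : M} (hr : r ∊ prd k k)
    (h1 : CanLt p q) (h2 : CanLt q r) : CanLt p r := by
  obtain ⟨a, b, rfl, c, d, rfl, h1⟩ := h1
  obtain ⟨e, f, he, hf, rfl⟩ := mem_prd.1 hr
  rw [canLt_op] at h2 ⊢
  have ht1 := (hk.mem (hk.cup_mem he hf)).1 (cup c d)
  have ht2 := (hk.mem he).1 c
  have ht3 := (hk.mem hf).1 d
  grind

/-- Infinite cardinals below which all infinite cardinals are equal to their square have no
surjection from the square of a smaller ordinal. -/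
theorem InfCard.not_sm_prd {k : M} (hk : InfCard k)
    (ih : ∀ m, m ∊ k → InfCard m → Sm m (prd m m)) {g : M} (hg : g ∊ k) : ¬ Sm (prd g g) k := by
  intro h
  have hgo := hk.ordS.mem hg
  by_cases hgom : g ∊ (om : M)
  · exact not_sm_om_prd hgom hgom (h.subset hk.2)
  have hsub : ∀ n, n ∊ (om : M) → n ∊ g := fun n => om_subset_of_not_mem hgo hgom
  -- The least ordinal `m` that covers `g` is an infinite cardinal below `k`. Then `m` covers `m ×
  -- m`, hence `g × g`, hence `k`, contradicting that `k` is a cardinal.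
  obtain ⟨m, hm, hmg, hmin⟩ := exists_minimal (X := suc g) (P := fun m => Sm m g)
    ⟨g, by simp, Sm.refl g⟩
  have hmk : m ∊ k := by
    rcases mem_suc.1 hm with hm | rfl
    exacts [hk.ordS.1 g hg m hm, hg]
  have hmo := hk.ordS.mem hmk
  have hmi : InfCard m := by
    refine ⟨cardS_iff.2 ⟨hmo, fun d hd hs => ?_⟩, fun n hn => ?_⟩
    · exact hmin d hd ((ordS_suc hgo).1 m hm d hd) (hs.trans hmg)
    · exact om_subset_of_not_mem hmo (fun h' => not_sm_om_of_mem h' (hmg.subset hsub)) hn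
  exact hk.1.not_sm hmk (((ih m hmk hmi).trans hmg.prd).trans h)

/-- An infinite cardinal is equal to its square. -/
theorem InfCard.sm_prd {k : M} (hk : InfCard k) : Sm k (prd k k) := by
  by_contra hcon
  -- `κ` is the least counterexample, so every smaller infinite cardinal covers its square.
  obtain ⟨κ, hκs, ⟨hκ, hκn⟩, hmin⟩ := exists_minimal (X := suc k)
    (P := fun m => (OrdS m ∧ (∀ d, d ∊ m → ¬ Sm d m) ∧ ∀ n, n ∊ (om : M) → n ∊ m) ∧
      ¬ Sm m (prd m m))
    ⟨k, by simp, ⟨hk.ordS, fun d hd => hk.1.not_sm hd, hk.2⟩, hcon⟩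
  have hκ : InfCard κ := ⟨cardS_iff.2 ⟨hκ.1, hκ.2.1⟩, hκ.2.2⟩
  have ih : ∀ m, m ∊ κ → InfCard m → Sm m (prd m m) := fun m hm hmi => by
    by_contra h
    exact hmin m hm ((ordS_suc hk.ordS).1 κ hκs m hm)
      ⟨⟨hmi.ordS, fun d hd => hmi.1.not_sm hd, hmi.2⟩, h⟩
  have ho := hκ.ordS
  -- The collapse of the canonical well-ordering assigns ordinals to the pairs. They turn out to lie
  -- below `κ`, and the inverse of the collapse then covers `κ × κ`.
  obtain ⟨p, hp⟩ := exists_collapse (prd κ κ) CanLt (canLt_wf ho)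
  have hord : ∀ x, x ∊ prd κ κ → OrdS (app p x) := by
    intro x hx
    refine ⟨fun y hy z hz => ?_, fun y z h => ?_⟩
    · obtain ⟨y, hyX, hyx, rfl⟩ := (hp x hx _).1 hy
      obtain ⟨z, hzX, hzy, rfl⟩ := (hp y hyX _).1 hz
      exact (hp x hx _).2 ⟨z, hzX, canLt_trans ho hx hzy hyx, rfl⟩
    · obtain ⟨y, hyX, _, rfl⟩ := (hp x hx _).1 h.1
      obtain ⟨z, hzX, _, rfl⟩ := (hp x hx _).1 h.2
      rcases canLt_total ho hyX hzX with h | rfl | h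
      · exact Or.inl (Or.inl ((hp z hzX _).2 ⟨y, hyX, h, rfl⟩))
      · exact Or.inl (Or.inr rfl)
      · exact Or.inr ((hp y hyX _).2 ⟨z, hzX, h, rfl⟩)
  have hlt : ∀ x, x ∊ prd κ κ → app p x ∊ κ := by
    intro x hx
    by_contra hxk
    have hsub : ∀ a, a ∊ κ → a ∊ app p x := by
      rcases (hord x hx).total ho with h | h | h
      · exact (hxk h).elim
      · intro a ha
        rwa [h]
      · exact (hord x hx).1 κ h
    obtain ⟨a, b, ha, hb, rfl⟩ := mem_prd.1 hx
    have hc := ho.cup_mem ha hb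
    -- If the value at `(a, b)` is not below `κ`, every ordinal below `κ` is the value of a
    -- predecessor of `(a, b)`. The predecessors all lie in the square of the ordinal `max a b + 1`,
    -- which is below `κ`.
    refine hκ.not_sm_prd ih (hκ.suc_mem hc) ⟨p, fun y hy => ?_⟩
    obtain ⟨z, hzX, hz, rfl⟩ := (hp _ hx _).1 (hsub y hy)
    obtain ⟨c, d, hc', hd', rfl⟩ := mem_prd.1 hzX
    refine ⟨op c d, op_mem_prd.2 ?_, rfl⟩
    have h1 := ho.mem_suc_cup hc' hd'
    have h2 : cup c d ∊ suc (cup a b) := by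
      rw [mem_suc]
      rcases canLt_op.1 hz with h | h
      exacts [Or.inl h, Or.inr h.1]
    have hos := ordS_suc (ho.mem hc)
    constructor
    · rcases mem_suc.1 h1.1 with h | h
      · exact hos.1 _ h2 _ h
      · rwa [h]
    · rcases mem_suc.1 h1.2 with h | h
      · exact hos.1 _ h2 _ h
      · rwa [h]
  refine hκn (Sm.of_fun (fun a => iota fun x => x ∊ prd κ κ ∧ app p x = a) fun x hx => ?_)
  refine ⟨app p x, hlt x hx, (iota_eq fun w => ⟨fun h => ?_, ?_⟩).symm⟩
  · obtain ⟨hw, e⟩ := h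
    rcases canLt_total ho hw hx with h | h | h
    · exact (not_mem_self (app p w) (by
        nth_rw 2 [e]
        exact (hp x hx _).2 ⟨w, hw, h, rfl⟩)).elim
    · exact h
    · exact (not_mem_self (app p x) (by
        nth_rw 2 [← e]
        exact (hp w hw _).2 ⟨x, hx, h, rfl⟩)).elim
  · rintro rfl
    exact ⟨hx, rfl⟩

end Small

end AMCSpectrum

namespace AMCSpectrum

/-! ## The sets of hereditary cardinality at most `k` -/

section Hereditary

variable {M : Type u} [LSet.Structure M] [ZF M]

/-- A pair of coordinate functions with which `k` covers its square. -/
theorem InfCard.exists_coords {k : M} (hk : InfCard k) : ∃ p₁ p₂ : M → M, DF₁ p₁ ∧ DF₁ p₂ ∧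
    ∀ a b, a ∊ k → b ∊ k → ∃ c, c ∊ k ∧ p₁ c = a ∧ p₂ c = b := by
  obtain ⟨h, hh⟩ := hk.sm_prd
  refine ⟨fun c => iota fun a => ∃ b, app h c = op a b, fun c => iota fun b => ∃ a, app h c = op a b,
    inferInstance, inferInstance, fun a b ha hb => ?_⟩
  obtain ⟨c, hc, e⟩ := hh (op a b) (op_mem_prd.2 ⟨ha, hb⟩)
  refine ⟨c, hc, iota_eq fun w => ?_, iota_eq fun w => ?_⟩ <;> simp [← e, op_inj, eq_comm]

theorem InfCard.sm_upair {k : M} (hk : InfCard k) (a b : M) : Sm k (upair a b) := by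
  classical
  refine Sm.of_fun (fun c => if c = emp then a else b) fun y hy => ?_
  rcases mem_upair.1 hy with rfl | rfl
  · exact ⟨emp, hk.2 _ emp_mem_om, by rw [if_pos rfl]⟩
  · refine ⟨suc emp, hk.2 _ (suc_mem_om emp_mem_om), ?_⟩
    rw [if_neg]
    intro h
    exact not_mem_emp (emp : M) (by nth_rw 2 [← h]; simp)

/-- Choose a covering function for each element of `x`. A code `c` in `k` splits into the index of
an element of `x` and an argument of its covering function. -/
theorem InfCard.sm_sUn {k : M} (hk : InfCard k) {x : M} (hx : Sm k x)
    (h : ∀ y, y ∊ x → Sm k y) : Sm k (sUn x) := by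
  obtain ⟨p₁, p₂, h1, h2, hp⟩ := hk.exists_coords
  obtain ⟨e, he⟩ := hx
  obtain ⟨g, _, hg⟩ := exists_fun (fun y f => ∀ z, z ∊ y → ∃ a, a ∊ k ∧ z = app f a) x h
  refine Sm.of_fun (fun c => app (app g (app e (p₁ c))) (p₂ c)) fun z hz => ?_
  obtain ⟨y, hy, hzy⟩ := mem_sUn.1 hz
  obtain ⟨a, ha, rfl⟩ := he y hy
  obtain ⟨b, hb, rfl⟩ := hg _ hy z hzy
  obtain ⟨c, hc, rfl, rfl⟩ := hp a b ha hb
  exact ⟨c, hc, rfl⟩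

theorem InfCard.sm_cup {k : M} (hk : InfCard k) {x y : M} (hx : Sm k x) (hy : Sm k y) :
    Sm k (cup x y) :=
  hk.sm_sUn (hk.sm_upair x y) fun z hz => by
    rcases mem_upair.1 hz with rfl | rfl
    exacts [hx, hy]

theorem InfCard.sm_prd_of_sm {k : M} (hk : InfCard k) {x y : M} (hx : Sm k x) (hy : Sm k y) :
    Sm k (prd x y) :=
  (hk.sm_prd.trans (hk.sm_cup hx hy).prd).subset fun z hz => by
    obtain ⟨a, b, ha, hb, rfl⟩ := mem_prd.1 hz
    exact op_mem_prd.2 ⟨by simp [ha], by simp [hb]⟩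

/-- `x` is a subset of a transitive set covered by `k`. -/
def Hs (k x : M) : Prop := ∃ t, TransS t ∧ (∀ y, y ∊ x → y ∊ t) ∧ Sm k t

theorem Hs.mem {k x y : M} (h : Hs k x) (hy : y ∊ x) : Hs k y := by
  obtain ⟨t, ht, hx, hs⟩ := h
  exact ⟨t, ht, ht y (hx y hy), hs⟩

theorem Hs.sm {k x : M} (h : Hs k x) : Sm k x := by
  obtain ⟨t, ht, hx, hs⟩ := h
  exact hs.subset hx

theorem Hs.subset {k x y : M} (h : Hs k x) (hy : ∀ z, z ∊ y → z ∊ x) : Hs k y := by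
  obtain ⟨t, ht, hx, hs⟩ := h
  exact ⟨t, ht, fun z hz => hx z (hy z hz), hs⟩

theorem Hs.mono {k k' x : M} (h : Hs k x) (hk : ∀ z, z ∊ k → z ∊ k') : Hs k' x := by
  obtain ⟨t, ht, hx, hs⟩ := h
  exact ⟨t, ht, hx, hs.mono hk⟩

variable {k : M}

/-- Choose for each element a small transitive set including it. The union of these sets together
with `x` itself is transitive, and it is small because `k` covers unions of `k` many sets covered by
`k`. -/
theorem InfCard.hs_of_sm (hk : InfCard k) {x : M} (h : ∀ y, y ∊ x → Hs k y) (hs : Sm k x) :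
    Hs k x := by
  obtain ⟨g, _, hg⟩ := exists_fun (fun y t => TransS t ∧ (∀ z, z ∊ y → z ∊ t) ∧ Sm k t) x h
  refine ⟨cup (sUn (img (fun y => app g y) x)) x, fun y hy z hz => ?_, fun y hy => by simp [hy],
    hk.sm_cup (hk.sm_sUn (hs.img _) fun y hy => ?_) hs⟩
  · simp only [mem_cup, mem_sUn, mem_img] at hy ⊢
    left
    rcases hy with ⟨_, ⟨w, hw, rfl⟩, hy⟩ | hy
    · exact ⟨_, ⟨w, hw, rfl⟩, (hg w hw).1 y hy z hz⟩
    · exact ⟨_, ⟨y, hy, rfl⟩, (hg y hy).2.1 z hz⟩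
  · obtain ⟨w, hw, rfl⟩ := mem_img.1 hy
    exact (hg w hw).2.2

theorem InfCard.hs_upair (hk : InfCard k) {x y : M} (hx : Hs k x) (hy : Hs k y) :
    Hs k (upair x y) :=
  hk.hs_of_sm (fun z hz => by
    rcases mem_upair.1 hz with rfl | rfl
    exacts [hx, hy]) (hk.sm_upair x y)

theorem InfCard.hs_op (hk : InfCard k) {x y : M} (hx : Hs k x) (hy : Hs k y) : Hs k (op x y) :=
  hk.hs_upair (hk.hs_upair hx hx) (hk.hs_upair hx hy)

theorem InfCard.hs_prd (hk : InfCard k) {x y : M} (hx : Hs k x) (hy : Hs k y) : Hs k (prd x y) :=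
  hk.hs_of_sm (fun z hz => by
    obtain ⟨a, b, ha, hb, rfl⟩ := mem_prd.1 hz
    exact hk.hs_op (hx.mem ha) (hy.mem hb)) (hk.sm_prd_of_sm hx.sm hy.sm)

theorem Hs.sUn {x : M} (h : Hs k x) : Hs k (sUn x) := by
  obtain ⟨t, ht, hx, hs⟩ := h
  refine ⟨t, ht, fun z hz => ?_, hs⟩
  obtain ⟨y, hy, hzy⟩ := mem_sUn.1 hz
  exact ht y (hx y hy) z hzy

theorem InfCard.hs_emp (hk : InfCard k) : Hs k (emp : M) :=
  ⟨k, hk.ordS.1, fun y hy => (not_mem_emp y hy).elim, Sm.refl k⟩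

theorem InfCard.hs_om (hk : InfCard k) : Hs k (om : M) := ⟨k, hk.ordS.1, hk.2, Sm.refl k⟩

/-- Choosing a preimage for each element turns a covering function into an injection; conversely the
inverse of an injection covers. -/
theorem sm_iff_injS {t : M} : Sm k t ↔ ∃ f, InjS f t k := by
  constructor
  · rintro ⟨f, hf⟩
    obtain ⟨g, hg, hgP⟩ := exists_fun (fun y a => a ∊ k ∧ y = app f a) t hf
    refine ⟨g, ⟨hg, fun a b hab => ?_⟩, fun a a₁ b h => ?_⟩
    · rw [pairInS_iff, hg.op_mem_iff] at hab
      rw [hab.2]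
      exact (hgP a hab.1).1
    · rw [pairInS_iff, pairInS_iff, hg.op_mem_iff, hg.op_mem_iff] at h
      obtain ⟨⟨h1, e1⟩, h2, e2⟩ := h
      rw [(hgP a h1).2, (hgP a₁ h2).2, ← e1, ← e2]
  · rintro ⟨f, hf⟩
    refine Sm.of_fun (fun a => iota fun y => op y a ∊ f) fun y hy => ⟨app f y, ?_, ?_⟩
    · refine hf.1.2 y _ ?_
      rw [pairInS_iff, hf.1.1.op_mem_iff]
      exact ⟨hy, rfl⟩
    · have h1 : op y (app f y) ∊ f := hf.1.1.op_mem_iff.2 ⟨hy, rfl⟩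
      refine (iota_eq fun w => ⟨fun hw => ?_, ?_⟩).symm
      · exact hf.2 w y (app f y) ⟨pairInS_iff.2 hw, pairInS_iff.2 h1⟩
      · rintro rfl
        exact h1

/-- The transitive closure need not be constructed in advance: it is separated from any small
transitive set including `x`, as the part lying in all such transitive sets. -/
theorem inHPlusS_iff {x : M} : InHPlusS k x ↔ Hs k x := by
  constructor
  · rintro ⟨t, ht, hf⟩
    exact ⟨t, ht.1.1, ht.1.2, sm_iff_injS.2 hf⟩
  · rintro ⟨t, ht, hx, hs⟩
    have hc : ∀ y, y ∊ cls (fun y => y ∊ t ∧ ∀ s, (TransS s ∧ ∀ y, y ∊ x → y ∊ s) → y ∊ s) ↔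
      y ∊ t ∧ ∀ s, (TransS s ∧ ∀ y, y ∊ x → y ∊ s) → y ∊ s := fun y => mem_cls_sep y
    refine ⟨_, ⟨⟨fun y hy z hz => ?_, fun y hy => ?_⟩, fun s hs' y hy => ?_⟩,
      sm_iff_injS.1 (hs.subset fun y hy => ((hc y).1 hy).1)⟩
    · rw [hc] at hy ⊢
      exact ⟨ht y hy.1 z hz, fun s hs' => hs'.1 y (hy.2 s hs') z hz⟩
    · exact (hc y).2 ⟨hx y hy, fun s hs' => hs'.2 y hy⟩
    · exact ((hc y).1 hy).2 s hs'

end Hereditary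

/-! ## Löwenheim–Skolem hulls of size `k` -/

section Demand

variable {M : Type u} [LSet.Structure M]

/-- A witness demand `(n, φ)`: for all `v` there should be a `y` with `φ(y, v)`, if there is any. -/
abbrev Demand : Type := Σ n : ℕ, LSet.Formula (Fin (n + 1))

theorem dfn_demand (d : Demand) {Γ : Type u} [Ctx M Γ] (y : Γ → M) (v : Fin d.1 → Γ → M) [DF y]
    (hv : ∀ i, DF (v i)) : Dfn M fun γ => d.2.Realize (Fin.cons (y γ) fun i => v i γ : Fin _ → M) := by
  refine (Dfn.realize d.2 (M := M) (Γ := Γ) (Fin.cons y v) (fun i _ => i.elim0) (fun i => ?_)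
    fun i => i.elim0).congr fun γ => ?_
  · refine Fin.cases ?_ (fun i => ?_) i
    · simpa
    · simpa using hv i
  · unfold Formula.Realize
    refine iff_of_eq (congrArg₂ _ ?_ (Subsingleton.elim _ _))
    funext i
    refine Fin.cases ?_ (fun i => ?_) i <;> simp

end Demand

section Hull

variable {M : Type u} [LSet.Structure M] [ZF M] {k : M}

/-- `n`-tuples of elements of `k` are coded by elements of `k`. -/
theorem InfCard.exists_tuple_coords (hk : InfCard k) (n : ℕ) : ∃ u : Fin n → M → M,
    (∀ i, DF₁ (u i)) ∧ ∀ v : Fin n → M, (∀ i, v i ∊ k) → ∃ c, c ∊ k ∧ ∀ i, u i c = v i := by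
  induction n with
  | zero => exact ⟨fun i => i.elim0, fun i => i.elim0, fun v _ =>
      ⟨emp, hk.2 _ emp_mem_om, fun i => i.elim0⟩⟩
  | succ n ih =>
    obtain ⟨u, hu, h⟩ := ih
    obtain ⟨p₁, p₂, h1, h2, hp⟩ := hk.exists_coords
    refine ⟨Fin.cons p₁ fun i c => u i (p₂ c), fun i => ?_, fun v hv => ?_⟩
    · refine Fin.cases ?_ (fun i => ?_) i
      · exact h1
      · have := hu i
        simp only [Fin.cons_succ]
        infer_instance
    · obtain ⟨b, hb, e⟩ := h (fun i => v i.succ) fun i => hv _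
      obtain ⟨c, hc, e1, e2⟩ := hp (v 0) b (hv 0) hb
      refine ⟨c, hc, fun i => ?_⟩
      refine Fin.cases ?_ (fun i => ?_) i
      · simpa using e1
      · simp only [Fin.cons_succ, e2, e]

/-- The range of `e'` contains witnesses in `t` for the demand `d`, for all tuples from the range
of `e`, as coded by `u`. -/
def Meets (k t : M) (d : Demand) (u : Fin d.1 → M → M) (e e' : M) : Prop :=
  ∀ c, c ∊ k → (∃ y, y ∊ t ∧ d.2.Realize (Fin.cons y fun i => app e (u i c) : Fin _ → M)) →
    ∃ y, y ∊ t ∧ (∃ a, a ∊ k ∧ y = app e' a) ∧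
      d.2.Realize (Fin.cons y fun i => app e (u i c) : Fin _ → M)

theorem Meets.dfn (t : M) (d : Demand) (u : Fin d.1 → M → M) (hu : ∀ i, DF₁ (u i)) :
    Dfn₂ (Meets k t d u) := by
  have h := fun {Γ : Type u} [Ctx M Γ] (y e c : Γ → M) [DF y] [DF e] [DF c] =>
    dfn_demand d y (fun i γ => app (e γ) (u i (c γ))) fun i => by
      have := hu i
      infer_instance
  have h1 : Dfn M fun p : (((PUnit.{u + 1} × M) × M) × M) × M =>
      d.2.Realize (Fin.cons p.2 fun i => app p.1.1.1.2 (u i p.1.2) : Fin _ → M) :=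
    h (Γ := (((PUnit.{u + 1} × M) × M) × M) × M) (fun p => p.2) (fun p => p.1.1.1.2)
      fun p => p.1.2
  unfold Meets
  infer_instance

/-- Replacement with choice picks a witness for each code `c`; where none exists the value is
irrelevant. -/
theorem exists_meets (k t : M) (d : Demand) (u : Fin d.1 → M → M)
    (hu : ∀ i, DF₁ (u i)) (e : M) : ∃ g, Meets k t d u e g := by
  have h1 : Dfn M fun p : (PUnit.{u + 1} × M) × M =>
      d.2.Realize (Fin.cons p.2 fun i => app e (u i p.1.2) : Fin _ → M) :=
    dfn_demand d (fun p : (PUnit.{u + 1} × M) × M => p.2) (fun i p => app e (u i p.1.2)) fun i => by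
      have := hu i
      infer_instance
  have h2 : Dfn M fun p : ((PUnit.{u + 1} × M) × M) × M =>
      d.2.Realize (Fin.cons p.2 fun i => app e (u i p.1.1.2) : Fin _ → M) :=
    dfn_demand d (fun p : ((PUnit.{u + 1} × M) × M) × M => p.2) (fun i p => app e (u i p.1.1.2))
      fun i => by
        have := hu i
        infer_instance
  obtain ⟨g, _, hg⟩ := exists_fun (fun c y =>
    (∃ y, y ∊ t ∧ d.2.Realize (Fin.cons y fun i => app e (u i c) : Fin _ → M)) →
      y ∊ t ∧ d.2.Realize (Fin.cons y fun i => app e (u i c) : Fin _ → M)) k fun c _ => by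
    by_cases h : ∃ y, y ∊ t ∧ d.2.Realize (Fin.cons y fun i => app e (u i c) : Fin _ → M)
    · obtain ⟨y, hy⟩ := h
      exact ⟨y, fun _ => hy⟩
    · exact ⟨c, fun h' => (h h').elim⟩
  exact ⟨g, fun c hc h => ⟨app g c, (hg c hc h).1, ⟨c, hc, rfl⟩, (hg c hc h).2⟩⟩

/-- `y` is a value of `e` on `k`. -/
def Val (k e y : M) : Prop := ∃ a, a ∊ k ∧ y = app e a

theorem Meets.mono {t : M} {d : Demand} {u : Fin d.1 → M → M} {e g g' : M} (h : Meets k t d u e g)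
    (hg : ∀ y, y ∊ t → Val k g y → Val k g' y) : Meets k t d u e g' := fun c hc hex => by
  obtain ⟨y, hyt, hy, hr⟩ := h c hc hex
  exact ⟨y, hyt, hg y hyt hy, hr⟩

/-- One function takes the values of both: the first coordinate of the code selects the function,
the second is its argument. -/
theorem InfCard.exists_val_or (hk : InfCard k) (e g : M) :
    ∃ e', ∀ y, Val k e y ∨ Val k g y → Val k e' y := by
  classical
  obtain ⟨p₁, p₂, h1, h2, hp⟩ := hk.exists_coords
  have hz := hk.2 _ emp_mem_om
  have ho := hk.2 _ (suc_mem_om emp_mem_om)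
  have hne : suc (emp : M) ≠ emp := fun h => not_mem_emp (emp : M) (by nth_rw 2 [← h]; simp)
  refine ⟨lam (fun c => if p₁ c = emp then app e (p₂ c) else app g (p₂ c)) k, fun y hy => ?_⟩
  rcases hy with ⟨a, ha, rfl⟩ | ⟨a, ha, rfl⟩
  · obtain ⟨c, hc, e1, e2⟩ := hp emp a hz ha
    exact ⟨c, hc, by rw [app_lam hc, if_pos e1, e2]⟩
  · obtain ⟨c, hc, e1, e2⟩ := hp (suc emp) a ho ha
    exact ⟨c, hc, by rw [app_lam hc, if_neg (by rw [e1]; exact hne), e2]⟩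

/-- The enumerations have to range over a set so that a step function can be chosen on it.
Redirecting values outside `t` to `x₀` puts them into the power set of `k × t`. -/
theorem exists_val_normal {t : M} (k : M) (ht : ∃ x, x ∊ t) (e : M) : ∃ e', e' ∊ pow (prd k t) ∧
    (∀ y, y ∊ t → Val k e y → Val k e' y) ∧ ∀ y, Val k e' y → y ∊ t := by
  classical
  obtain ⟨x₀, hx₀⟩ := ht
  have hval : ∀ a, (if app e a ∊ t then app e a else x₀) ∊ t := fun a => by
    split_ifs with h
    exacts [h, hx₀]
  refine ⟨lam (fun a => if app e a ∊ t then app e a else x₀) k, ?_, ?_, ?_⟩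
  · rw [mem_pow]
    intro p hp
    obtain ⟨a, ha, rfl⟩ := mem_lam.1 hp
    exact op_mem_prd.2 ⟨ha, hval a⟩
  · rintro y hyt ⟨a, ha, rfl⟩
    exact ⟨a, ha, by rw [app_lam ha, if_pos hyt]⟩
  · rintro y ⟨a, ha, rfl⟩
    rw [app_lam ha]
    exact hval a

theorem InfCard.exists_meets_list (hk : InfCard k) (t : M) (u : ∀ d : Demand, Fin d.1 → M → M)
    (hu : ∀ d i, DF₁ (u d i)) (ds : List Demand) (e : M) :
    ∃ g, (∀ y, Val k e y → Val k g y) ∧ ∀ d ∈ ds, Meets k t d (u d) e g := by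
  induction ds with
  | nil => exact ⟨e, fun _ => id, by simp⟩
  | cons d ds ih =>
    obtain ⟨g, hg, hm⟩ := ih
    obtain ⟨g', hg'⟩ := exists_meets k t d (u d) (hu d) e
    obtain ⟨g'', h⟩ := hk.exists_val_or g g'
    refine ⟨g'', fun y hy => h y (Or.inl (hg y hy)), ?_⟩
    rw [List.forall_mem_cons]
    exact ⟨hg'.mono fun y _ hy => h y (Or.inr hy),
      fun d hd => (hm d hd).mono fun y _ hy => h y (Or.inl hy)⟩

theorem Meets.dfn_list (t : M) (u : ∀ d : Demand, Fin d.1 → M → M) (hu : ∀ d i, DF₁ (u d i))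
    (ds : List Demand) : Dfn₂ fun e g : M => ∀ d ∈ ds, Meets k t d (u d) e g := by
  induction ds with
  | nil => exact (Dfn.const True).congr fun γ => by simp
  | cons d ds ih =>
    have := Meets.dfn (k := k) t d (u d) (hu d)
    exact (inferInstance : Dfn₂ fun e g : M => Meets k t d (u d) e g ∧
      ∀ d ∈ ds, Meets k t d (u d) e g).congr fun γ => List.forall_mem_cons

/-- Inside a set `t`, a set covered by `k` is contained in one which is closed under witnesses for
finitely many demands. -/
theorem InfCard.exists_hull (hk : InfCard k) (t x₀ : M) (hx₀ : ∀ y, y ∊ x₀ → y ∊ t)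
    (hne : ∃ y, y ∊ x₀) (hs : Sm k x₀) (ds : List Demand) :
    ∃ X, (∀ y, y ∊ X → y ∊ t) ∧ (∀ y, y ∊ x₀ → y ∊ X) ∧ Sm k X ∧
      ∀ d ∈ ds, ∀ v : Fin d.1 → M, (∀ i, v i ∊ X) →
        (∃ y, y ∊ t ∧ d.2.Realize (Fin.cons y v : Fin _ → M)) →
        ∃ y, y ∊ X ∧ d.2.Realize (Fin.cons y v : Fin _ → M) := by
  choose u hu huc using fun d : Demand => hk.exists_tuple_coords d.1
  have htne : ∃ y, y ∊ t := hne.imp hx₀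
  have hdl := Meets.dfn_list (k := k) t u hu ds
  let Nm : M → Prop := fun e => e ∊ pow (prd k t) ∧ ∀ a, a ∊ k → app e a ∊ t
  have hNm : Dfn₁ Nm := by
    change Dfn₁ fun e => e ∊ pow (prd k t) ∧ ∀ a, a ∊ k → app e a ∊ t
    infer_instance
  -- `St e g`: the enumeration `g` keeps the values of `e` and adds witnesses for all demands with
  -- parameters among the values of `e`.
  let St : M → M → Prop := fun e g => Nm g ∧
    (∀ a, a ∊ k → ∃ b, b ∊ k ∧ app e a = app g b) ∧ ∀ d ∈ ds, Meets k t d (u d) e g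
  have hSt : Dfn₂ St := by
    change Dfn₂ fun e g => Nm g ∧ (∀ a, a ∊ k → ∃ b, b ∊ k ∧ app e a = app g b) ∧
      ∀ d ∈ ds, Meets k t d (u d) e g
    infer_instance
  have hP : ∀ e, e ∊ cls (fun e => e ∊ pow (prd k t) ∧ ∀ a, a ∊ k → app e a ∊ t) ↔ Nm e :=
    fun e => mem_cls_sep e
  have hnorm : ∀ e, ∃ g, Nm g ∧ ∀ y, y ∊ t → Val k e y → Val k g y := fun e => by
    obtain ⟨g, h1, h2, h3⟩ := exists_val_normal k htne e
    exact ⟨g, ⟨h1, fun a ha => h3 _ ⟨a, ha, rfl⟩⟩, h2⟩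
  obtain ⟨G, _, hG⟩ := exists_fun St
    (cls fun e => e ∊ pow (prd k t) ∧ ∀ a, a ∊ k → app e a ∊ t) fun e he => by
      rw [hP] at he
      obtain ⟨g, hg1, hg2⟩ := hk.exists_meets_list t u hu ds e
      obtain ⟨g', hg', h⟩ := hnorm g
      exact ⟨g', hg', fun a ha => h _ (he.2 a ha) (hg1 _ ⟨a, ha, rfl⟩),
        fun d hd => (hg2 d hd).mono h⟩
  obtain ⟨f₀, hf₀⟩ := hs
  obtain ⟨e₀, he₀, h₀⟩ := hnorm f₀
  -- The hull consists of the values of the enumerations `s n`, obtained by iterating the chosen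
  -- step function `G` along `ω`.
  obtain ⟨s, hs0, hsS⟩ := om_recursion (fun e => app G e) e₀
  have hsN : ∀ n, n ∊ (om : M) → Nm (app s n) := fun n hn => by
    refine om_induction (P := fun n => Nm (app s n)) (by rwa [hs0]) (fun n hn ih => ?_) hn
    rw [hsS n hn]
    exact (hG _ ((hP _).2 ih)).1
  have hstep : ∀ n, n ∊ (om : M) → St (app s n) (app s (suc n)) := fun n hn => by
    rw [hsS n hn]
    exact hG _ ((hP _).2 (hsN n hn))
  have hmono : ∀ m, m ∊ (om : M) → ∀ n, n ∊ m → ∀ a, a ∊ k →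
      ∃ b, b ∊ k ∧ app (app s n) a = app (app s m) b := fun m hm => by
    refine om_induction (P := fun m => ∀ n, n ∊ m → ∀ a, a ∊ k →
      ∃ b, b ∊ k ∧ app (app s n) a = app (app s m) b) (by simp) (fun m hm ih n hn a ha => ?_) hm
    rcases mem_suc.1 hn with hn | rfl
    · obtain ⟨b, hb, e⟩ := ih n hn a ha
      rw [e]
      exact (hstep m hm).2.1 b hb
    · exact (hstep n hm).2.1 a ha
  have hmem : ∀ y, y ∊ cls (fun y => y ∊ t ∧ ∃ n, n ∊ (om : M) ∧ ∃ a, a ∊ k ∧ y = app (app s n) a) ↔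
      y ∊ t ∧ ∃ n, n ∊ (om : M) ∧ ∃ a, a ∊ k ∧ y = app (app s n) a := fun y => mem_cls_sep y
  refine ⟨_, fun y hy => ((hmem y).1 hy).1, fun y hy => ?_, ?_, fun d hd v hv hex => ?_⟩
  · obtain ⟨a, ha, e⟩ := h₀ y (hx₀ y hy) (hf₀ y hy)
    exact (hmem y).2 ⟨hx₀ y hy, emp, emp_mem_om, a, ha, by rw [hs0, e]⟩
  · obtain ⟨p₁, p₂, h1, h2, hp⟩ := hk.exists_coords
    refine Sm.of_fun (fun c => app (app s (p₁ c)) (p₂ c)) fun y hy => ?_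
    obtain ⟨_, n, hn, a, ha, rfl⟩ := (hmem y).1 hy
    obtain ⟨c, hc, rfl, rfl⟩ := hp n a (hk.2 n hn) ha
    exact ⟨c, hc, rfl⟩
  -- The stages increase, so a finite tuple from the hull already appears at one stage `N`; its
  -- witnesses appear at the next stage.
  · have hN : ∀ (r : ℕ) (w : Fin r → M), (∀ i, ∃ n, n ∊ (om : M) ∧ Val k (app s n) (w i)) →
        ∃ N, N ∊ (om : M) ∧ ∀ i, Val k (app s N) (w i) := by
      intro r
      induction r with
      | zero => exact fun w _ => ⟨emp, emp_mem_om, fun i => i.elim0⟩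
      | succ r ih =>
        intro w hw
        obtain ⟨N, hN, h⟩ := ih (fun i => w i.succ) fun i => hw _
        obtain ⟨n, hn, h'⟩ := hw 0
        have up : ∀ n m y, m ∊ (om : M) → n ∊ m → Val k (app s n) y → Val k (app s m) y := by
          rintro n m _ hm hnm ⟨a, ha, rfl⟩
          exact hmono m hm n hnm a ha
        rcases ordS_om.2 n N ⟨hn, hN⟩ with (hlt | rfl) | hlt
        · refine ⟨N, hN, Fin.cases (up n N _ hN hlt h') h⟩
        · exact ⟨n, hn, Fin.cases h' h⟩
        · exact ⟨n, hn, Fin.cases h' fun i => up N n _ hn hlt (h i)⟩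
    obtain ⟨N, hN, h⟩ := hN d.1 v fun i => ((hmem _).1 (hv i)).2
    choose a ha e using h
    obtain ⟨c, hc, hca⟩ := huc d a ha
    have hv' : v = fun i => app (app s N) (u d i c) := funext fun i => by rw [hca, e]
    rw [hv'] at hex ⊢
    obtain ⟨y, hyt, ⟨b, hb, rfl⟩, hr⟩ := (hstep N hN).2.2 d hd c hc hex
    exact ⟨_, (hmem _).2 ⟨hyt, suc N, suc_mem_om hN, b, hb, rfl⟩, hr⟩

end Hull

end AMCSpectrum

namespace AMCSpectrum

/-! ## Semantics of the formulas -/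

section RealizeGeneral

variable {L : FirstOrder.Language.{0, 0}} {M : Type*} [L.Structure M] {α β : Type} {n : ℕ}
  {v : α → M} {xs : Fin n → M}

@[simp] theorem elim_up (x : α ⊕ Fin n) (y : M) :
    Sum.elim v (Fin.snoc xs y : Fin (n + 1) → M) x↟ = Sum.elim v xs x := by
  rcases x with x | x <;> simp [up]

theorem elim_last (y : M) :
    Sum.elim v (Fin.snoc xs y : Fin (n + 1) → M) (Sum.inr (Fin.last n)) = y := by
  simp

@[simp] theorem realize_allF (f : α ⊕ Fin (n + 1) → L.BoundedFormula α (n + 1)) :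
    (allF f).Realize v xs ↔ ∀ y : M, (f (Sum.inr (Fin.last n))).Realize v (Fin.snoc xs y) := by
  simp [allF]

@[simp] theorem realize_exF (f : α ⊕ Fin (n + 1) → L.BoundedFormula α (n + 1)) :
    (exF f).Realize v xs ↔ ∃ y : M, (f (Sum.inr (Fin.last n))).Realize v (Fin.snoc xs y) := by
  simp [exF]

@[simp] theorem realize_eqF (x y : α ⊕ Fin n) :
    (eqF x y : L.BoundedFormula α n).Realize v xs ↔ Sum.elim v xs x = Sum.elim v xs y := by
  simp [eqF]

@[simp] theorem realize_plug (φ : L.Formula β) (g : β → α ⊕ Fin n) :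
    (plug φ g).Realize v xs ↔ φ.Realize fun i => Sum.elim v xs (g i) := by
  rw [plug, BoundedFormula.realize_relabel, Formula.Realize]
  refine iff_of_eq (congrArg₂ _ ?_ (Subsingleton.elim _ _))
  funext i
  rfl

end RealizeGeneral

section Realize

variable {M : Type*} [LSet.Structure M] {α : Type} {n : ℕ} {v : α → M} {xs : Fin n → M}

@[simp] theorem realize_mem (x y : α ⊕ Fin n) :
    (mem x y).Realize v xs ↔ Sum.elim v xs x ∊ Sum.elim v xs y :=
  BoundedFormula.realize_rel₂

@[simp] theorem realize_nonemptyF (x : α ⊕ Fin n) :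
    (nonemptyF x).Realize v xs ↔ ∃ y, y ∊ Sum.elim v xs x := by
  simp [nonemptyF]

@[simp] theorem realize_subsetF (x y : α ⊕ Fin n) :
    (subsetF x y).Realize v xs ↔ ∀ z, z ∊ Sum.elim v xs x → z ∊ Sum.elim v xs y := by
  simp [subsetF]

@[simp] theorem realize_isUPair (z x y : α ⊕ Fin n) :
    (isUPair z x y).Realize v xs ↔
      UPairS (Sum.elim v xs z) (Sum.elim v xs x) (Sum.elim v xs y) := by
  simp [isUPair, UPairS]

@[simp] theorem realize_isPair (p x y : α ⊕ Fin n) :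
    (isPair p x y).Realize v xs ↔
      PairS (Sum.elim v xs p) (Sum.elim v xs x) (Sum.elim v xs y) := by
  simp [isPair, PairS]

@[simp] theorem realize_isTriple (p x y z : α ⊕ Fin n) :
    (isTriple p x y z).Realize v xs ↔ ∃ q, PairS q (Sum.elim v xs x) (Sum.elim v xs y) ∧
      PairS (Sum.elim v xs p) q (Sum.elim v xs z) := by
  simp [isTriple]

@[simp] theorem realize_pairIn (r x y : α ⊕ Fin n) :
    (pairIn r x y).Realize v xs ↔
      PairInS (Sum.elim v xs r) (Sum.elim v xs x) (Sum.elim v xs y) := by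
  simp [pairIn, PairInS]

@[simp] theorem realize_tripleIn (r x y z : α ⊕ Fin n) :
    (tripleIn r x y z).Realize v xs ↔ ∃ p, (∃ q, PairS q (Sum.elim v xs x) (Sum.elim v xs y) ∧
      PairS p q (Sum.elim v xs z)) ∧ p ∊ Sum.elim v xs r := by
  simp [tripleIn]

@[simp] theorem realize_isFunOn (f x : α ⊕ Fin n) :
    (isFunOn f x).Realize v xs ↔ FunOnS (Sum.elim v xs f) (Sum.elim v xs x) := by
  simp [isFunOn, FunOnS]

@[simp] theorem realize_isFun (f x y : α ⊕ Fin n) :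
    (isFun f x y).Realize v xs ↔
      FunS (Sum.elim v xs f) (Sum.elim v xs x) (Sum.elim v xs y) := by
  simp [isFun, FunS]

@[simp] theorem realize_isSurj (f x y : α ⊕ Fin n) :
    (isSurj f x y).Realize v xs ↔
      SurjS (Sum.elim v xs f) (Sum.elim v xs x) (Sum.elim v xs y) := by
  simp [isSurj, SurjS]

@[simp] theorem realize_isInj (f x y : α ⊕ Fin n) :
    (isInj f x y).Realize v xs ↔
      InjS (Sum.elim v xs f) (Sum.elim v xs x) (Sum.elim v xs y) := by
  simp [isInj, InjS]

@[simp] theorem realize_isTransitive (x : α ⊕ Fin n) :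
    (isTransitive x).Realize v xs ↔ TransS (Sum.elim v xs x) := by
  simp [isTransitive, TransS]

@[simp] theorem realize_isOrd (x : α ⊕ Fin n) :
    (isOrd x).Realize v xs ↔ OrdS (Sum.elim v xs x) := by
  simp [isOrd, OrdS]

@[simp] theorem realize_isCard (x : α ⊕ Fin n) :
    (isCard x).Realize v xs ↔ CardS (Sum.elim v xs x) := by
  simp [isCard, CardS]

@[simp] theorem realize_isLimitLike (x : α ⊕ Fin n) :
    (isLimitLike x).Realize v xs ↔ LimS (Sum.elim v xs x) := by
  simp [isLimitLike, LimS]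

@[simp] theorem realize_isOmega (x : α ⊕ Fin n) :
    (isOmega x).Realize v xs ↔ OmegaS (Sum.elim v xs x) := by
  simp [isOmega, OmegaS]

@[simp] theorem realize_isInfinite (x : α ⊕ Fin n) :
    (isInfinite x).Realize v xs ↔ ∃ w, OmegaS w ∧ ∀ z, z ∊ w → z ∊ Sum.elim v xs x := by
  simp [isInfinite]

@[simp] theorem realize_isTrcl (t x : α ⊕ Fin n) :
    (isTrcl t x).Realize v xs ↔ TrclS (Sum.elim v xs t) (Sum.elim v xs x) := by
  simp [isTrcl, TrclS]

@[simp] theorem realize_inHPlus (l x : α ⊕ Fin n) :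
    (inHPlus l x).Realize v xs ↔ InHPlusS (Sum.elim v xs l) (Sum.elim v xs x) := by
  simp [inHPlus, InHPlusS]

end Realize

/-! ## Models of ZFC -/

section ModelsZFC

variable {M : Type u} [LSet.Structure M]

theorem Dfn₁.exists_formula [Nonempty M] {P : M → Prop} (h : Dfn₁ P) :
    ∃ (n : ℕ) (φ : LSet.Formula (Fin (n + 1))) (p : Fin n → M),
      ∀ z, P z ↔ φ.Realize (Fin.cons z p : Fin (n + 1) → M) := by
  obtain ⟨m₀⟩ := ‹Nonempty M›
  obtain ⟨φ, hφ⟩ := h.out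
  obtain ⟨k, ψ, s, hψ⟩ := exists_formula_fin.{u} φ
  -- The only variables of this context are the last coordinate and the constants. The constants
  -- become the parameters; the point `m₀` merely serves to evaluate them.
  have hs : ∀ i, ∃ j : Fin (k + 1), ∀ z : M, (s i).1 (PUnit.unit, z) =
      (Fin.cons z fun i => (s i).1 (PUnit.unit, m₀) : Fin (k + 1) → M) j := by
    intro i
    obtain h | ⟨g, ⟨c, rfl⟩, h⟩ := (s i).2
    · exact ⟨0, fun z => by rw [h]; rfl⟩
    · exact ⟨i.succ, fun z => by simp [h]⟩
  choose j hj using hs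
  refine ⟨k, ψ.relabel j, fun i => (s i).1 (PUnit.unit, m₀), fun z => ?_⟩
  rw [Formula.realize_relabel]
  refine (hφ (PUnit.unit, z)).trans ((hψ M _).trans (iff_of_eq (congrArg _ ?_)))
  funext i
  exact hj i z

theorem Dfn₂.exists_formula [Nonempty M] {P : M → M → Prop} (h : Dfn₂ P) :
    ∃ (n : ℕ) (φ : LSet.Formula (Fin (n + 2))) (p : Fin n → M),
      ∀ x y, P x y ↔ φ.Realize (Fin.cons x (Fin.cons y p) : Fin (n + 2) → M) := by
  obtain ⟨m₀⟩ := ‹Nonempty M›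
  obtain ⟨φ, hφ⟩ := h.out
  obtain ⟨k, ψ, s, hψ⟩ := exists_formula_fin.{u} φ
  have hs : ∀ i, ∃ j : Fin (k + 2), ∀ x y : M, (s i).1 ((PUnit.unit, x), y) =
      (Fin.cons x (Fin.cons y fun i => (s i).1 ((PUnit.unit, m₀), m₀)) : Fin (k + 2) → M) j := by
    intro i
    obtain h | ⟨g, h' | ⟨g, ⟨c, rfl⟩, rfl⟩, h⟩ := (s i).2
    · exact ⟨Fin.succ 0, fun x y => by simp [h]⟩
    · exact ⟨0, fun x y => by rw [h, h']; rfl⟩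
    · exact ⟨i.succ.succ, fun x y => by simp [h]⟩
  choose j hj using hs
  refine ⟨k, ψ.relabel j, fun i => (s i).1 ((PUnit.unit, m₀), m₀), fun x y => ?_⟩
  rw [Formula.realize_relabel]
  refine (hφ ((PUnit.unit, x), y)).trans ((hψ M _).trans (iff_of_eq (congrArg _ ?_)))
  funext i
  exact hj i x y

theorem funcons_elim {N : Type*} {α : Type} {m n : ℕ} (v : α → N) (xs : Fin n → N) (x : α ⊕ Fin n) (g : Fin m → α ⊕ Fin n) :
    (fun i => Sum.elim v xs ((Fin.cons x g : Fin (m + 1) → α ⊕ Fin n) i)) =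
      Fin.cons (Sum.elim v xs x) fun i => Sum.elim v xs (g i) := by
  funext i
  refine Fin.cases rfl (fun i => rfl) i

theorem ZF.of_model [Nonempty M] (h : M ⊨ ZFC) : ZF M := by
  have hm : ∀ σ ∈ ZFC, M ⊨ σ := fun σ hσ => h.realize_of_mem σ hσ
  have h1 := hm extensionality (by simp [ZFC])
  have h2 := hm foundation (by simp [ZFC])
  have h3 := hm AMCSpectrum.pairing (by simp [ZFC])
  have h4 := hm AMCSpectrum.union (by simp [ZFC])
  have h5 := hm powerset (by simp [ZFC])
  have h6 := hm AMCSpectrum.infinity (by simp [ZFC])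
  have h7 : ∀ {n : ℕ} (φ : LSet.Formula (Fin (n + 1))), M ⊨ separation φ := fun {n} φ =>
    hm _ (Or.inl (Or.inr ⟨n, φ, rfl⟩))
  have h8 : ∀ {n : ℕ} (φ : LSet.Formula (Fin (n + 2))), M ⊨ replacement (LHom.id LSet) φ :=
    fun {n} φ => hm _ (Or.inr ⟨n, φ, rfl⟩)
  simp only [Sentence.Realize, Formula.Realize, extensionality, foundation, AMCSpectrum.pairing,
    AMCSpectrum.union, powerset, AMCSpectrum.infinity, realize_allF, realize_exF, realize_mem,
    realize_eqF, realize_nonemptyF, realize_subsetF, realize_isUPair, BoundedFormula.realize_imp,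
    BoundedFormula.realize_iff, BoundedFormula.realize_inf, BoundedFormula.realize_sup,
    BoundedFormula.realize_not, elim_up, elim_last] at h1 h2 h3 h4 h5 h6
  refine ⟨‹_›, h1, h2, h3, h4, h5, h6, fun P hP x => ?_, fun P hP X hX => ?_⟩
  · obtain ⟨n, φ, p, hφ⟩ := hP.exists_formula
    have := h7 φ
    simp only [separation, Sentence.Realize, BoundedFormula.realize_alls, realize_allF, realize_exF,
      realize_mem, BoundedFormula.realize_iff, BoundedFormula.realize_inf, elim_up,
      realize_plug, funcons_elim, Sum.elim_inr, Fin.snoc_last] at this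
    simpa only [hφ] using this p x
  · obtain ⟨n, φ, p, hφ⟩ := hP.exists_formula
    have := h8 φ
    simp only [replacement, Sentence.Realize, BoundedFormula.realize_alls, realize_allF, realize_exF,
      LHom.id_onBoundedFormula, id, realize_mem, BoundedFormula.realize_imp, realize_isFunOn,
      realize_pairIn, BoundedFormula.realize_inf, elim_up, realize_plug, funcons_elim,
      Sum.elim_inr, Fin.snoc_last] at this
    simp only [hφ] at hX ⊢
    exact this p X hX

end ModelsZFC

end AMCSpectrum

namespace AMCSpectrum

/-! ## Bounded formulas -/

section Bounded

variable {α β : Type} {n m : ℕ}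

theorem IsDeltaZero.not {φ : LSet.BoundedFormula α n} (h : IsDeltaZero φ) : IsDeltaZero (∼φ) :=
  h.imp .falsum

theorem IsDeltaZero.inf {φ ψ : LSet.BoundedFormula α n} (h : IsDeltaZero φ) (h' : IsDeltaZero ψ) :
    IsDeltaZero (φ ⊓ ψ) :=
  (h.imp h'.not).not

/-- `IsDeltaZero` fixes the syntactic shape of bounded quantifiers, so the substitution rebuilds the
formula by recursion. It may exchange free variables and de Bruijn variables. -/
theorem IsDeltaZero.exists_subst {φ : LSet.BoundedFormula α n} (h : IsDeltaZero φ) :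
    ∀ {β : Type} {m : ℕ} (s : α ⊕ Fin n → β ⊕ Fin m), ∃ φ' : LSet.BoundedFormula β m,
      IsDeltaZero φ' ∧ ∀ (M : Type u) [LSet.Structure M] (v : β → M) (xs : Fin m → M),
        φ'.Realize v xs ↔
          φ.Realize (fun a => Sum.elim v xs (s (Sum.inl a))) fun i => Sum.elim v xs (s (Sum.inr i)) := by
  have key : ∀ {α β : Type} {n m : ℕ} (s : α ⊕ Fin n → β ⊕ Fin m) (x : α ⊕ Fin n) {M : Type u}
      (v : β → M) (xs : Fin m → M), Sum.elim (fun a => Sum.elim v xs (s (Sum.inl a)))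
        (fun i => Sum.elim v xs (s (Sum.inr i))) x = Sum.elim v xs (s x) := by
    rintro α β n m s (x | x) M v xs <;> rfl
  have ext : ∀ {α β : Type} {n m : ℕ} (s : α ⊕ Fin n → β ⊕ Fin m),
      ∃ s' : α ⊕ Fin (n + 1) → β ⊕ Fin (m + 1), ∀ {M : Type u} (v : β → M) (xs : Fin m → M) (y : M),
        (fun a => Sum.elim v (Fin.snoc xs y : Fin (m + 1) → M) (s' (Sum.inl a))) =
          (fun a => Sum.elim v xs (s (Sum.inl a))) ∧
        (fun i => Sum.elim v (Fin.snoc xs y : Fin (m + 1) → M) (s' (Sum.inr i))) =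
          Fin.snoc (fun i => Sum.elim v xs (s (Sum.inr i))) y := by
    intro α β n m s
    refine ⟨Sum.elim (fun a => (s (Sum.inl a))↟) (Fin.snoc (α := fun _ => β ⊕ Fin (m + 1))
      (fun i => (s (Sum.inr i))↟) (Sum.inr (Fin.last m))), fun v xs y => ⟨?_, ?_⟩⟩
    · funext a
      simp
    · funext i
      refine Fin.lastCases ?_ (fun i => ?_) i <;> simp
  induction h with
  | falsum => exact fun s => ⟨⊥, .falsum, fun _ _ _ _ => Iff.rfl⟩
  | eq x y => exact fun s => ⟨_, .eq (s x) (s y), fun M _ v xs => by simp [key]⟩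
  | mem x y => exact fun s => ⟨_, .mem (s x) (s y), fun M _ v xs => by simp [key]⟩
  | imp _ _ ih₁ ih₂ =>
    intro β m s
    obtain ⟨φ, h, hφ⟩ := ih₁ s
    obtain ⟨ψ, h', hψ⟩ := ih₂ s
    exact ⟨_, h.imp h', fun M _ v xs => by simp [hφ, hψ]⟩
  | ball x _ ih =>
    intro β m s
    obtain ⟨s', hs'⟩ := ext s
    obtain ⟨φ, h, hφ⟩ := ih s'
    refine ⟨_, .ball (s x) h, fun M _ v xs => ?_⟩
    simp only [realize_allF, BoundedFormula.realize_imp, realize_mem, elim_up, elim_last, hφ, key,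
      (hs' v xs _).1, (hs' v xs _).2]
  | bex x _ ih =>
    intro β m s
    obtain ⟨s', hs'⟩ := ext s
    obtain ⟨φ, h, hφ⟩ := ih s'
    refine ⟨_, .bex (s x) h, fun M _ v xs => ?_⟩
    simp only [realize_exF, BoundedFormula.realize_inf, realize_mem, elim_up, elim_last, hφ, key,
      (hs' v xs _).1, (hs' v xs _).2]

/-- Structures that satisfy extensionality and pairing. -/
class EP (M : Type u) [LSet.Structure M] : Prop where
  ext : ∀ x y : M, (∀ z, z ∊ x ↔ z ∊ y) → x = y
  pairing : ∀ x y : M, ∃ z, UPairS z x y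

instance {M : Type u} [LSet.Structure M] [ZF M] : EP M := ⟨ZF.ext, ZF.pairing⟩

/-- Formulas equivalent to a `Δ₀`-formula in the presence of extensionality and pairing. -/
def D0 (φ : LSet.BoundedFormula α n) : Prop :=
  ∃ ψ : LSet.BoundedFormula α n, IsDeltaZero ψ ∧
    ∀ (M : Type u) [LSet.Structure M] [EP M] (v : α → M) (xs : Fin n → M),
      φ.Realize v xs ↔ ψ.Realize v xs

theorem IsDeltaZero.d0 {φ : LSet.BoundedFormula α n} (h : IsDeltaZero φ) : D0.{u} φ :=
  ⟨φ, h, fun _ _ _ _ _ => Iff.rfl⟩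

theorem D0.congr {φ ψ : LSet.BoundedFormula α n} (h : D0.{u} ψ)
    (hφ : ∀ (M : Type u) [LSet.Structure M] [EP M] (v : α → M) (xs : Fin n → M),
      φ.Realize v xs ↔ ψ.Realize v xs) : D0.{u} φ := by
  obtain ⟨χ, h, hχ⟩ := h
  exact ⟨χ, h, fun M _ _ v xs => (hφ M v xs).trans (hχ M v xs)⟩

theorem D0.eq (x y : α ⊕ Fin n) : D0.{u} (eqF x y) := (IsDeltaZero.eq x y).d0

theorem D0.mem (x y : α ⊕ Fin n) : D0.{u} (mem x y) := (IsDeltaZero.mem x y).d0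

theorem D0.imp {φ ψ : LSet.BoundedFormula α n} (hφ : D0.{u} φ) (hψ : D0.{u} ψ) :
    D0.{u} (φ ⟹ ψ) := by
  obtain ⟨φ', h, hφ⟩ := hφ
  obtain ⟨ψ', h', hψ⟩ := hψ
  exact ⟨_, h.imp h', fun M _ _ v xs => by simp [hφ, hψ]⟩

theorem D0.not {φ : LSet.BoundedFormula α n} (hφ : D0.{u} φ) : D0.{u} (∼φ) :=
  hφ.imp IsDeltaZero.falsum.d0

theorem D0.inf {φ ψ : LSet.BoundedFormula α n} (hφ : D0.{u} φ) (hψ : D0.{u} ψ) :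
    D0.{u} (φ ⊓ ψ) :=
  (hφ.imp hψ.not).not

theorem D0.sup {φ ψ : LSet.BoundedFormula α n} (hφ : D0.{u} φ) (hψ : D0.{u} ψ) :
    D0.{u} (φ ⊔ ψ) :=
  hφ.not.imp hψ

theorem D0.ball (x : α ⊕ Fin n) {f : α ⊕ Fin (n + 1) → LSet.BoundedFormula α (n + 1)}
    (h : D0.{u} (f (Sum.inr (Fin.last n)))) :
    D0.{u} (allF fun y => AMCSpectrum.mem y x↟ ⟹ f y) := by
  obtain ⟨φ', h, hφ⟩ := h
  exact ⟨_, .ball x h, fun M _ _ v xs => by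
    simp only [realize_allF, BoundedFormula.realize_imp, hφ]⟩

theorem D0.bex (x : α ⊕ Fin n) {f : α ⊕ Fin (n + 1) → LSet.BoundedFormula α (n + 1)}
    (h : D0.{u} (f (Sum.inr (Fin.last n)))) :
    D0.{u} (exF fun y => AMCSpectrum.mem y x↟ ⊓ f y) := by
  obtain ⟨φ', h, hφ⟩ := h
  exact ⟨_, .bex x h, fun M _ _ v xs => by
    simp only [realize_exF, BoundedFormula.realize_inf, hφ]⟩

theorem D0.plug {φ : LSet.Formula β} (h : D0.{u} φ) (g : β → α ⊕ Fin n) : D0.{u} (plug φ g) := by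
  obtain ⟨φ', h, hφ⟩ := h
  obtain ⟨ψ, h', hψ⟩ := h.exists_subst.{u} (Sum.elim g Fin.elim0)
  refine ⟨ψ, h', fun M _ _ v xs => ?_⟩
  rw [realize_plug, hψ, Formula.Realize, hφ]
  exact iff_of_eq (congrArg _ (Subsingleton.elim _ _))

/-! ### Bounded notions -/

/-- A bounded form of `z = {x, y}`. -/
def isUPairB (z x y : α ⊕ Fin n) : LSet.BoundedFormula α n :=
  mem x z ⊓ mem y z ⊓ allF fun w => mem w z↟ ⟹ (∼(eqF w x↟) ⟹ eqF w y↟)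

theorem isDeltaZero_isUPairB (z x y : α ⊕ Fin n) : IsDeltaZero (isUPairB z x y) :=
  ((IsDeltaZero.mem _ _).inf (.mem _ _)).inf (.ball _ ((IsDeltaZero.eq _ _).not.imp (.eq _ _)))

theorem realize_isUPairB {M : Type u} [LSet.Structure M] (z x y : α ⊕ Fin n) (v : α → M)
    (xs : Fin n → M) : (isUPairB z x y).Realize v xs ↔
      UPairS (Sum.elim v xs z) (Sum.elim v xs x) (Sum.elim v xs y) := by
  simp only [isUPairB, BoundedFormula.realize_inf, realize_mem, realize_allF,
    BoundedFormula.realize_imp, BoundedFormula.realize_not, realize_eqF, elim_up, elim_last, UPairS]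
  constructor
  · rintro ⟨⟨h1, h2⟩, h3⟩ w
    refine ⟨fun h => or_iff_not_imp_left.2 (h3 w h), ?_⟩
    rintro (rfl | rfl)
    exacts [h1, h2]
  · exact fun h => ⟨⟨(h _).2 (Or.inl rfl), (h _).2 (Or.inr rfl)⟩,
      fun w hw hn => ((h w).1 hw).resolve_left hn⟩

theorem D0.isUPair (z x y : α ⊕ Fin n) : D0.{u} (isUPair z x y) :=
  (isDeltaZero_isUPairB z x y).d0.congr fun M _ _ v xs => by
    rw [realize_isUPairB, realize_isUPair]

theorem D0.isPair (p x y : α ⊕ Fin n) : D0.{u} (isPair p x y) := by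
  refine (D0.bex p (f := fun a => exF fun b => AMCSpectrum.mem b p↟↟ ⊓
    (AMCSpectrum.isUPair a↟ x↟↟ x↟↟ ⊓ AMCSpectrum.isUPair b x↟↟ y↟↟ ⊓ AMCSpectrum.isUPair p↟↟ a↟ b))
    (D0.bex _ (((D0.isUPair _ _ _).inf (.isUPair _ _ _)).inf (.isUPair _ _ _)))).congr
    fun M _ _ v xs => ?_
  simp only [realize_isPair, realize_exF, BoundedFormula.realize_inf, realize_mem, realize_isUPair,
    elim_up, elim_last, PairS]
  constructor
  · rintro ⟨a, b, h, h'⟩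
    exact ⟨a, (h' a).2 (Or.inl rfl), b, (h' b).2 (Or.inr rfl), h, h'⟩
  · rintro ⟨a, -, b, -, h⟩
    exact ⟨a, b, h⟩

theorem D0.pairIn (r x y : α ⊕ Fin n) : D0.{u} (pairIn r x y) := by
  refine (D0.bex r (f := fun p => AMCSpectrum.isPair p x↟ y↟) (.isPair _ _ _)).congr
    fun M _ _ v xs => ?_
  simp only [realize_pairIn, realize_exF, BoundedFormula.realize_inf, realize_mem, realize_isPair,
    elim_up, elim_last, PairInS, and_comm]

theorem PairS.mem_mem {M : Type u} [LSet.Structure M] {p x y : M} (h : PairS p x y) :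
    (∃ a, a ∊ p ∧ x ∊ a) ∧ ∃ a, a ∊ p ∧ y ∊ a := by
  obtain ⟨a, b, ⟨h1, h2⟩, h3⟩ := h
  exact ⟨⟨a, (h3 a).2 (Or.inl rfl), (h1 x).2 (Or.inl rfl)⟩,
    b, (h3 b).2 (Or.inr rfl), (h2 y).2 (Or.inr rfl)⟩

/-- Quantification over `⋃ x` is a double bounded quantifier, `∃ a ∈ x, ∃ y ∈ a`. -/
theorem D0.bex₂ (x : α ⊕ Fin n) {f : α ⊕ Fin (n + 1) → LSet.BoundedFormula α (n + 1)}
    (h : D0.{u} (f (Sum.inr (Fin.last n)))) :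
    D0.{u} (exF fun y => (exF fun a => AMCSpectrum.mem a x↟↟ ⊓ AMCSpectrum.mem y↟ a) ⊓ f y) := by
  obtain ⟨φ', h, hφ⟩ := h
  let s : α ⊕ Fin (n + 1) → α ⊕ Fin (n + 2) :=
    Sum.elim Sum.inl (Fin.snoc (α := fun _ => α ⊕ Fin (n + 2))
      (fun i => Sum.inr i.castSucc.castSucc) (Sum.inr (Fin.last _)))
  obtain ⟨ψ, h', hψ⟩ := h.exists_subst.{u} s
  have hs : ∀ {M : Type u} (v : α → M) (xs : Fin n → M) (a y : M),
      (fun i => Sum.elim v (Fin.snoc (Fin.snoc xs a : Fin (n + 1) → M) y : Fin (n + 2) → M)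
        (s (Sum.inl i))) = v ∧
      (fun i => Sum.elim v (Fin.snoc (Fin.snoc xs a : Fin (n + 1) → M) y : Fin (n + 2) → M)
        (s (Sum.inr i))) = Fin.snoc xs y := by
    intro M v xs a y
    refine ⟨rfl, ?_⟩
    funext i
    refine Fin.lastCases ?_ (fun i => ?_) i
    · simp [s]
    · simp only [s, Sum.elim_inr, Fin.snoc_castSucc]
  refine ⟨_, .bex x (.bex (Sum.inr (Fin.last n)) h'), fun M _ _ v xs => ?_⟩
  simp only [realize_exF, BoundedFormula.realize_inf, hφ, hψ, realize_mem, elim_up, elim_last,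
    (hs v xs _ _).1, (hs v xs _ _).2]
  constructor
  · rintro ⟨y, ⟨a, ha, hy⟩, hf⟩
    exact ⟨a, ha, y, hy, hf⟩
  · rintro ⟨a, ha, y, hy, hf⟩
    exact ⟨y, ⟨a, ha, hy⟩, hf⟩

/-- The components of a pair `p` belong to `⋃ p`. This makes quantification over components bounded
and underlies all bounded forms below that take pairs apart. -/
theorem D0.exPair (p : α ⊕ Fin n)
    {f : α ⊕ Fin (n + 2) → α ⊕ Fin (n + 2) → LSet.BoundedFormula α (n + 2)}
    (h : D0.{u} (f (Sum.inr (Fin.last n))↟ (Sum.inr (Fin.last (n + 1))))) :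
    D0.{u} (exF fun a => exF fun b => AMCSpectrum.isPair p↟↟ a↟ b ⊓ f a↟ b) := by
  refine (D0.bex₂ p (f := fun a => exF fun b =>
    (exF fun c => AMCSpectrum.mem c p↟↟↟ ⊓ AMCSpectrum.mem b↟ c) ⊓
    (AMCSpectrum.isPair p↟↟ a↟ b ⊓ f a↟ b)) (D0.bex₂ _ ((D0.isPair _ _ _).inf h))).congr
    fun M _ _ v xs => ?_
  simp only [realize_exF, BoundedFormula.realize_inf, realize_mem, realize_isPair, elim_up, elim_last]
  constructor
  · rintro ⟨a, b, h, h'⟩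
    exact ⟨a, h.mem_mem.1, b, h.mem_mem.2, h, h'⟩
  · rintro ⟨a, -, b, -, h⟩
    exact ⟨a, b, h⟩

theorem D0.isTriple (p x y z : α ⊕ Fin n) : D0.{u} (isTriple p x y z) := by
  refine (D0.exPair p (f := fun q w => AMCSpectrum.isPair q x↟↟ y↟↟ ⊓ eqF w z↟↟)
    ((D0.isPair _ _ _).inf (.eq _ _))).congr fun M _ _ v xs => ?_
  simp only [realize_isTriple, realize_exF, BoundedFormula.realize_inf, realize_isPair, realize_eqF,
    elim_up, elim_last]
  constructor
  · rintro ⟨q, h, h'⟩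
    exact ⟨q, _, h', h, rfl⟩
  · rintro ⟨q, _, h', h, rfl⟩
    exact ⟨q, h, h'⟩

theorem D0.tripleIn (r x y z : α ⊕ Fin n) : D0.{u} (tripleIn r x y z) := by
  refine (D0.bex r (f := fun p => AMCSpectrum.isTriple p x↟ y↟ z↟) (.isTriple _ _ _ _)).congr
    fun M _ _ v xs => ?_
  simp only [realize_tripleIn, realize_exF, BoundedFormula.realize_inf, realize_mem,
    realize_isTriple, elim_up, elim_last]
  exact exists_congr fun _ => and_comm

/-- The value at `a` is found inside `f`: some member of `f` is a pair with first component `a`, and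
no member of `f` pairs `a` with a different second component. -/
theorem D0.isFunOn (f x : α ⊕ Fin n) : D0.{u} (isFunOn f x) := by
  refine (D0.inf
    (D0.ball f (f := fun p => exF fun a => exF fun b => AMCSpectrum.isPair p↟↟ a↟ b ⊓
      AMCSpectrum.mem a↟ x↟↟↟) (D0.exPair _ (f := fun a _ => AMCSpectrum.mem a x↟↟↟) (.mem _ _)))
    (D0.ball x (f := fun a => exF fun p => AMCSpectrum.mem p f↟↟ ⊓
      exF fun a' => exF fun b => AMCSpectrum.isPair p↟↟ a'↟ b ⊓ (eqF a'↟ a↟↟↟ ⊓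
        allF fun q => AMCSpectrum.mem q f↟↟↟↟↟ ⟹ ∼(exF fun c => exF fun d =>
          AMCSpectrum.isPair q↟↟ c↟ d ⊓ (eqF c↟ a↟↟↟↟↟↟ ⊓ ∼(eqF d b↟↟↟)))))
      (D0.bex _ (D0.exPair _ (f := fun a' b => eqF a' (Sum.inr (Fin.last n))↟↟↟ ⊓
        allF fun q => AMCSpectrum.mem q f↟↟↟↟↟ ⟹ ∼(exF fun c => exF fun d =>
          AMCSpectrum.isPair q↟↟ c↟ d ⊓ (eqF c↟ (Sum.inr (Fin.last n))↟↟↟↟↟↟ ⊓ ∼(eqF d b↟↟↟))))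
      ((D0.eq _ _).inf (D0.ball _ (D0.not (D0.exPair _
        (f := fun c d => eqF c (Sum.inr (Fin.last n))↟↟↟↟↟↟ ⊓
          ∼(eqF d (Sum.inr (Fin.last (n + 3)))↟↟↟))
        ((D0.eq _ _).inf (D0.eq _ _).not))))))))).congr
    fun M _ _ v xs => ?_
  simp only [realize_isFunOn, realize_allF, realize_exF, BoundedFormula.realize_inf, realize_mem,
    realize_isPair, realize_eqF, BoundedFormula.realize_imp, BoundedFormula.realize_not, elim_up,
    elim_last, FunOnS]
  refine and_congr (forall₂_congr fun p _ => exists₂_congr fun a b => and_comm)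
    (forall₂_congr fun a _ => ?_)
  constructor
  · rintro ⟨b, hb⟩
    obtain ⟨p, hp, hpf⟩ := (hb b).2 rfl
    refine ⟨p, hpf, a, b, hp, rfl, ?_⟩
    rintro q hq ⟨c, d, h1, rfl, h3⟩
    exact h3 ((hb d).1 ⟨q, h1, hq⟩)
  · rintro ⟨p, hp, _, b, hpab, rfl, h⟩
    refine ⟨b, fun d => ⟨?_, ?_⟩⟩
    · rintro ⟨q, h1, hq⟩
      by_contra hd
      exact h q hq ⟨_, d, h1, rfl, hd⟩
    · rintro rfl
      exact ⟨p, hpab, hp⟩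

theorem D0.isFun (f x y : α ⊕ Fin n) : D0.{u} (isFun f x y) := by
  refine ((D0.isFunOn f x).inf (D0.ball f (f := fun p => ∼(exF fun a => exF fun b =>
    AMCSpectrum.isPair p↟↟ a↟ b ⊓ ∼(AMCSpectrum.mem b y↟↟↟)))
    (D0.not (D0.exPair _ (f := fun _ b => ∼(AMCSpectrum.mem b y↟↟↟)) (D0.mem _ _).not)))).congr
    fun M _ _ v xs => ?_
  simp only [realize_isFun, realize_isFunOn, realize_allF, realize_exF, BoundedFormula.realize_inf,
    realize_mem, realize_isPair, BoundedFormula.realize_imp, BoundedFormula.realize_not, elim_up,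
    elim_last, FunS, PairInS]
  refine and_congr Iff.rfl ⟨?_, ?_⟩
  · rintro h p hp ⟨a, b, hab, hb⟩
    exact hb (h a b ⟨p, hab, hp⟩)
  · rintro h a b ⟨p, hab, hp⟩
    by_contra hb
    exact h p hp ⟨a, b, hab, hb⟩

theorem D0.isSurj (f x y : α ⊕ Fin n) : D0.{u} (isSurj f x y) :=
  (D0.isFun f x y).inf (D0.ball y (f := fun b => exF fun a => AMCSpectrum.mem a x↟↟ ⊓
    AMCSpectrum.pairIn f↟↟ a b↟) (D0.bex _ (.pairIn _ _ _)))

theorem D0.subsetF (x y : α ⊕ Fin n) : D0.{u} (subsetF x y) :=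
  D0.ball x (f := fun z => AMCSpectrum.mem z y↟) (.mem _ _)

theorem D0.isTransitive (x : α ⊕ Fin n) : D0.{u} (isTransitive x) :=
  D0.ball x (f := fun y => AMCSpectrum.subsetF y x↟) (.subsetF _ _)

theorem D0.nonemptyF (x : α ⊕ Fin n) : D0.{u} (nonemptyF x) :=
  (D0.bex x (f := fun y => eqF y y) (.eq _ _)).congr fun M _ _ v xs => by simp

theorem D0.isOrd (x : α ⊕ Fin n) : D0.{u} (isOrd x) := by
  refine ((D0.isTransitive x).inf (D0.ball x (f := fun y => allF fun z => AMCSpectrum.mem z x↟↟ ⟹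
    (AMCSpectrum.mem y↟ z ⊔ eqF y↟ z ⊔ AMCSpectrum.mem z y↟))
    (D0.ball _ (((D0.mem _ _).sup (.eq _ _)).sup (.mem _ _))))).congr fun M _ _ v xs => ?_
  simp only [realize_isOrd, OrdS, BoundedFormula.realize_inf, realize_isTransitive, realize_allF,
    BoundedFormula.realize_imp, BoundedFormula.realize_sup, realize_mem, realize_eqF, elim_up,
    elim_last]
  exact and_congr Iff.rfl ⟨fun h y hy z hz => h y z ⟨hy, hz⟩, fun h y z hyz => h y hyz.1 z hyz.2⟩

theorem D0.isLimitLike (x : α ⊕ Fin n) : D0.{u} (isLimitLike x) :=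
  (D0.nonemptyF x).inf (D0.ball x (f := fun y => exF fun z => AMCSpectrum.mem z x↟↟ ⊓
    AMCSpectrum.mem y↟ z) (D0.bex _ (.mem _ _)))

theorem D0.isOmega (x : α ⊕ Fin n) : D0.{u} (isOmega x) :=
  ((D0.isOrd x).inf (.isLimitLike x)).inf (D0.ball x (f := fun y => ∼(AMCSpectrum.isLimitLike y))
    (D0.isLimitLike _).not)

/-! ### The graphs of the Gödel operations -/

theorem EP.exists_pairS {M : Type u} [LSet.Structure M] [EP M] (x y : M) : ∃ p, PairS p x y := by
  obtain ⟨a, ha⟩ := EP.pairing x x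
  obtain ⟨b, hb⟩ := EP.pairing x y
  obtain ⟨p, hp⟩ := EP.pairing a b
  exact ⟨p, a, b, ⟨ha, hb⟩, hp⟩

theorem UPairS.unique {M : Type u} [LSet.Structure M] [EP M] {x y z z' : M} (h : UPairS z x y)
    (h' : UPairS z' x y) : z = z' :=
  EP.ext _ _ fun w => (h w).trans (h' w).symm

theorem PairS.unique {M : Type u} [LSet.Structure M] [EP M] {p q x y : M} (h : PairS p x y)
    (h' : PairS q x y) : p = q := by
  obtain ⟨a, b, ⟨h1, h2⟩, h3⟩ := h
  obtain ⟨a', b', ⟨h1', h2'⟩, h3'⟩ := h'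
  obtain rfl := h1.unique h1'
  obtain rfl := h2.unique h2'
  exact h3.unique h3'

/-- Of the two inclusions, that of `z` in the class is bounded by `z`. The other has no evident
bound and is supplied separately as a Δ₀-formula `ψ`. -/
theorem D0.graph (z : α ⊕ Fin n) {f : α ⊕ Fin (n + 1) → LSet.BoundedFormula α (n + 1)}
    (h : D0.{u} (f (Sum.inr (Fin.last n)))) {ψ : LSet.BoundedFormula α n} (hψ : D0.{u} ψ)
    (h' : ∀ (M : Type u) [LSet.Structure M] [EP M] (v : α → M) (xs : Fin n → M),
      ψ.Realize v xs ↔ ∀ w, (f (Sum.inr (Fin.last n))).Realize v (Fin.snoc xs w) →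
        w ∊ Sum.elim v xs z) :
    D0.{u} (allF fun w => AMCSpectrum.mem w z↟ ⇔ f w) := by
  refine ((D0.ball z h).inf hψ).congr fun M _ _ v xs => ?_
  simp only [realize_allF, BoundedFormula.realize_iff, BoundedFormula.realize_inf,
    BoundedFormula.realize_imp, realize_mem, elim_up, elim_last, h']
  exact ⟨fun h => ⟨fun y => (h y).1, fun y => (h y).2⟩, fun h y => ⟨h.1 y, h.2 y⟩⟩

/-- The reverse inclusion is stated by quantifying over `a ∈ x`, `b ∈ y` and asking for their pair
in `z`. Passing between this and the original uses that pairs exist and are unique, that is, pairing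
and extensionality. -/
theorem D0.prodGraph (z x y : α ⊕ Fin n) : D0.{u} (allF fun w => AMCSpectrum.mem w z↟ ⇔
    exF fun a => exF fun b => AMCSpectrum.mem a↟ x↟↟↟ ⊓ AMCSpectrum.mem b y↟↟↟ ⊓
      AMCSpectrum.isPair w↟↟ a↟ b) := by
  refine D0.graph z (f := fun w => exF fun a => exF fun b => AMCSpectrum.mem a↟ x↟↟↟ ⊓
    AMCSpectrum.mem b y↟↟↟ ⊓ AMCSpectrum.isPair w↟↟ a↟ b) ?_
    (D0.ball x (f := fun a => allF fun b => AMCSpectrum.mem b y↟↟ ⟹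
      exF fun w => AMCSpectrum.mem w z↟↟↟ ⊓ AMCSpectrum.isPair w a↟↟ b↟)
      (D0.ball _ (D0.bex _ (D0.isPair _ _ _)))) fun M _ _ v xs => ?_
  · refine (D0.exPair (Sum.inr (Fin.last n)) (f := fun a b => AMCSpectrum.mem a x↟↟↟ ⊓
      AMCSpectrum.mem b y↟↟↟) ((D0.mem _ _).inf (.mem _ _))).congr fun M _ _ v xs => ?_
    simp only [realize_exF, BoundedFormula.realize_inf]
    exact exists₂_congr fun _ _ => and_comm
  · simp only [realize_exF, realize_allF, BoundedFormula.realize_inf, BoundedFormula.realize_imp,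
      realize_mem, realize_isPair, elim_up, elim_last]
    constructor
    · rintro h w ⟨a, b, ⟨ha, hb⟩, hw⟩
      obtain ⟨w', hw', h⟩ := h a ha b hb
      rwa [hw.unique h]
    · intro h a ha b hb
      obtain ⟨w, hw⟩ := EP.exists_pairS a b
      exact ⟨w, h w ⟨a, b, ⟨ha, hb⟩, hw⟩, hw⟩

theorem D0.memGraph (z x y : α ⊕ Fin n) : D0.{u} (allF fun w => AMCSpectrum.mem w z↟ ⇔
    exF fun a => exF fun b => AMCSpectrum.mem a↟ x↟↟↟ ⊓ AMCSpectrum.mem b y↟↟↟ ⊓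
      AMCSpectrum.mem a↟ b ⊓ AMCSpectrum.isPair w↟↟ a↟ b) := by
  refine D0.graph z (f := fun w => exF fun a => exF fun b => AMCSpectrum.mem a↟ x↟↟↟ ⊓
    AMCSpectrum.mem b y↟↟↟ ⊓ AMCSpectrum.mem a↟ b ⊓ AMCSpectrum.isPair w↟↟ a↟ b) ?_
    (D0.ball x (f := fun a => allF fun b => AMCSpectrum.mem b y↟↟ ⟹ (AMCSpectrum.mem a↟ b ⟹
      exF fun w => AMCSpectrum.mem w z↟↟↟ ⊓ AMCSpectrum.isPair w a↟↟ b↟))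
      (D0.ball _ ((D0.mem _ _).imp (D0.bex _ (D0.isPair _ _ _))))) fun M _ _ v xs => ?_
  · refine (D0.exPair (Sum.inr (Fin.last n)) (f := fun a b => AMCSpectrum.mem a x↟↟↟ ⊓
      AMCSpectrum.mem b y↟↟↟ ⊓ AMCSpectrum.mem a b)
      (((D0.mem _ _).inf (.mem _ _)).inf (.mem _ _))).congr fun M _ _ v xs => ?_
    simp only [realize_exF, BoundedFormula.realize_inf]
    exact exists₂_congr fun _ _ => and_comm
  · simp only [realize_exF, realize_allF, BoundedFormula.realize_inf, BoundedFormula.realize_imp,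
      realize_mem, realize_isPair, elim_up, elim_last]
    constructor
    · rintro h w ⟨a, b, ⟨⟨ha, hb⟩, hab⟩, hw⟩
      obtain ⟨w', hw', h⟩ := h a ha b hb hab
      rwa [hw.unique h]
    · intro h a ha b hb hab
      obtain ⟨w, hw⟩ := EP.exists_pairS a b
      exact ⟨w, h w ⟨a, b, ⟨⟨ha, hb⟩, hab⟩, hw⟩, hw⟩

theorem D0.sepGraph (z x : α ⊕ Fin n) {f : α ⊕ Fin (n + 1) → LSet.BoundedFormula α (n + 1)}
    (h : D0.{u} (f (Sum.inr (Fin.last n)))) :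
    D0.{u} (allF fun w => AMCSpectrum.mem w z↟ ⇔ (AMCSpectrum.mem w x↟ ⊓ f w)) :=
  D0.graph z (f := fun w => AMCSpectrum.mem w x↟ ⊓ f w) ((D0.mem _ _).inf h)
    (D0.ball x (f := fun w => f w ⟹ AMCSpectrum.mem w z↟) (h.imp (.mem _ _))) fun M _ _ v xs => by
    simp only [realize_allF, BoundedFormula.realize_inf, BoundedFormula.realize_imp, realize_mem,
      elim_up, elim_last, and_imp]

theorem D0.goedelBinary : ∀ i : Fin 5, D0.{u} (goedelBinary i)
  | 0 => D0.isUPair _ _ _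
  | 1 => D0.prodGraph (Sum.inl 0) (Sum.inl 1) (Sum.inl 2)
  | 2 => D0.memGraph (Sum.inl 0) (Sum.inl 1) (Sum.inl 2)
  | 3 => D0.sepGraph (Sum.inl 0) (Sum.inl 1) (f := fun w => ∼(AMCSpectrum.mem w (Sum.inl 2)↟))
      (D0.mem _ _).not
  | 4 => D0.sepGraph (Sum.inl 0) (Sum.inl 1) (f := fun w => AMCSpectrum.mem w (Sum.inl 2)↟)
      (D0.mem _ _)

theorem D0.unionGraph (z x : α ⊕ Fin n) : D0.{u} (allF fun w => AMCSpectrum.mem w z↟ ⇔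
    exF fun a => AMCSpectrum.mem a x↟↟ ⊓ AMCSpectrum.mem w↟ a) :=
  D0.graph z (f := fun w => exF fun a => AMCSpectrum.mem a x↟↟ ⊓ AMCSpectrum.mem w↟ a)
    (D0.bex _ (.mem _ _)) (D0.ball x (f := fun a => AMCSpectrum.subsetF a z↟) (.subsetF _ _))
    fun M _ _ v xs => by
      simp only [realize_allF, realize_exF, BoundedFormula.realize_inf, BoundedFormula.realize_imp,
        realize_mem, realize_subsetF, elim_up, elim_last]
      exact ⟨fun h w ⟨a, ha, hw⟩ => h a ha w hw, fun h a ha w hw => h w ⟨a, ha, hw⟩⟩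

theorem D0.domGraph (z x : α ⊕ Fin n) : D0.{u} (allF fun w => AMCSpectrum.mem w z↟ ⇔
    exF fun b => AMCSpectrum.pairIn x↟↟ w↟ b) := by
  refine D0.graph z (f := fun w => exF fun b => AMCSpectrum.pairIn x↟↟ w↟ b) ?_
    (D0.ball x (f := fun p => ∼(exF fun a => exF fun b => AMCSpectrum.isPair p↟↟ a↟ b ⊓
      ∼(AMCSpectrum.mem a↟ z↟↟↟))) (D0.not (D0.exPair _
        (f := fun a _ => ∼(AMCSpectrum.mem a z↟↟↟)) (D0.mem _ _).not))) fun M _ _ v xs => ?_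
  · refine (D0.bex x↟ (f := fun p => exF fun a => exF fun b => AMCSpectrum.isPair p↟↟ a↟ b ⊓
      eqF a↟ (Sum.inr (Fin.last n))↟↟↟) (D0.exPair _
        (f := fun a _ => eqF a (Sum.inr (Fin.last n))↟↟↟) (.eq _ _))).congr fun M _ _ v xs => ?_
    simp only [realize_exF, BoundedFormula.realize_inf, realize_mem, realize_isPair, realize_eqF,
      realize_pairIn, elim_up, elim_last, PairInS]
    constructor
    · rintro ⟨b, p, hp, h⟩
      exact ⟨p, h, _, b, hp, rfl⟩
    · rintro ⟨p, h, a, b, hp, rfl⟩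
      exact ⟨b, p, hp, h⟩
  · simp only [realize_exF, realize_allF, BoundedFormula.realize_inf, BoundedFormula.realize_imp,
      BoundedFormula.realize_not, realize_mem, realize_isPair, realize_pairIn, elim_up, elim_last,
      PairInS]
    constructor
    · rintro h a ⟨b, p, hp, hpx⟩
      by_contra ha
      exact h p hpx ⟨a, b, hp, ha⟩
    · rintro h p hp ⟨a, b, hab, ha⟩
      exact ha (h a ⟨b, p, hab, hp⟩)

theorem D0.converseGraph (z x : α ⊕ Fin n) : D0.{u} (allF fun w => AMCSpectrum.mem w z↟ ⇔
    exF fun a => exF fun b => AMCSpectrum.isPair w↟↟ a↟ b ⊓ AMCSpectrum.pairIn x↟↟↟ b a↟) := by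
  refine D0.graph z (f := fun w => exF fun a => exF fun b => AMCSpectrum.isPair w↟↟ a↟ b ⊓
      AMCSpectrum.pairIn x↟↟↟ b a↟)
    (D0.exPair (Sum.inr (Fin.last n)) (f := fun a b => AMCSpectrum.pairIn x↟↟↟ b a) (.pairIn _ _ _))
    (D0.ball x (f := fun p => ∼(exF fun b => exF fun a => AMCSpectrum.isPair p↟↟ b↟ a ⊓
      ∼(exF fun w => AMCSpectrum.mem w z↟↟↟↟ ⊓ AMCSpectrum.isPair w a↟ b↟↟)))
      (D0.not (D0.exPair (Sum.inr (Fin.last n)) (f := fun b a => ∼(exF fun w => AMCSpectrum.mem w z↟↟↟↟ ⊓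
        AMCSpectrum.isPair w a↟ b↟)) (D0.not (D0.bex _ (.isPair _ _ _)))))) fun M _ _ v xs => ?_
  simp only [realize_exF, realize_allF, BoundedFormula.realize_inf, BoundedFormula.realize_imp,
    BoundedFormula.realize_not, realize_mem, realize_isPair, realize_pairIn, elim_up, elim_last,
    PairInS]
  constructor
  · rintro h w ⟨a, b, hw, p, hp, hpx⟩
    by_contra hn
    refine h p hpx ⟨b, a, hp, ?_⟩
    rintro ⟨w', hw', h'⟩
    exact hn (by rwa [hw.unique h'])
  · rintro h p hp ⟨b, a, hab, hn⟩
    obtain ⟨w, hw⟩ := EP.exists_pairS a b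
    exact hn ⟨w, h w ⟨a, b, hw, p, hab, hp⟩, hw⟩

theorem D0.swapGraph (z x : α ⊕ Fin n) : D0.{u} (allF fun w => AMCSpectrum.mem w z↟ ⇔
    exF fun a => exF fun b => exF fun c => AMCSpectrum.isTriple w↟↟↟ a↟↟ b↟ c ⊓
      AMCSpectrum.tripleIn x↟↟↟↟ a↟↟ c b↟) := by
  refine D0.graph z (f := fun w => exF fun a => exF fun b => exF fun c =>
      AMCSpectrum.isTriple w↟↟↟ a↟↟ b↟ c ⊓ AMCSpectrum.tripleIn x↟↟↟↟ a↟↟ c b↟)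
    ((D0.exPair (Sum.inr (Fin.last n)) (f := fun q c => exF fun a => exF fun b =>
      AMCSpectrum.isPair q↟↟ a↟ b ⊓ AMCSpectrum.tripleIn x↟↟↟↟↟ a↟ c↟↟ b)
      (D0.exPair (Sum.inr (Fin.last (n + 1)))↟ (f := fun a b => AMCSpectrum.tripleIn x↟↟↟↟↟
        a (Sum.inr (Fin.last (n + 2)))↟↟ b) (.tripleIn _ _ _ _))).congr fun M _ _ v xs => ?_)
    -- For the reverse inclusion a member `p = ((a, c), b)` of `x` is taken apart and `((a, b), c)`
    -- is sought in `z`.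
    (D0.ball x (f := fun p => ∼(exF fun q => exF fun b => AMCSpectrum.isPair p↟↟ q↟ b ⊓
      exF fun a => exF fun c => AMCSpectrum.isPair q↟↟↟ a↟ c ⊓
        ∼(exF fun w => AMCSpectrum.mem w z↟↟↟↟↟↟ ⊓ AMCSpectrum.isTriple w a↟↟ b↟↟↟ c↟)))
      (D0.not (D0.exPair (Sum.inr (Fin.last n)) (f := fun q b => exF fun a => exF fun c =>
        AMCSpectrum.isPair q↟↟ a↟ c ⊓ ∼(exF fun w => AMCSpectrum.mem w z↟↟↟↟↟↟ ⊓
          AMCSpectrum.isTriple w a↟↟ b↟↟↟ c↟))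
        (D0.exPair (Sum.inr (Fin.last (n + 1)))↟ (f := fun a c => ∼(exF fun w =>
          AMCSpectrum.mem w z↟↟↟↟↟↟ ⊓ AMCSpectrum.isTriple w a↟ (Sum.inr (Fin.last (n + 2)))↟↟↟ c↟))
          (D0.not (D0.bex _ (.isTriple _ _ _ _))))))) fun M _ _ v xs => ?_
  · simp only [realize_exF, BoundedFormula.realize_inf, realize_isPair, realize_isTriple,
      realize_tripleIn, elim_up, elim_last]
    constructor
    · rintro ⟨a, b, c, ⟨q, hq, hw⟩, h⟩
      exact ⟨q, c, hw, a, b, hq, h⟩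
    · rintro ⟨q, c, hw, a, b, hq, h⟩
      exact ⟨a, b, c, ⟨q, hq, hw⟩, h⟩
  · simp only [realize_exF, realize_allF, BoundedFormula.realize_inf, BoundedFormula.realize_imp,
      BoundedFormula.realize_not, realize_mem, realize_isPair, realize_isTriple, realize_tripleIn,
      elim_up, elim_last]
    constructor
    · rintro h w ⟨a, b, c, ⟨q, hq, hw⟩, p, ⟨q', hq', hp⟩, hpx⟩
      by_contra hn
      refine h p hpx ⟨q', b, hp, a, c, hq', ?_⟩
      rintro ⟨w', hw', q₁, hq₁, h'⟩
      obtain rfl := hq.unique hq₁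
      exact hn (by rwa [hw.unique h'])
    · rintro h p hp ⟨q', b, hpq, a, c, hq', hn⟩
      obtain ⟨q, hq⟩ := EP.exists_pairS a b
      obtain ⟨w, hw⟩ := EP.exists_pairS q c
      exact hn ⟨w, h w ⟨a, b, c, ⟨q, hq, hw⟩, p, ⟨q', hq', hpq⟩, hp⟩, q, hq, hw⟩

theorem D0.cycleGraph (z x : α ⊕ Fin n) : D0.{u} (allF fun w => AMCSpectrum.mem w z↟ ⇔
    exF fun a => exF fun b => exF fun c => AMCSpectrum.isTriple w↟↟↟ a↟↟ b↟ c ⊓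
      AMCSpectrum.tripleIn x↟↟↟↟ b↟ c a↟↟) := by
  refine D0.graph z (f := fun w => exF fun a => exF fun b => exF fun c =>
      AMCSpectrum.isTriple w↟↟↟ a↟↟ b↟ c ⊓ AMCSpectrum.tripleIn x↟↟↟↟ b↟ c a↟↟)
    ((D0.exPair (Sum.inr (Fin.last n)) (f := fun q c => exF fun a => exF fun b =>
      AMCSpectrum.isPair q↟↟ a↟ b ⊓ AMCSpectrum.tripleIn x↟↟↟↟↟ b c↟↟ a↟)
      (D0.exPair (Sum.inr (Fin.last (n + 1)))↟ (f := fun a b => AMCSpectrum.tripleIn x↟↟↟↟↟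
        b (Sum.inr (Fin.last (n + 2)))↟↟ a) (.tripleIn _ _ _ _))).congr fun M _ _ v xs => ?_)
    (D0.ball x (f := fun p => ∼(exF fun q => exF fun a => AMCSpectrum.isPair p↟↟ q↟ a ⊓
      exF fun b => exF fun c => AMCSpectrum.isPair q↟↟↟ b↟ c ⊓
        ∼(exF fun w => AMCSpectrum.mem w z↟↟↟↟↟↟ ⊓ AMCSpectrum.isTriple w a↟↟↟ b↟↟ c↟)))
      (D0.not (D0.exPair (Sum.inr (Fin.last n)) (f := fun q a => exF fun b => exF fun c =>
        AMCSpectrum.isPair q↟↟ b↟ c ⊓ ∼(exF fun w => AMCSpectrum.mem w z↟↟↟↟↟↟ ⊓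
          AMCSpectrum.isTriple w a↟↟↟ b↟↟ c↟))
        (D0.exPair (Sum.inr (Fin.last (n + 1)))↟ (f := fun b c => ∼(exF fun w =>
          AMCSpectrum.mem w z↟↟↟↟↟↟ ⊓ AMCSpectrum.isTriple w (Sum.inr (Fin.last (n + 2)))↟↟↟ b↟ c↟))
          (D0.not (D0.bex _ (.isTriple _ _ _ _))))))) fun M _ _ v xs => ?_
  · simp only [realize_exF, BoundedFormula.realize_inf, realize_isPair, realize_isTriple,
      realize_tripleIn, elim_up, elim_last]
    constructor
    · rintro ⟨a, b, c, ⟨q, hq, hw⟩, h⟩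
      exact ⟨q, c, hw, a, b, hq, h⟩
    · rintro ⟨q, c, hw, a, b, hq, h⟩
      exact ⟨a, b, c, ⟨q, hq, hw⟩, h⟩
  · simp only [realize_exF, realize_allF, BoundedFormula.realize_inf, BoundedFormula.realize_imp,
      BoundedFormula.realize_not, realize_mem, realize_isPair, realize_isTriple, realize_tripleIn,
      elim_up, elim_last]
    constructor
    · rintro h w ⟨a, b, c, ⟨q, hq, hw⟩, p, ⟨q', hq', hp⟩, hpx⟩
      by_contra hn
      refine h p hpx ⟨q', a, hp, b, c, hq', ?_⟩
      rintro ⟨w', hw', q₁, hq₁, h'⟩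
      obtain rfl := hq.unique hq₁
      exact hn (by rwa [hw.unique h'])
    · rintro h p hp ⟨q', a, hpq, b, c, hq', hn⟩
      obtain ⟨q, hq⟩ := EP.exists_pairS a b
      obtain ⟨w, hw⟩ := EP.exists_pairS q c
      exact hn ⟨w, h w ⟨a, b, c, ⟨q, hq, hw⟩, p, ⟨q', hq', hpq⟩, hp⟩, q, hq, hw⟩

theorem D0.goedelUnary : ∀ i : Fin 5, D0.{u} (goedelUnary i)
  | 0 => D0.unionGraph (Sum.inl 0) (Sum.inl 1)
  | 1 => D0.domGraph (Sum.inl 0) (Sum.inl 1)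
  | 2 => D0.converseGraph (Sum.inl 0) (Sum.inl 1)
  | 3 => D0.swapGraph (Sum.inl 0) (Sum.inl 1)
  | 4 => D0.cycleGraph (Sum.inl 0) (Sum.inl 1)

end Bounded

end AMCSpectrum

namespace AMCSpectrum

/-! ## Models of the Morleyization -/

section Morleyization

theorem realize_funTerm {A : Set (Form LSet × Fin 2)} {M : Type u} [(morley LSet A).Structure M]
    {n : ℕ} (φ : LSet.Formula (Fin (n + 1)))
    (h : ((⟨n, φ⟩ : Form LSet), (1 : Fin 2)) ∈ A) {α : Type} {k : ℕ} (g : Fin n → α ⊕ Fin k)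
    (v : α ⊕ Fin k → M) : (funTerm φ h g).realize v =
      Structure.funMap (L := morley LSet A) (MorleyFunctions.funSymb φ h) fun i => v (g i) := rfl

variable {A : Set (Form LSet × Fin 2)} {M : Type u} [LSet.Structure M]
  [(morley LSet A).Structure M] [(incl A).IsExpansionOn M]

theorem realize_axZero {n : ℕ} {φ : LSet.Formula (Fin (n + 1))}
    (h : ((⟨n, φ⟩ : Form LSet), (0 : Fin 2)) ∈ A) : M ⊨ axZero φ h ↔ ∀ v : Fin (n + 1) → M,
      Structure.RelMap (L := morley LSet A) (MorleyRelations.relSymb φ h) v ↔ φ.Realize v := by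
  rw [Sentence.Realize, axZero, BoundedFormula.realize_alls]
  refine forall_congr' fun v => ?_
  rw [BoundedFormula.realize_iff, realize_plug, LHom.realize_onFormula]
  exact Iff.comm

theorem relMap_relSymb (hT : M ⊨ setMorleyTheory A) {n : ℕ} {φ : LSet.Formula (Fin (n + 1))}
    (h : ((⟨n, φ⟩ : Form LSet), (0 : Fin 2)) ∈ A) (v : Fin (n + 1) → M) :
    Structure.RelMap (L := morley LSet A) (MorleyRelations.relSymb φ h) v ↔ φ.Realize v :=
  (realize_axZero h).1 (hT.realize_of_mem (axZero φ h) (Or.inl (Or.inl ⟨n, φ, h, rfl⟩))) v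

theorem funMap_funSymb (hT : M ⊨ setMorleyTheory A) {n : ℕ} {φ : LSet.Formula (Fin (n + 1))}
    (h : ((⟨n, φ⟩ : Form LSet), (1 : Fin 2)) ∈ A) (v : Fin n → M) {z : M}
    (hz : ∀ y, φ.Realize (Fin.cons y v : Fin (n + 1) → M) ↔ y = z) :
    Structure.funMap (L := morley LSet A) (MorleyFunctions.funSymb φ h) v = z := by
  have := hT.realize_of_mem (axOne φ h) (Or.inl (Or.inr ⟨n, φ, h, rfl⟩))
  rw [Sentence.Realize, axOne, BoundedFormula.realize_alls] at this
  have := (BoundedFormula.realize_inf.1 (this v)).1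
  simp only [BoundedFormula.realize_imp, exUniqueF, realize_exF, realize_allF,
    BoundedFormula.realize_iff, realize_plug, LHom.realize_onFormula, realize_eqF, elim_up,
    funcons_elim, Sum.elim_inr, Fin.snoc_last, BoundedFormula.realize_bdEqual, Term.realize_var,
    realize_funTerm] at this
  exact (hz _).1 (this ⟨z, hz⟩ _ rfl)

theorem defaultConst_eq (hT : M ⊨ setMorleyTheory A) (h : ∃ φ : Form LSet, (φ, (1 : Fin 2)) ∈ A)
    (v : Fin 0 → M) (x : M) :
    (¬ ∃ y, y ∊ x) ↔ Structure.funMap (L := morley LSet A) (MorleyFunctions.default h) v = x := by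
  have := hT.realize_of_mem _ (Or.inr ⟨h, rfl⟩)
  simp only [Sentence.Realize, Formula.Realize, realize_allF, BoundedFormula.realize_iff,
    LHom.realize_onBoundedFormula, BoundedFormula.realize_not, realize_nonemptyF, elim_last,
    BoundedFormula.realize_bdEqual, Term.realize_var] at this
  refine (this x).trans (iff_of_eq (congrArg (· = x) ?_))
  rw [Subsingleton.elim v default]
  exact Term.realize_constants

end Morleyization

/-! ### The operations of the signature of bounded formulas -/

section Operations

variable {M : Type u} [LSet.Structure M] [ZF M]

/-- The bound `b` has two roles: separation from it yields the set, and the set is hereditarily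
small whenever `b` is. -/
theorem exists_unique_set (Q : M → Prop) [Dfn₁ Q] (b : M) (hb : ∀ w, Q w → w ∊ b) :
    ∃ z, (∀ y, (∀ w, w ∊ y ↔ Q w) ↔ y = z) ∧ ∀ k, Hs k b → Hs k z := by
  have h := mem_cls_of_subset (P := Q) b hb
  refine ⟨cls Q, fun y => ⟨fun hy => ZF.ext _ _ fun w => (hy w).trans (h w).symm, ?_⟩,
    fun k hk => hk.subset fun w hw => hb w ((h w).1 hw)⟩
  rintro rfl
  exact h

theorem goedelBinary_total (i : Fin 5) (x y : M) :
    ∃ z, (∀ w, (goedelBinary i).Realize ![w, x, y] ↔ w = z) ∧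
      ∀ k, InfCard k → Hs k x → Hs k y → Hs k z := by
  fin_cases i
  · obtain ⟨z, h, h'⟩ := exists_unique_set (fun w => w = x ∨ w = y) (upair x y) (by simp)
    exact ⟨z, fun w => (realize_isUPair _ _ _).trans (h w), fun k hk hx hy => h' k (hk.hs_upair hx hy)⟩
  · obtain ⟨z, h, h'⟩ := exists_unique_set (fun w => ∃ a b, (a ∊ x ∧ b ∊ y) ∧ w = op a b) (prd x y)
      (fun w ⟨a, b, h, hw⟩ => mem_prd.2 ⟨a, b, h.1, h.2, hw⟩)
    refine ⟨z, fun w => Iff.trans ?_ (h w), fun k hk hx hy => h' k (hk.hs_prd hx hy)⟩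
    simp [goedelBinary, Formula.Realize, pairS_iff, -Fin.reduceLast]
    exact Iff.rfl
  · obtain ⟨z, h, h'⟩ := exists_unique_set (fun w => ∃ a b, ((a ∊ x ∧ b ∊ y) ∧ a ∊ b) ∧ w = op a b)
      (prd x y) (fun w ⟨a, b, h, hw⟩ => mem_prd.2 ⟨a, b, h.1.1, h.1.2, hw⟩)
    refine ⟨z, fun w => Iff.trans ?_ (h w), fun k hk hx hy => h' k (hk.hs_prd hx hy)⟩
    simp [goedelBinary, Formula.Realize, pairS_iff, -Fin.reduceLast]
    exact Iff.rfl
  · obtain ⟨z, h, h'⟩ := exists_unique_set (fun w => w ∊ x ∧ ¬ w ∊ y) x (fun w h => h.1)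
    refine ⟨z, fun w => Iff.trans ?_ (h w), fun k hk hx hy => h' k hx⟩
    simp [goedelBinary, Formula.Realize]
    exact Iff.rfl
  · obtain ⟨z, h, h'⟩ := exists_unique_set (fun w => w ∊ x ∧ w ∊ y) x (fun w h => h.1)
    refine ⟨z, fun w => Iff.trans ?_ (h w), fun k hk hx hy => h' k hx⟩
    simp [goedelBinary, Formula.Realize]
    exact Iff.rfl

theorem mem_of_triple_mem {a b c x : M} (h : op (op a b) c ∊ x) :
    a ∊ cup (sUn (sUn x)) (sUn (sUn (sUn (sUn x)))) ∧
    b ∊ cup (sUn (sUn x)) (sUn (sUn (sUn (sUn x)))) ∧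
    c ∊ cup (sUn (sUn x)) (sUn (sUn (sUn (sUn x)))) := by
  have h1 := mem_sUn_sUn_of_op h
  have h2 := mem_sUn_sUn_of_op h1.1
  exact ⟨mem_cup.2 (Or.inr h2.1), mem_cup.2 (Or.inr h2.2), mem_cup.2 (Or.inl h1.2)⟩

theorem InfCard.hs_cup {k x y : M} (hk : InfCard k) (hx : Hs k x) (hy : Hs k y) :
    Hs k (cup x y) := (hk.hs_upair hx hy).sUn

theorem goedelUnary_total (i : Fin 5) (x : M) :
    ∃ z, (∀ w, (goedelUnary i).Realize ![w, x] ↔ w = z) ∧ ∀ k, InfCard k → Hs k x → Hs k z := by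
  -- `d` contains the components of all triples in `x`: the last one lies in `⋃⋃x`, the first two
  -- lie two unions deeper.
  let d := cup (sUn (sUn x)) (sUn (sUn (sUn (sUn x))))
  have hd : ∀ k, InfCard k → Hs k x → Hs k (prd (prd d d) d) := fun k hk hx => by
    have := hk.hs_cup hx.sUn.sUn hx.sUn.sUn.sUn.sUn
    exact hk.hs_prd (hk.hs_prd this this) this
  fin_cases i
  · obtain ⟨z, h, h'⟩ := exists_unique_set (fun w => ∃ a, a ∊ x ∧ w ∊ a) (sUn x) (by simp)
    refine ⟨z, fun w => Iff.trans ?_ (h w), fun k hk hx => h' k hx.sUn⟩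
    simp [goedelUnary, Formula.Realize, -Fin.reduceLast]
    exact Iff.rfl
  · obtain ⟨z, h, h'⟩ := exists_unique_set (fun w => ∃ b, op w b ∊ x) (sUn (sUn x))
      (fun w ⟨b, h⟩ => (mem_sUn_sUn_of_op h).1)
    refine ⟨z, fun w => Iff.trans ?_ (h w), fun k hk hx => h' k hx.sUn.sUn⟩
    simp [goedelUnary, Formula.Realize, pairInS_iff, -Fin.reduceLast]
    exact Iff.rfl
  · obtain ⟨z, h, h'⟩ := exists_unique_set (fun w => ∃ a b, w = op a b ∧ op b a ∊ x)
      (prd (sUn (sUn x)) (sUn (sUn x))) (fun w ⟨a, b, hw, h⟩ => mem_prd.2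
        ⟨a, b, (mem_sUn_sUn_of_op h).2, (mem_sUn_sUn_of_op h).1, hw⟩)
    refine ⟨z, fun w => Iff.trans ?_ (h w), fun k hk hx => h' k (hk.hs_prd hx.sUn.sUn hx.sUn.sUn)⟩
    simp [goedelUnary, Formula.Realize, pairInS_iff, pairS_iff, -Fin.reduceLast]
    exact Iff.rfl
  · obtain ⟨z, h, h'⟩ := exists_unique_set
      (fun w => ∃ a b c, w = op (op a b) c ∧ op (op a c) b ∊ x) (prd (prd d d) d)
      (fun w ⟨a, b, c, hw, h⟩ => by
        obtain ⟨h1, h2, h3⟩ := mem_of_triple_mem h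
        rw [hw, op_mem_prd, op_mem_prd]
        exact ⟨⟨h1, h3⟩, h2⟩)
    refine ⟨z, fun w => Iff.trans ?_ (h w), fun k hk hx => h' k (hd k hk hx)⟩
    simp [goedelUnary, Formula.Realize, pairS_iff, -Fin.reduceLast]
    exact Iff.rfl
  · obtain ⟨z, h, h'⟩ := exists_unique_set
      (fun w => ∃ a b c, w = op (op a b) c ∧ op (op b c) a ∊ x) (prd (prd d d) d)
      (fun w ⟨a, b, c, hw, h⟩ => by
        obtain ⟨h1, h2, h3⟩ := mem_of_triple_mem h
        rw [hw, op_mem_prd, op_mem_prd]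
        exact ⟨⟨h3, h1⟩, h2⟩)
    refine ⟨z, fun w => Iff.trans ?_ (h w), fun k hk hx => h' k (hd k hk hx)⟩
    simp [goedelUnary, Formula.Realize, pairS_iff, -Fin.reduceLast]
    exact Iff.rfl

theorem deltaZero_zero {n : ℕ} {φ : LSet.Formula (Fin (n + 1))} :
    ((⟨n, φ⟩ : Form LSet), (0 : Fin 2)) ∈ deltaZero ↔ IsDeltaZero φ := by
  constructor
  · rintro (((⟨m, ψ, h, h'⟩ | h) | ⟨i, h⟩) | ⟨i, h⟩)
    · simp only [Prod.mk.injEq, Sigma.mk.injEq, and_true] at h'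
      obtain ⟨rfl, h'⟩ := h'
      rwa [eq_of_heq h']
    all_goals simp at h
  · exact fun h => Or.inl (Or.inl (Or.inl ⟨n, φ, h, rfl⟩))

/-- What is needed of each function symbol: its graph is Δ₀, it is total, so that the default value
is never taken, and `H_{k⁺}` is closed under it. -/
theorem deltaZero_one {n : ℕ} {φ : LSet.Formula (Fin (n + 1))}
    (h : ((⟨n, φ⟩ : Form LSet), (1 : Fin 2)) ∈ deltaZero) : D0.{u} φ ∧
      ∀ v : Fin n → M, ∃ z, (∀ y, φ.Realize (Fin.cons y v : Fin (n + 1) → M) ↔ y = z) ∧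
        ∀ k, InfCard k → (∀ i, Hs k (v i)) → Hs k z := by
  rcases h with ((⟨m, ψ, h, h'⟩ | h) | ⟨i, h⟩) | ⟨i, h⟩
  · simp at h'
  · simp only [Set.mem_singleton_iff, Prod.mk.injEq, Sigma.mk.injEq, and_true] at h
    obtain ⟨rfl, h⟩ := h
    obtain rfl := eq_of_heq h
    refine ⟨D0.isOmega _, fun v => ⟨om, fun y => ?_, fun k hk _ => hk.hs_om⟩⟩
    exact (realize_isOmega _).trans omegaS_iff
  · simp only [Prod.mk.injEq, Sigma.mk.injEq, and_true] at h
    obtain ⟨rfl, h⟩ := h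
    obtain rfl := eq_of_heq h
    refine ⟨D0.goedelBinary i, fun v => ?_⟩
    obtain ⟨z, h, h'⟩ := goedelBinary_total i (v 0) (v 1)
    refine ⟨z, fun y => ?_, fun k hk hv => h' k hk (hv 0) (hv 1)⟩
    rw [← h]
    refine iff_of_eq (congrArg _ ?_)
    funext j
    fin_cases j <;> rfl
  · simp only [Prod.mk.injEq, Sigma.mk.injEq, and_true] at h
    obtain ⟨rfl, h⟩ := h
    obtain rfl := eq_of_heq h
    refine ⟨D0.goedelUnary i, fun v => ?_⟩
    obtain ⟨z, h, h'⟩ := goedelUnary_total i (v 0)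
    refine ⟨z, fun y => ?_, fun k hk hv => h' k hk (hv 0)⟩
    rw [← h]
    refine iff_of_eq (congrArg _ ?_)
    funext j
    fin_cases j <;> rfl

end Operations

end AMCSpectrum

namespace AMCSpectrum

/-! ## Embeddings into models of a theory -/

section Embeddings

variable {L : FirstOrder.Language.{0, 0}}

theorem isQF_restrictFreeVar {α : Type*} [DecidableEq α] {β : Type*} {n : ℕ}
    {φ : L.BoundedFormula α n} (h : φ.IsQF) :
    ∀ f : φ.freeVarFinset → β, (φ.restrictFreeVar f).IsQF := by
  induction h with
  | falsum => exact fun _ => .falsum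
  | of_isAtomic h =>
    intro f
    cases h with
    | equal t₁ t₂ => exact (BoundedFormula.IsAtomic.equal _ _).isQF
    | rel R ts => exact (BoundedFormula.IsAtomic.rel _ _).isQF
  | imp _ _ ih₁ ih₂ => exact fun f => (ih₁ _).imp (ih₂ _)

theorem isUniversal_alls {α : Type*} : ∀ {n : ℕ} {φ : L.BoundedFormula α n}, φ.IsUniversal →
    BoundedFormula.IsUniversal φ.alls
  | 0, _, h => h
  | _ + 1, φ, h => isUniversal_alls (φ := φ.all) h.all

/-- Models of the universal consequences of `T` embed into models of `T`. -/
theorem exists_embedding {T : L.Theory} (M : Type u) [L.Structure M]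
    (h : ∀ σ ∈ univConsequences T, M ⊨ σ) :
    ∃ (K : Type u) (_ : L.Structure K) (_ : Nonempty K), K ⊨ T ∧ Nonempty (M ↪[L] K) := by
  classical
  let ι := {φ : L.Formula M // BoundedFormula.IsQF φ ∧ φ.Realize (id : M → M)}
  let D : ι → L[[M]].Theory := fun φ =>
    (L.lhomWithConstants M).onTheory T ∪ {Formula.equivSentence φ.1}
  -- A finite part of the diagram is implied by a single quantifier-free formula true in `M`, the
  -- conjunction.
  have hconj : ∀ s : Finset ι, ∃ φ : ι, ∀ (K : Type) [L.Structure K] (v : M → K),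
      φ.1.Realize v → ∀ ψ ∈ s, ψ.1.Realize v := by
    intro s
    induction s using Finset.induction_on with
    | empty => exact ⟨⟨⊤, .top, by simp⟩, by simp⟩
    | insert a s _ ih =>
      obtain ⟨φ, hφ⟩ := ih
      refine ⟨⟨a.1 ⊓ φ.1, a.2.1.inf φ.2.1, Formula.realize_inf.2 ⟨a.2.2, φ.2.2⟩⟩, ?_⟩
      intro K _ v hv ψ hψ
      have hv := Formula.realize_inf.1 hv
      rcases Finset.mem_insert.1 hψ with rfl | hψ
      exacts [hv.1, hφ K v hv.2 ψ hψ]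
  have hsat : Theory.IsSatisfiable (⋃ i, D i) := by
    rw [Theory.isSatisfiable_iUnion_iff_isSatisfiable_iUnion_finset]
    intro s
    obtain ⟨φ, hφ⟩ := hconj s
    let e := Fintype.equivFin (BoundedFormula.freeVarFinset φ.1)
    let ψ : L.Formula (Fin _) := BoundedFormula.restrictFreeVar φ.1 e
    have hψ : ∀ (N : Type _) [L.Structure N] (v : M → N),
        ψ.Realize (v ∘ fun i => (e.symm i).1) ↔ φ.1.Realize v := fun N _ v =>
      BoundedFormula.realize_restrictFreeVar v (by simp)
    have hψ₀ : ∀ (N : Type) [L.Structure N] (v : M → N),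
        ψ.Realize (v ∘ fun i => (e.symm i).1) ↔ φ.1.Realize v := fun N _ v =>
      BoundedFormula.realize_restrictFreeVar v (by simp)
    -- `σ` says that no tuple satisfies `φ`. It is universal and false in `M`, hence not a
    -- consequence of `T`, and a model of `T` violating it realizes this part of the diagram.
    let σ : L.Sentence := BoundedFormula.alls (plug (Formula.not ψ) Sum.inr : L.BoundedFormula Empty _)
    have hσ : BoundedFormula.IsUniversal σ := isUniversal_alls
      (BoundedFormula.IsQF.isUniversal ((isQF_restrictFreeVar φ.2.1 e).not.relabel _))
    have hM : ¬ M ⊨ σ := by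
      intro hM
      simp only [σ, Sentence.Realize, BoundedFormula.realize_alls, realize_plug,
        Formula.realize_not] at hM
      exact hM _ ((hψ M id).2 φ.2.2)
    have hT : ¬ T ⊨ᵇ σ := fun hT => hM (h σ ⟨hσ, hT⟩)
    rw [Theory.models_sentence_iff] at hT
    push Not at hT
    obtain ⟨K, hK⟩ := hT
    simp only [σ, Sentence.Realize, BoundedFormula.realize_alls, realize_plug,
        Formula.realize_not, not_forall, not_not, Sum.elim_inr] at hK
    obtain ⟨v, hv⟩ := hK
    obtain ⟨k₀⟩ := K.nonempty'
    -- Elements of `M` that do not occur in `φ` may be sent anywhere.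
    let v' : M → K := fun a => if h : a ∈ BoundedFormula.freeVarFinset φ.1 then v (e ⟨a, h⟩) else k₀
    have hv' : φ.1.Realize v' := by
      rw [← hψ₀]
      convert hv using 1
      funext i
      simp [v']
    let _ : (constantsOn M).Structure K := constantsOn.structure v'
    have : K ⊨ (⋃ i ∈ s, D i) := by
      refine ⟨fun τ hτ => ?_⟩
      simp only [Set.mem_iUnion] at hτ
      obtain ⟨i, hi, hτ | hτ⟩ := hτ
      · exact ((LHom.onTheory_model (L.lhomWithConstants M) T).2 K.is_model).realize_of_mem τ hτ
      · rw [Set.mem_singleton_iff.1 hτ, Formula.realize_equivSentence]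
        exact hφ K v' hv' i hi
    exact Theory.Model.isSatisfiable K
  obtain ⟨K⟩ := hsat
  let _ : L.Structure K := (L.lhomWithConstants M).reduct K
  have : (L.lhomWithConstants M).IsExpansionOn K := LHom.isExpansionOn_reduct _ _
  have hK : ∀ i, ∀ τ ∈ D i, K ⊨ τ := fun i τ hτ =>
    K.is_model.realize_of_mem τ (Set.mem_iUnion.2 ⟨i, hτ⟩)
  have hqf : ∀ φ : L.Formula M, BoundedFormula.IsQF φ → φ.Realize (id : M → M) →
      φ.Realize fun a => (L.con a : K) := fun φ hφ hM =>
    (Formula.realize_equivSentence K φ).1 (hK ⟨φ, hφ, hM⟩ _ (Or.inr rfl))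
  refine ⟨K, _, K.nonempty', ?_, ⟨⟨⟨fun a => (L.con a : K), fun a b hab => ?_⟩, fun {n} f x => ?_,
    fun {n} r x => ?_⟩⟩⟩
  · refine (LHom.onTheory_model (L.lhomWithConstants M) T).1 ⟨fun τ hτ => ?_⟩
    exact hK ⟨⊤, .top, by simp⟩ τ (Or.inl hτ)
  · by_contra hne
    have := hqf (∼((Term.var a).equal (Term.var b))) (BoundedFormula.IsAtomic.equal _ _).isQF.not
      (by simpa using hne)
    simp only [Formula.realize_not, Formula.realize_equal, Term.realize_var] at this
    exact this hab
  · have := hqf ((Term.var (Structure.funMap f x)).equal (Term.func f fun i => Term.var (x i)))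
      (BoundedFormula.IsAtomic.equal _ _).isQF (by simp)
    simp only [Formula.realize_equal, Term.realize_var, Term.realize_func] at this
    exact this
  · constructor
    · intro hr
      by_contra hne
      have := hqf (∼(r.formula fun i => Term.var (x i))) (BoundedFormula.IsAtomic.rel _ _).isQF.not
        (by simpa [Formula.realize_rel] using hne)
      simp only [Formula.realize_not, Formula.realize_rel, Term.realize_var] at this
      exact this hr
    · intro hr
      have := hqf (r.formula fun i => Term.var (x i)) (BoundedFormula.IsAtomic.rel _ _).isQF
        (by simpa [Formula.realize_rel] using hr)
      simp only [Formula.realize_rel, Term.realize_var] at this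
      exact this

/-- If `S` is the model companion of `T`, then every model of `S` embeds `Σ₁`-elementarily into a
model of `T`. -/
theorem IsModelCompanion.exists_embedding {S T : L.Theory} (hS : IsModelCompanion.{u} S T)
    (M : Type u) [L.Structure M] [Nonempty M] (hM : M ⊨ S) :
    ∃ (K : Type u) (_ : L.Structure K) (_ : Nonempty K) (j : M ↪[L] K), K ⊨ T ∧
      ∀ (n : ℕ) (φ : L.Formula (Fin n)), BoundedFormula.IsExistential φ → ∀ v : Fin n → M,
        φ.Realize v ↔ φ.Realize (j ∘ v) := by
  obtain ⟨K, _, _, hK, ⟨j⟩⟩ := AMCSpectrum.exists_embedding (T := T) M fun σ hσ => by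
    rw [← hS.1] at hσ
    exact hσ.2.realize_sentence M
  -- `K` embeds into a model `N` of `S`. An existential formula true in `K` persists to `N`, and the
  -- embedding of `M` into `N` is elementary by model completeness.
  obtain ⟨N, _, _, hN, ⟨j'⟩⟩ := AMCSpectrum.exists_embedding (T := S) K fun σ hσ => by
    rw [hS.1] at hσ
    exact hσ.2.realize_sentence K
  have up : ∀ {A B : Type u} [L.Structure A] [L.Structure B] (f : A ↪[L] B) {n : ℕ}
      {φ : L.Formula (Fin n)}, BoundedFormula.IsExistential φ → ∀ v : Fin n → A,
        φ.Realize v → φ.Realize (f ∘ v) := by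
    intro A B _ _ f n φ hφ v h
    have := hφ.realize_embedding f h
    rwa [Subsingleton.elim (f ∘ default) default] at this
  refine ⟨K, _, ‹_›, j, hK, fun n φ hφ v => ⟨up j hφ v, fun h => ?_⟩⟩
  exact (hS.2 M N hM hN (j'.comp j) n φ v).1 (up j' hφ _ h)

end Embeddings

end AMCSpectrum

namespace AMCSpectrum

/-! ## Maps that are elementary for `∃ Δ₀`-formulas -/

theorem IsDeltaZero.exists_formula {α β : Type} {n : ℕ} {φ : LSet.BoundedFormula α n}
    (h : IsDeltaZero φ) (s : α ⊕ Fin n → β) : ∃ ψ : LSet.Formula β, IsDeltaZero ψ ∧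
      ∀ (N : Type u) [LSet.Structure N] (v : β → N),
        ψ.Realize v ↔ φ.Realize (fun a => v (s (Sum.inl a))) fun i => v (s (Sum.inr i)) := by
  obtain ⟨ψ, hψ, hr⟩ := h.exists_subst.{u} (m := 0) fun x => Sum.inl (s x)
  exact ⟨ψ, hψ, fun N _ v => hr N v default⟩

theorem IsDeltaZero.exists_relabel {α β : Type} {φ : LSet.Formula α} (h : IsDeltaZero φ)
    (s : α → β) : ∃ ψ : LSet.Formula β, IsDeltaZero ψ ∧
      ∀ (N : Type u) [LSet.Structure N] (v : β → N), ψ.Realize v ↔ φ.Realize (v ∘ s) := by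
  obtain ⟨ψ, hψ, hr⟩ := h.exists_formula.{u} (Sum.elim s Fin.elim0)
  exact ⟨ψ, hψ, fun N _ v => (hr N v).trans (iff_of_eq (congrArg _ (Subsingleton.elim _ _)))⟩

theorem elim_comp_comp {M K : Type u} {α β : Type} (j : M → K) (x : α ⊕ β) (v : α → M) (w : β → M) :
    Sum.elim (j ∘ v) (j ∘ w) x = j (Sum.elim v w x) := by
  cases x <;> rfl

section DeltaEmb

variable {M K : Type u} [LSet.Structure M] [LSet.Structure K]

/-- Maps that reflect the formulas `∃ ys, χ`, where `χ` is `Δ₀`. -/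
structure DeltaEmb (j : M → K) : Prop where
  inj : Function.Injective j
  mem_iff : ∀ x y, j x ∊ j y ↔ x ∊ y
  witness : ∀ (m p : ℕ) (χ : LSet.Formula (Fin m ⊕ Fin (p + 1))), IsDeltaZero χ →
    ∀ w : Fin m → M, (∃ ys : Fin (p + 1) → K, χ.Realize (Sum.elim (j ∘ w) ys)) →
      ∃ ys : Fin (p + 1) → M, χ.Realize (Sum.elim (j ∘ w) (j ∘ ys))

variable {j : M → K}

/-- The bounded quantifier step of absoluteness. The two blocks of parameters are merged by
`finSumFinEquiv`, and the clause `witness` is applied with a single new variable. -/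
theorem DeltaEmb.exists_bounded (h : DeltaEmb j) {k n : ℕ} {φ : LSet.BoundedFormula (Fin k) (n + 1)}
    (hφ : IsDeltaZero φ) (x : Fin k ⊕ Fin n) (v : Fin k → M) (xs : Fin n → M)
    (hex : ∃ y, y ∊ j (Sum.elim v xs x) ∧ φ.Realize (j ∘ v) (Fin.snoc (j ∘ xs) y)) :
    ∃ y, y ∊ Sum.elim v xs x ∧ φ.Realize (j ∘ v) (Fin.snoc (j ∘ xs) (j y)) := by
  let s : Fin k ⊕ Fin (n + 1) → Fin (k + n) ⊕ Fin 1 := Sum.elim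
    (fun i => Sum.inl (finSumFinEquiv (Sum.inl i)))
    (Fin.snoc (α := fun _ => Fin (k + n) ⊕ Fin 1)
      (fun i => Sum.inl (finSumFinEquiv (Sum.inr i))) (Sum.inr 0))
  obtain ⟨χ, hχ, hr⟩ := hφ.exists_formula.{u} s
  let w : Fin (k + n) → M := Sum.elim v xs ∘ finSumFinEquiv.symm
  have hs : ∀ y : K, χ.Realize (Sum.elim (j ∘ w) fun _ : Fin 1 => y) ↔
      φ.Realize (j ∘ v) (Fin.snoc (j ∘ xs) y) := by
    intro y
    refine (hr K _).trans (iff_of_eq (congrArg₂ _ ?_ ?_))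
    · funext i
      simp only [s, w, Sum.elim_inl, Function.comp, Equiv.symm_apply_apply]
    · funext i
      refine Fin.lastCases ?_ (fun i => ?_) i
      · simp only [s, Sum.elim_inr, Fin.snoc_last]
      · simp only [s, w, Sum.elim_inr, Fin.snoc_castSucc, Sum.elim_inl, Function.comp,
          Equiv.symm_apply_apply]
  obtain ⟨y, hy, hyφ⟩ := hex
  let x' : (Fin (k + n) ⊕ Fin 1) ⊕ Fin 0 := Sum.inl (Sum.inl (finSumFinEquiv x))
  have hx' : ∀ y : K, (Formula.Realize (mem (Sum.inl (Sum.inr 0)) x' ⊓ χ)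
      (Sum.elim (j ∘ w) fun _ : Fin 1 => y)) ↔ y ∊ j (Sum.elim v xs x) ∧
        φ.Realize (j ∘ v) (Fin.snoc (j ∘ xs) y) := by
    intro y
    rw [Formula.Realize, BoundedFormula.realize_inf, realize_mem, ← hs]
    refine and_congr (iff_of_eq ?_) Iff.rfl
    simp only [x', w, Sum.elim_inl, Sum.elim_inr, Function.comp, Equiv.symm_apply_apply]
  obtain ⟨ys, hys⟩ := h.witness (k + n) 0 _ ((IsDeltaZero.mem (Sum.inl (Sum.inr 0)) x').inf hχ) w
    ⟨fun _ => y, (hx' y).2 ⟨hy, hyφ⟩⟩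
  have e : j ∘ ys = fun _ => j (ys 0) := by
    funext i
    rw [Fin.fin_one_eq_zero i]
    rfl
  rw [e, hx'] at hys
  exact ⟨ys 0, (h.mem_iff _ _).1 hys.1, hys.2⟩

/-- The clause `witness` speaks only of truth in `K` for images of elements of `M`. Agreement with
truth in `M` follows by induction: the witness of a bounded quantifier in `K` can be taken in the
image of `M`. -/
theorem DeltaEmb.absolute (h : DeltaEmb j) {k n : ℕ} {φ : LSet.BoundedFormula (Fin k) n}
    (hφ : IsDeltaZero φ) (v : Fin k → M) (xs : Fin n → M) :
    φ.Realize v xs ↔ φ.Realize (j ∘ v) (j ∘ xs) := by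
  induction hφ with
  | falsum => exact Iff.rfl
  | eq x y => rw [realize_eqF, realize_eqF, elim_comp_comp, elim_comp_comp, h.inj.eq_iff]
  | mem x y => rw [realize_mem, realize_mem, elim_comp_comp, elim_comp_comp, h.mem_iff]
  | imp _ _ ih₁ ih₂ => rw [BoundedFormula.realize_imp, BoundedFormula.realize_imp, ih₁, ih₂]
  | ball x hφ ih =>
    simp only [realize_allF, BoundedFormula.realize_imp, realize_mem, elim_up, elim_last,
      elim_comp_comp, ih, Fin.comp_snoc]
    constructor
    · intro hM y hy
      by_contra hn
      obtain ⟨y, hy, hn⟩ := h.exists_bounded hφ.not x v xs ⟨y, hy, BoundedFormula.realize_not.2 hn⟩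
      exact BoundedFormula.realize_not.1 hn (hM y hy)
    · exact fun hK y hy => hK (j y) ((h.mem_iff _ _).2 hy)
  | bex x hφ ih =>
    simp only [realize_exF, BoundedFormula.realize_inf, realize_mem, elim_up, elim_last,
      elim_comp_comp, ih, Fin.comp_snoc]
    constructor
    · rintro ⟨y, hy, hφ⟩
      exact ⟨j y, (h.mem_iff _ _).2 hy, hφ⟩
    · exact h.exists_bounded hφ x v xs

theorem DeltaEmb.absolute_formula (h : DeltaEmb j) {α : Type} [Finite α] {φ : LSet.Formula α}
    (hφ : IsDeltaZero φ) (v : α → M) : φ.Realize v ↔ φ.Realize (j ∘ v) := by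
  obtain ⟨k, ⟨e⟩⟩ := Finite.exists_equiv_fin α
  obtain ⟨ψ, hψ, hr⟩ := hφ.exists_relabel.{u} e
  have key : ∀ {N : Type u} [LSet.Structure N] (v : α → N),
      φ.Realize v ↔ ψ.Realize (v ∘ e.symm) := by
    intro N _ v
    rw [hr, Function.comp_assoc, Equiv.symm_comp_self, Function.comp_id]
  rw [key, key, Formula.Realize, h.absolute hψ, Formula.Realize]
  exact iff_of_eq (congrArg _ (Subsingleton.elim _ _))

theorem DeltaEmb.witness_one (h : DeltaEmb j) {m : ℕ} {χ : LSet.Formula (Fin m ⊕ Fin 1)}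
    (hχ : IsDeltaZero χ) (w : Fin m → M)
    (hex : ∃ y, χ.Realize (Sum.elim (j ∘ w) fun _ : Fin 1 => y)) :
    ∃ y, χ.Realize (Sum.elim w fun _ : Fin 1 => y) := by
  obtain ⟨y, hy⟩ := hex
  obtain ⟨ys, hys⟩ := h.witness m 0 χ hχ w ⟨_, hy⟩
  refine ⟨ys 0, (h.absolute_formula hχ _).2 ?_⟩
  convert hys using 1
  funext a
  rcases a with a | a
  · rfl
  · rw [Subsingleton.elim a 0]
    rfl

/-- If `x` and `y` have the same elements in `M`, an element of `K` separating `j x` from `j y`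
would reflect to one in `M`. Pairing asserts the existence of a set with a Δ₀-property. -/
theorem DeltaEmb.ep (h : DeltaEmb j) [EP K] : EP M := by
  refine ⟨fun x y hxy => ?_, fun x y => ?_⟩
  · have sub : ∀ x y : M, (∀ z, z ∊ x → z ∊ y) → ∀ z, z ∊ j x → z ∊ j y := by
      intro x y hxy z hz
      by_contra hn
      obtain ⟨z, hz⟩ := h.witness_one (m := 2) (χ := mem (Sum.inl (Sum.inr 0)) (Sum.inl (Sum.inl 0)) ⊓
        ∼(mem (Sum.inl (Sum.inr 0)) (Sum.inl (Sum.inl 1))))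
        ((IsDeltaZero.mem _ _).inf (IsDeltaZero.mem _ _).not) ![x, y]
        ⟨z, by simpa [Formula.Realize] using ⟨hz, hn⟩⟩
      have hz : z ∊ x ∧ ¬ z ∊ y := by simpa [Formula.Realize] using hz
      exact hz.2 (hxy z hz.1)
    exact h.inj (EP.ext _ _ fun z =>
      ⟨sub x y (fun z => (hxy z).1) z, sub y x (fun z => (hxy z).2) z⟩)
  · obtain ⟨z, hz⟩ := EP.pairing (j x) (j y)
    obtain ⟨z, hz⟩ := h.witness_one (m := 2) (isDeltaZero_isUPairB (Sum.inl (Sum.inr 0))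
        (Sum.inl (Sum.inl 0)) (Sum.inl (Sum.inl 1))) ![x, y] ⟨z, (realize_isUPairB _ _ _ _ _).2 hz⟩
    exact ⟨z, (realize_isUPairB _ _ _ _ _).1 hz⟩

theorem DeltaEmb.absolute_d0 (h : DeltaEmb j) [EP K] {α : Type} [Finite α] {φ : LSet.Formula α}
    (hφ : D0.{u} φ) (v : α → M) : φ.Realize v ↔ φ.Realize (j ∘ v) := by
  have := h.ep
  obtain ⟨ψ, hψ, hr⟩ := hφ
  exact (hr M v default).trans ((h.absolute_formula hψ v).trans (hr K (j ∘ v) default).symm)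

theorem DeltaEmb.witness_one_d0 (h : DeltaEmb j) [EP K] {m : ℕ} {χ : LSet.Formula (Fin m ⊕ Fin 1)}
    (hχ : D0.{u} χ) (w : Fin m → M)
    (hex : ∃ y, χ.Realize (Sum.elim (j ∘ w) fun _ : Fin 1 => y)) :
    ∃ y, χ.Realize (Sum.elim w fun _ : Fin 1 => y) := by
  have := h.ep
  obtain ⟨ψ, hψ, hr⟩ := hχ
  obtain ⟨y, hy⟩ := hex
  obtain ⟨y, hy⟩ := h.witness_one hψ w ⟨y, (hr K _ default).1 hy⟩
  exact ⟨y, (hr M _ default).2 hy⟩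

end DeltaEmb

section OfEmbedding

theorem isExistential_exs {L : FirstOrder.Language.{0, 0}} {α : Type*} :
    ∀ {n : ℕ} {φ : L.BoundedFormula α n}, φ.IsExistential → BoundedFormula.IsExistential φ.exs
  | 0, _, h => h
  | _ + 1, φ, h => isExistential_exs (φ := φ.ex) h.ex

variable {A : Set (Form LSet × Fin 2)} {M K : Type u} [LSet.Structure M] [LSet.Structure K]
  [(morley LSet A).Structure M] [(morley LSet A).Structure K]

/-- The predicate symbols for `Δ₀`-formulas are interpreted by these formulas. -/
def DeltaInterp (A : Set (Form LSet × Fin 2)) (K : Type u) [LSet.Structure K]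
    [(morley LSet A).Structure K] : Prop :=
  ∀ (n : ℕ) (φ : LSet.Formula (Fin (n + 1))) (h : ((⟨n, φ⟩ : Form LSet), (0 : Fin 2)) ∈ A),
    IsDeltaZero φ → ∀ v : Fin (n + 1) → K,
      Structure.RelMap (L := morley LSet A) (MorleyRelations.relSymb φ h) v ↔ φ.Realize v

variable [(incl A).IsExpansionOn M] [(incl A).IsExpansionOn K]

/-- Since `χ` has a predicate symbol, `∃ ys, χ` is in `K` an existential formula of the signature,
and `hj` transfers it. In `M` this yields tuples satisfying the symbol, which is not known to mean
`χ` there; the embedding carries them back to `K`, where it does. -/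
theorem DeltaEmb.of_embedding (hA : deltaZero ⊆ A) (hK : DeltaInterp A K)
    (j : M ↪[morley LSet A] K)
    (hj : ∀ (n : ℕ) (φ : (morley LSet A).Formula (Fin n)), BoundedFormula.IsExistential φ →
      ∀ v : Fin n → M, φ.Realize v ↔ φ.Realize (j ∘ v)) : DeltaEmb j := by
  refine ⟨j.injective, fun x y => ?_, fun m p χ hχ w hex => ?_⟩
  · have h1 := j.map_rel ((incl A).onRelation (n := 2) SetRel.mem) ![x, y]
    have h2 := LHom.map_onRelation (incl A) (M := K) (n := 2) SetRel.mem (j ∘ ![x, y])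
    have h3 := LHom.map_onRelation (incl A) (M := M) (n := 2) SetRel.mem ![x, y]
    refine Iff.trans (iff_of_eq (congrArg (Structure.RelMap (L := LSet) SetRel.mem) ?_)) ((iff_of_eq h2).symm.trans (h1.trans (iff_of_eq h3)))
    funext i
    refine Fin.cases rfl (fun i => ?_) i
    rw [Subsingleton.elim i 0]
    rfl
  · let e : Fin m ⊕ Fin (p + 1) ≃ Fin (m + p + 1) := finSumFinEquiv
    obtain ⟨ψ, hψ, hr⟩ := hχ.exists_relabel.{u} e
    have key : ∀ v : Fin m ⊕ Fin (p + 1) → K, χ.Realize v ↔ ψ.Realize (v ∘ e.symm) := by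
      intro v
      rw [hr, Function.comp_assoc, Equiv.symm_comp_self, Function.comp_id]
    have hmem : ((⟨m + p, ψ⟩ : Form LSet), (0 : Fin 2)) ∈ A := hA (deltaZero_zero.2 hψ)
    let θ : (morley LSet A).BoundedFormula (Fin m) (p + 1) :=
      Relations.boundedFormula (L := morley LSet A) (MorleyRelations.relSymb ψ hmem)
        fun i => Term.var (e.symm i)
    have hθ : ∀ (w : Fin m → K) (ys : Fin (p + 1) → K), θ.Realize w ys ↔
        χ.Realize (Sum.elim w ys) := by
      intro w ys
      rw [key, ← hK _ ψ hmem hψ]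
      exact Iff.rfl
    have hE : BoundedFormula.IsExistential θ.exs :=
      isExistential_exs (BoundedFormula.IsAtomic.rel _ _).isExistential
    have hex' : Formula.Realize θ.exs (j ∘ w) := by
      rw [BoundedFormula.realize_exs]
      obtain ⟨ys, hys⟩ := hex
      exact ⟨ys, (hθ _ _).2 hys⟩
    rw [← hj m _ hE w, BoundedFormula.realize_exs] at hex'
    obtain ⟨ys, hys⟩ := hex'
    refine ⟨ys, (hθ _ _).1 ?_⟩
    exact ((BoundedFormula.IsAtomic.rel _ _).isQF.realize_embedding j).2 hys

end OfEmbedding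

end AMCSpectrum

namespace AMCSpectrum

/-! ## Elimination of function symbols -/

section Elimination

variable {M : Type u}

/-- Classes of predicates on `M` that are closed under boolean operations and substitution. -/
structure BoolClass (M : Type u) where
  Q : ∀ {α : Type}, ((α → M) → Prop) → Prop
  bot : ∀ {α : Type}, Q fun _ : α → M => False
  imp : ∀ {α : Type} {P P' : (α → M) → Prop}, Q P → Q P' → Q fun v => P v → P' v
  reindex : ∀ {α β : Type} {P : (α → M) → Prop} (s : α → β), Q P → Q fun v : β → M => P (v ∘ s)
  eq : ∀ {α : Type} (a b : α), Q fun v : α → M => v a = v b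

namespace BoolClass

variable {𝒬 : BoolClass M} {α β : Type}

theorem not {P : (α → M) → Prop} (h : 𝒬.Q P) : 𝒬.Q fun v => ¬ P v := 𝒬.imp h 𝒬.bot

theorem and {P P' : (α → M) → Prop} (h : 𝒬.Q P) (h' : 𝒬.Q P') : 𝒬.Q fun v => P v ∧ P' v := by
  have := 𝒬.not (𝒬.imp h (𝒬.not h'))
  simpa using this

theorem or {P P' : (α → M) → Prop} (h : 𝒬.Q P) (h' : 𝒬.Q P') : 𝒬.Q fun v => P v ∨ P' v := by
  have := 𝒬.imp (𝒬.not h) h'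
  simpa only [← or_iff_not_imp_left] using this

theorem all_fin : ∀ {n : ℕ} {P : Fin n → (α → M) → Prop}, (∀ i, 𝒬.Q (P i)) →
    𝒬.Q fun v => ∀ i, P i v
  | 0, P, _ => by
    have := 𝒬.not (𝒬.bot (α := α))
    simpa using this
  | n + 1, P, h => by
    have := 𝒬.and (h 0) (all_fin fun i : Fin n => h i.succ)
    simpa only [Fin.forall_fin_succ] using this

/-- The predicates `∃ ys, P'` with `P'` in the class. -/
def Ex (𝒬 : BoolClass M) (P : (α → M) → Prop) : Prop :=
  ∃ (β : Type) (_ : Finite β) (P' : (α ⊕ β → M) → Prop), 𝒬.Q P' ∧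
    ∀ v, P v ↔ ∃ ys : β → M, P' (Sum.elim v ys)

theorem ex_of {P : (α → M) → Prop} (h : 𝒬.Q P) : 𝒬.Ex P := by
  refine ⟨Empty, inferInstance, fun w => P (w ∘ Sum.inl), 𝒬.reindex _ h, fun v => ?_⟩
  simp [Sum.elim_comp_inl]

theorem Ex.reindex {P : (α → M) → Prop} (h : 𝒬.Ex P) (s : α → β) :
    𝒬.Ex fun v : β → M => P (v ∘ s) := by
  obtain ⟨γ, _, P', h, hP⟩ := h
  refine ⟨γ, ‹_›, fun w => P' (w ∘ Sum.map s id), 𝒬.reindex _ h, fun v => ?_⟩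
  simp only [hP, Sum.elim_comp_map, Function.comp_id]

theorem Ex.all_fin {n : ℕ} {P : Fin n → (α → M) → Prop} (h : ∀ i, 𝒬.Ex (P i)) :
    𝒬.Ex fun v => ∀ i, P i v := by
  choose β hβ P' h hP using h
  refine ⟨Σ i, β i, inferInstance, fun w => ∀ i, P' i (w ∘ Sum.map id fun b => ⟨i, b⟩),
    𝒬.all_fin fun i => 𝒬.reindex _ (h i), fun v => ?_⟩
  simp only [hP, Sum.elim_comp_map, Function.comp_id]
  constructor
  · intro hv
    choose ys hys using hv
    exact ⟨fun b => ys b.1 b.2, hys⟩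
  · rintro ⟨ys, hys⟩ i
    exact ⟨_, hys i⟩

theorem Ex.and {P P' : (α → M) → Prop} (h : 𝒬.Ex P) (h' : 𝒬.Ex P') :
    𝒬.Ex fun v => P v ∧ P' v := by
  have : 𝒬.Ex fun v => ∀ i : Fin 2, (![P, P'] i) v := Ex.all_fin fun i => by
    fin_cases i
    exacts [h, h']
  simpa [Fin.forall_fin_two] using this

/-- The two blocks of witnesses are placed side by side; the block of the disjunct that is not used
is filled with a fixed element. -/
theorem Ex.or [Nonempty M] {P P' : (α → M) → Prop} (h : 𝒬.Ex P) (h' : 𝒬.Ex P') :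
    𝒬.Ex fun v => P v ∨ P' v := by
  obtain ⟨β, _, R, h, hP⟩ := h
  obtain ⟨β', _, R', h', hP'⟩ := h'
  refine ⟨β ⊕ β', inferInstance,
    fun w => R (w ∘ Sum.map id Sum.inl) ∨ R' (w ∘ Sum.map id Sum.inr),
    𝒬.or (𝒬.reindex _ h) (𝒬.reindex _ h'), fun v => ?_⟩
  obtain ⟨m₀⟩ := ‹Nonempty M›
  simp only [hP, hP', Sum.elim_comp_map, Function.comp_id]
  constructor
  · rintro (⟨ys, hys⟩ | ⟨ys, hys⟩)
    · exact ⟨Sum.elim ys fun _ => m₀, Or.inl (by simpa using hys)⟩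
    · exact ⟨Sum.elim (fun _ => m₀) ys, Or.inr (by simpa using hys)⟩
  · rintro ⟨ys, hys | hys⟩
    · exact Or.inl ⟨_, hys⟩
    · exact Or.inr ⟨_, hys⟩

theorem Ex.ex [Finite β] {P : (α ⊕ β → M) → Prop} (h : 𝒬.Ex P) :
    𝒬.Ex fun v => ∃ ys : β → M, P (Sum.elim v ys) := by
  obtain ⟨γ, _, P', h, hP⟩ := h
  let s : (α ⊕ β) ⊕ γ → α ⊕ (β ⊕ γ) := Equiv.sumAssoc α β γ
  refine ⟨β ⊕ γ, inferInstance, fun w => P' (w ∘ s), 𝒬.reindex _ h, fun v => ?_⟩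
  have hs : ∀ (ys : β → M) (zs : γ → M), Sum.elim v (Sum.elim ys zs) ∘ s =
      Sum.elim (Sum.elim v ys) zs := by
    intro ys zs
    funext x
    rcases x with (x | x) | x <;> rfl
  simp only [hP]
  constructor
  · rintro ⟨ys, zs, h⟩
    exact ⟨Sum.elim ys zs, by rwa [hs]⟩
  · rintro ⟨ws, h⟩
    refine ⟨ws ∘ Sum.inl, ws ∘ Sum.inr, ?_⟩
    rwa [← hs, Sum.elim_comp_inl_inr]

/-- The interpretations of the symbols of `L` belong to the class. -/
structure Interprets (𝒬 : BoolClass M) (L : FirstOrder.Language.{0, 0}) [L.Structure M] : Prop where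
  rel : ∀ {n : ℕ} (r : L.Relations n), 𝒬.Q fun v : Fin n → M => Structure.RelMap r v
  func : ∀ {n : ℕ} (f : L.Functions n),
    𝒬.Q fun v : Fin (n + 1) → M => Structure.funMap f (fun i => v i.succ) = v 0

variable {L : FirstOrder.Language.{0, 0}} [L.Structure M]

/-- The values of the terms are named by a further block of existentially quantified variables. -/
theorem Ex.terms {n : ℕ} {ts : Fin n → L.Term α}
    (hts : ∀ i, 𝒬.Ex fun w : α ⊕ Unit → M => (ts i).realize (w ∘ Sum.inl) = w (Sum.inr ()))
    {P : (Fin n ⊕ β → M) → Prop} (hP : 𝒬.Ex P) :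
    𝒬.Ex fun w : α ⊕ β → M => P (Sum.elim (fun i => (ts i).realize (w ∘ Sum.inl)) (w ∘ Sum.inr)) := by
  have h1 : 𝒬.Ex fun w : (α ⊕ β) ⊕ Fin n → M => (∀ i, (ts i).realize (w ∘ Sum.inl ∘ Sum.inl) =
      w (Sum.inr i)) ∧ P (w ∘ Sum.elim Sum.inr (Sum.inl ∘ Sum.inr)) :=
    (Ex.all_fin fun i => (hts i).reindex (Sum.elim (Sum.inl ∘ Sum.inl) fun _ => Sum.inr i)).and
      (hP.reindex _)
  have h2 := h1.ex
  convert h2 using 2 with w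
  refine ⟨fun h => ⟨fun i => (ts i).realize (w ∘ Sum.inl), fun i => rfl, ?_⟩, ?_⟩
  · convert h using 1
    funext x
    rcases x with x | x <;> rfl
  · rintro ⟨ys, hys, h⟩
    convert h using 1
    funext x
    rcases x with x | x
    · exact hys x
    · rfl

theorem Interprets.term (h𝒬 : 𝒬.Interprets L) (t : L.Term α) :
    𝒬.Ex fun w : α ⊕ Unit → M => t.realize (w ∘ Sum.inl) = w (Sum.inr ()) := by
  induction t with
  | var a => exact ex_of (𝒬.eq (Sum.inl a) (Sum.inr ()))
  | func f ts ih =>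
    have h := ex_of (𝒬.reindex (Fin.cons (Sum.inr ()) Sum.inl : Fin _ → Fin _ ⊕ Unit) (h𝒬.func f))
    exact Ex.terms ih h

/-- Naming the values of terms costs existential quantifiers, so the resulting class is not
evidently closed under negation. The formula and its negation are therefore treated together. -/
theorem Interprets.qf [Nonempty M] (h𝒬 : 𝒬.Interprets L) {n : ℕ} {θ : L.BoundedFormula α n}
    (h : θ.IsQF) : (𝒬.Ex fun w : α ⊕ Fin n → M => θ.Realize (w ∘ Sum.inl) (w ∘ Sum.inr)) ∧
      𝒬.Ex fun w : α ⊕ Fin n → M => ¬ θ.Realize (w ∘ Sum.inl) (w ∘ Sum.inr) := by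
  have key : ∀ {k : ℕ} (ts : Fin k → L.Term (α ⊕ Fin n)) {P : (Fin k → M) → Prop}, 𝒬.Q P →
      𝒬.Ex fun w : α ⊕ Fin n → M => P fun i => (ts i).realize w := by
    intro k ts P hP
    have h := (Ex.terms (β := Empty) (fun i => h𝒬.term (ts i)) (ex_of (𝒬.reindex Sum.inl hP)))
    exact h.reindex (Sum.elim id Empty.elim)
  induction h with
  | falsum =>
    refine ⟨ex_of 𝒬.bot, ?_⟩
    exact ex_of (𝒬.not 𝒬.bot)
  | of_isAtomic h =>
    cases h with
    | equal t₁ t₂ =>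
      have h1 := key ![t₁, t₂] (𝒬.eq 0 1)
      have h2 := key ![t₁, t₂] (𝒬.not (𝒬.eq 0 1))
      simp only [BoundedFormula.realize_bdEqual, Sum.elim_comp_inl_inr]
      exact ⟨h1, h2⟩
    | rel r ts =>
      have h1 := key ts (h𝒬.rel r)
      have h2 := key ts (𝒬.not (h𝒬.rel r))
      simp only [BoundedFormula.realize_rel, Sum.elim_comp_inl_inr]
      exact ⟨h1, h2⟩
  | imp _ _ ih₁ ih₂ =>
    refine ⟨?_, ?_⟩
    · simpa only [BoundedFormula.realize_imp, imp_iff_not_or] using ih₁.2.or ih₂.1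
    · simpa only [BoundedFormula.realize_imp, Classical.not_imp] using ih₁.1.and ih₂.2

theorem Interprets.existential [Nonempty M] (h𝒬 : 𝒬.Interprets L) {n : ℕ}
    {θ : L.BoundedFormula α n} (h : θ.IsExistential) :
    𝒬.Ex fun w : α ⊕ Fin n → M => θ.Realize (w ∘ Sum.inl) (w ∘ Sum.inr) := by
  induction h with
  | of_isQF h => exact (h𝒬.qf h).1
  | @ex n θ _ ih =>
    have h := (ih.reindex (Sum.elim (Sum.inl ∘ Sum.inl) (Fin.snoc (α := fun _ => (α ⊕ Fin n) ⊕ Unit)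
      (Sum.inl ∘ Sum.inr) (Sum.inr ())))).ex
    convert h using 2 with w
    rw [BoundedFormula.realize_ex]
    refine ⟨fun ⟨y, hy⟩ => ⟨fun _ => y, ?_⟩, fun ⟨ys, hy⟩ => ⟨ys (), ?_⟩⟩
    · convert hy using 1
      · funext i
        rfl
      · funext i
        refine Fin.lastCases ?_ (fun i => ?_) i <;> simp
    · convert hy using 1
      · funext i
        rfl
      · funext i
        refine Fin.lastCases ?_ (fun i => ?_) i <;> simp

theorem Interprets.formula [Nonempty M] (h𝒬 : 𝒬.Interprets L) {θ : L.Formula α}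
    (h : BoundedFormula.IsExistential θ) : 𝒬.Ex fun w : α → M => θ.Realize w := by
  have := (h𝒬.existential h).reindex (Sum.elim id Fin.elim0)
  convert this using 2 with w
  rw [Formula.Realize]
  exact iff_of_eq (congrArg (BoundedFormula.Realize θ w) (Subsingleton.elim _ _))

end BoolClass

end Elimination

end AMCSpectrum

namespace AMCSpectrum

/-! ## Replacement for existential formulas -/

section Expand

variable {A : Set (Form LSet × Fin 2)} {R : LSet.Theory}

theorem model_of_expand {M : Type u} [LSet.Structure M] [(morley LSet A).Structure M]
    [(incl A).IsExpansionOn M] (h : M ⊨ expand R A) : M ⊨ R ∧ M ⊨ setMorleyTheory A :=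
  ⟨(LHom.onTheory_model (incl A) R).1 (h.mono Set.subset_union_left), h.mono Set.subset_union_right⟩

theorem model_zfc (hR : ∀ σ ∈ ZFC, R ⊨ᵇ σ) {M : Type u} [LSet.Structure M] [Nonempty M]
    (h : M ⊨ R) : M ⊨ ZFC :=
  ⟨fun σ hσ => (hR σ hσ).realize_sentence M⟩

variable {M : Type u} [LSet.Structure M] [(morley LSet A).Structure M] [(incl A).IsExpansionOn M]

theorem relMap_base {n : ℕ} (r : LSet.Relations n) (v : Fin n → M) :
    Structure.RelMap (L := morley LSet A) (MorleyRelations.base r) v ↔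
      Structure.RelMap (L := LSet) r v :=
  iff_of_eq (LHom.map_onRelation (incl A) r v)

variable [ZF M]

theorem exists_graph_funSymb (hT : M ⊨ setMorleyTheory A) {n : ℕ} {φ : LSet.Formula (Fin (n + 1))}
    (h : ((⟨n, φ⟩ : Form LSet), (1 : Fin 2)) ∈ A)
    (h' : ((⟨n, φ⟩ : Form LSet), (1 : Fin 2)) ∈ deltaZero) :
    ∃ ψ : LSet.Formula (Fin (n + 1)), IsDeltaZero ψ ∧ ∀ v : Fin (n + 1) → M,
      Structure.funMap (L := morley LSet A) (MorleyFunctions.funSymb φ h) (fun i => v i.succ) = v 0 ↔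
        ψ.Realize v := by
  obtain ⟨⟨ψ, hψ, hr⟩, hf⟩ := deltaZero_one (M := M) h'
  refine ⟨ψ, hψ, fun v => ?_⟩
  obtain ⟨z, hz, -⟩ := hf fun i => v i.succ
  rw [funMap_funSymb hT h _ hz, eq_comm, ← hz, Formula.Realize, hr]
  exact iff_of_eq (congrArg₂ _ (Fin.cons_self_tail v) rfl)

theorem exists_graph_default (hT : M ⊨ setMorleyTheory A)
    (h : ∃ φ : Form LSet, (φ, (1 : Fin 2)) ∈ A) :
    ∃ ψ : LSet.Formula (Fin 1), IsDeltaZero ψ ∧ ∀ v : Fin 1 → M,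
      Structure.funMap (L := morley LSet A) (MorleyFunctions.default h) (fun i => v i.succ) = v 0 ↔
        ψ.Realize v := by
  obtain ⟨ψ, hψ, hr⟩ := (D0.nonemptyF.{u} (α := Fin 1) (n := 0) (Sum.inl 0)).not
  refine ⟨ψ, hψ, fun v => ?_⟩
  rw [← defaultConst_eq hT, Formula.Realize, ← hr, BoundedFormula.realize_not, realize_nonemptyF]
  rfl

/-- The predicates defined by `Δ₀`-formulas. -/
def deltaClass (M : Type u) [LSet.Structure M] : BoolClass M where
  Q P := ∃ φ, IsDeltaZero φ ∧ ∀ v, P v ↔ Formula.Realize φ v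
  bot := ⟨⊥, .falsum, fun _ => Iff.rfl⟩
  imp := by
    rintro α P P' ⟨φ, h, hφ⟩ ⟨ψ, h', hψ⟩
    exact ⟨φ ⟹ ψ, h.imp h', fun v => (imp_congr (hφ v) (hψ v)).trans Formula.realize_imp.symm⟩
  reindex := by
    rintro α β P s ⟨φ, h, hφ⟩
    obtain ⟨ψ, h', hψ⟩ := h.exists_relabel.{u} s
    exact ⟨ψ, h', fun v => (hφ _).trans (hψ M v).symm⟩
  eq a b := ⟨_, .eq (Sum.inl a) (Sum.inl b), fun v =>
    (realize_eqF (v := v) (xs := default) (Sum.inl a) (Sum.inl b)).symm⟩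

theorem deltaClass_mem {M : Type u} [LSet.Structure M] {α : Type} (a b : α) : (deltaClass M).Q fun v : α → M => v a ∊ v b :=
  ⟨_, .mem (Sum.inl a) (Sum.inl b), fun v =>
    (realize_mem (v := v) (xs := default) (Sum.inl a) (Sum.inl b)).symm⟩

theorem deltaClass_rel {M : Type u} [LSet.Structure M] {n : ℕ} (r : LSet.Relations n) :
    (deltaClass M).Q fun v : Fin n → M => Structure.RelMap r v := by
  cases r
  convert deltaClass_mem (M := M) (0 : Fin 2) 1 using 2 with v
  refine iff_of_eq (congrArg _ ?_)
  funext i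
  fin_cases i <;> rfl

theorem deltaClass_interprets (hA : deltaZero ⊆ A) (hT : M ⊨ setMorleyTheory A)
    [(morley LSet deltaZero).Structure M] [(morleyMono hA).IsExpansionOn M] :
    (deltaClass M).Interprets (morley LSet deltaZero) := by
  refine ⟨fun {n} r => ?_, fun {n} f => ?_⟩
  · simp only [← LHom.map_onRelation (morleyMono hA)]
    cases r with
    | base r =>
      convert deltaClass_rel (M := M) r using 2 with v
      exact relMap_base r v
    | relSymb φ h => exact ⟨φ, deltaZero_zero.1 h, relMap_relSymb hT (hA h)⟩
  · simp only [← LHom.map_onFunction (morleyMono hA)]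
    cases f with
    | base f => exact f.elim
    | funSymb φ h => exact exists_graph_funSymb hT (hA h) h
    | default h => exact exists_graph_default hT _

end Expand

/-! ### Collecting witnesses in a single set -/

section Replacement

variable {K : Type u} [LSet.Structure K]

/-- Bounding a block of existential quantifiers by one variable `d` leaves a Δ₀-formula, which is
monotone in the set assigned to `d`. -/
theorem exists_bounded_exs {γ : Type} (d : γ) : ∀ {m : ℕ} {φ : LSet.BoundedFormula γ m},
    IsDeltaZero φ → ∃ ψ : LSet.Formula γ, IsDeltaZero ψ ∧ ∀ v : γ → K,
      ψ.Realize v ↔ ∃ ys : Fin m → K, (∀ i, ys i ∊ v d) ∧ φ.Realize v ys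
  | 0, φ, h => ⟨φ, h, fun v => ⟨fun h => ⟨default, Fin.rec0, h⟩, fun ⟨ys, _, h⟩ => by
      rwa [Subsingleton.elim ys default] at h⟩⟩
  | m + 1, φ, h => by
    obtain ⟨ψ, h', hψ⟩ := exists_bounded_exs d (h.bex (Sum.inl d))
    refine ⟨ψ, h', fun v => ?_⟩
    simp only [hψ, realize_exF, BoundedFormula.realize_inf, realize_mem, elim_up, elim_last,
      Sum.elim_inl]
    constructor
    · rintro ⟨ys, hys, y, hy, hφ⟩
      refine ⟨Fin.snoc ys y, fun i => ?_, hφ⟩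
      refine Fin.lastCases ?_ (fun i => ?_) i
      · rwa [Fin.snoc_last]
      · rw [Fin.snoc_castSucc]
        exact hys i
    · rintro ⟨ys, hys, hφ⟩
      refine ⟨Fin.init ys, fun i => hys _, ys (Fin.last m), hys _, ?_⟩
      rwa [Fin.snoc_init_self]

variable [ZF K]

theorem exists_finite_set : ∀ {m : ℕ} (ys : Fin m → K), ∃ D, ∀ i, ys i ∊ D
  | 0, _ => ⟨emp, Fin.rec0⟩
  | m + 1, ys => by
    obtain ⟨D, hD⟩ := exists_finite_set fun i : Fin m => ys i.succ
    refine ⟨cup (upair (ys 0) (ys 0)) D, fun i => ?_⟩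
    refine Fin.cases ?_ (fun i => ?_) i
    · simp
    · simp [hD i]

/-- Replacement for formulas `∃ D, χ` with `χ` monotone in `D`. -/
theorem exists_collect {χ : LSet.Formula (Fin 3)}
    (hmono : ∀ x y D D' : K, (∀ z, z ∊ D → z ∊ D') → χ.Realize ![x, y, D] → χ.Realize ![x, y, D'])
    (X : K) (hX : ∀ x, x ∊ X → ∃ y D, χ.Realize ![x, y, D]) :
    ∃ f D, FunOnS f X ∧ ∀ x, x ∊ X → ∃ y, y ∊ D ∧ PairInS f x y ∧ χ.Realize ![x, y, D] := by
  have hd : ∀ {Γ : Type u} [Ctx K Γ] (x y D : Γ → K) [DF x] [DF y] [DF D],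
      Dfn K fun γ => χ.Realize ![x γ, y γ, D γ] := by
    intro Γ _ x y D _ _ _
    have := Dfn.realize (M := K) χ ![x, y, D] Fin.elim0
      (fun i => by fin_cases i <;> assumption) (fun i => i.elim0)
    refine this.congr fun γ => ?_
    refine iff_of_eq (congrArg₂ (BoundedFormula.Realize χ) ?_ (Subsingleton.elim _ _))
    funext i
    fin_cases i <;> rfl
  have h1 : Dfn₂ fun x D : K => ∃ y, y ∊ D ∧ χ.Realize ![x, y, D] := by
    have := hd (Γ := ((PUnit.{u + 1} × K) × K) × K) (fun p => p.1.1.2) (fun p => p.2) (fun p => p.1.2)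
    infer_instance
  obtain ⟨F, hF, hF'⟩ := ZF.repl (fun x D : K => ∃ y, y ∊ D ∧ χ.Realize ![x, y, D]) X fun x hx => by
    obtain ⟨y, D, h⟩ := hX x hx
    refine ⟨cup D (upair y y), y, by simp, hmono x y D _ (fun z hz => ?_) h⟩
    simp [hz]
  -- The values of `F` lie in `⋃⋃F`, so `D` includes each of them. By monotonicity this single `D`
  -- serves all `x`, and a second replacement selects `y` in it.
  let D := sUn (sUn (sUn F))
  have hD : ∀ x, x ∊ X → ∃ y, y ∊ D ∧ χ.Realize ![x, y, D] := by
    intro x hx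
    obtain ⟨d, hd⟩ := hF.2 x hx
    have hxd := (hd d).2 rfl
    obtain ⟨y, hy, h⟩ := hF' x d hxd
    have hsub : ∀ z, z ∊ d → z ∊ D := fun z hz =>
      mem_sUn.2 ⟨d, (mem_sUn_sUn_of_op (pairInS_iff.1 hxd)).2, hz⟩
    exact ⟨y, hsub y hy, hmono x y d D hsub h⟩
  have h2 : Dfn₂ fun x y : K => y ∊ D ∧ χ.Realize ![x, y, D] := by
    have := hd (Γ := (PUnit.{u + 1} × K) × K) (fun p => p.1.2) (fun p => p.2) (fun p => D)
    infer_instance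
  obtain ⟨f, hf, hf'⟩ := ZF.repl (fun x y : K => y ∊ D ∧ χ.Realize ![x, y, D]) X hD
  refine ⟨f, D, hf, fun x hx => ?_⟩
  obtain ⟨y, hy⟩ := hf.2 x hx
  have hxy := (hy y).2 rfl
  exact ⟨y, (hf' x y hxy).1, hxy, (hf' x y hxy).2⟩

end Replacement

end AMCSpectrum

namespace AMCSpectrum

/-! ## Axioms that hold in the model companion -/

section PartOne

theorem isExistential_onBoundedFormula {L L' : FirstOrder.Language.{0, 0}} (g : L →ᴸ L') {α : Type}
    {n : ℕ} {φ : L.BoundedFormula α n} (h : φ.IsExistential) :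
    (g.onBoundedFormula φ).IsExistential := by
  have hqf : ∀ {n : ℕ} {φ : L.BoundedFormula α n}, φ.IsQF → (g.onBoundedFormula φ).IsQF := by
    intro n φ h
    induction h with
    | falsum => exact .falsum
    | of_isAtomic h =>
      cases h with
      | equal t₁ t₂ => exact (BoundedFormula.IsAtomic.equal _ _).isQF
      | rel r ts => exact (BoundedFormula.IsAtomic.rel _ _).isQF
    | imp _ _ ih₁ ih₂ => exact ih₁.imp ih₂
  induction h with
  | of_isQF h => exact (hqf h).isExistential
  | ex _ ih => exact ih.ex

/-! ### Reflecting axioms along a Δ₀-embedding -/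

section Transfer

variable {M K : Type u} [LSet.Structure M] [LSet.Structure K] {j : M → K}

theorem DeltaEmb.foundation (h : DeltaEmb j) [ZF K] : M ⊨ foundation := by
  simp only [Sentence.Realize, Formula.Realize, AMCSpectrum.foundation, realize_allF,
    BoundedFormula.realize_imp, realize_nonemptyF, elim_last, realize_exF,
    BoundedFormula.realize_inf, realize_mem, elim_up, BoundedFormula.realize_not]
  rintro x ⟨y, hy⟩
  obtain ⟨z, hz⟩ := ZF.found (j x) ⟨j y, (h.mem_iff _ _).2 hy⟩
  obtain ⟨z, hz⟩ := h.witness_one_d0 (m := 1) (χ := mem (Sum.inl (Sum.inr 0)) (Sum.inl (Sum.inl 0)) ⊓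
    ∼(exF fun z => mem z (Sum.inl (Sum.inl 0))↟ ⊓ mem z (Sum.inl (Sum.inr 0))↟))
    ((D0.mem _ _).inf (D0.not (D0.bex _ (f := fun z => mem z (Sum.inl (Sum.inr 0))↟) (D0.mem _ _))))
    ![x] ⟨z, by
      simp only [Formula.Realize, BoundedFormula.realize_inf, realize_mem,
        BoundedFormula.realize_not, realize_exF, elim_up, elim_last]
      exact hz⟩
  simp only [Formula.Realize, BoundedFormula.realize_inf, realize_mem,
    BoundedFormula.realize_not, realize_exF, elim_up, elim_last] at hz
  exact ⟨z, hz⟩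

theorem DeltaEmb.choice (h : DeltaEmb j) [ZF K] (hK : K ⊨ choice) : M ⊨ choice := by
  simp only [Sentence.Realize, Formula.Realize, AMCSpectrum.choice, realize_allF,
    BoundedFormula.realize_imp, realize_nonemptyF, elim_last, realize_exF,
    BoundedFormula.realize_inf, realize_mem, elim_up, realize_isFunOn, realize_pairIn] at hK ⊢
  intro x hx
  have hx' := (h.absolute_d0 (φ := (allF fun y => mem y (Sum.inl 0)↟ ⟹ nonemptyF y :
    LSet.Formula (Fin 1))) (D0.ball _ (f := fun y => nonemptyF y) (D0.nonemptyF _)) ![x]).1 (by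
      simp only [Formula.Realize, realize_allF, BoundedFormula.realize_imp, realize_mem,
        realize_nonemptyF, elim_up, elim_last]
      exact hx)
  simp only [Formula.Realize, realize_allF, BoundedFormula.realize_imp, realize_mem,
    realize_nonemptyF, elim_up, elim_last] at hx'
  obtain ⟨f, hf⟩ := hK (j x) hx'
  obtain ⟨f, hf⟩ := h.witness_one_d0 (m := 1) (χ := isFunOn (Sum.inl (Sum.inr 0)) (Sum.inl (Sum.inl 0)) ⊓
    allF fun y => mem y (Sum.inl (Sum.inl 0))↟ ⟹ exF fun z => mem z y↟ ⊓
      pairIn (Sum.inl (Sum.inr 0))↟↟ y↟ z)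
    ((D0.isFunOn _ _).inf (D0.ball _ (f := fun y => exF fun z => mem z y↟ ⊓
      pairIn (Sum.inl (Sum.inr 0))↟↟ y↟ z) (D0.bex _ (D0.pairIn _ _ _)))) ![x] ⟨f, by
      simp only [Formula.Realize, BoundedFormula.realize_inf, realize_mem, realize_allF,
        BoundedFormula.realize_imp, realize_isFunOn, realize_pairIn, realize_exF, elim_up, elim_last]
      exact hf⟩
  simp only [Formula.Realize, BoundedFormula.realize_inf, realize_mem, realize_allF,
    BoundedFormula.realize_imp, realize_isFunOn, realize_pairIn, realize_exF, elim_up,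
    elim_last] at hf
  exact ⟨f, hf⟩

theorem DeltaEmb.closedBinary (h : DeltaEmb j) [ZF K] (i : Fin 5) : M ⊨ closedBinary i := by
  simp only [Sentence.Realize, Formula.Realize, AMCSpectrum.closedBinary, realize_allF, realize_exF,
    realize_plug]
  intro x y
  obtain ⟨z, hz, -⟩ := goedelBinary_total i (j x) (j y)
  have e : ∀ {N : Type u} (x y z : N), (fun i => Sum.elim (Sum.elim ![x, y] fun _ : Fin 1 => z)
      (default : Fin 0 → N) (![Sum.inl (Sum.inr 0), Sum.inl (Sum.inl 0), Sum.inl (Sum.inl 1)] i)) =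
        ![z, x, y] := by
    intro N x y z
    funext i
    fin_cases i <;> rfl
  have e' : j ∘ ![x, y] = ![j x, j y] := by
    funext i
    fin_cases i <;> rfl
  obtain ⟨z, hz⟩ := h.witness_one_d0 (m := 2) ((D0.goedelBinary i).plug
    ![Sum.inl (Sum.inr 0), Sum.inl (Sum.inl 0), Sum.inl (Sum.inl 1)]) ![x, y]
    ⟨z, by rw [Formula.Realize, realize_plug, e', e, hz]⟩
  refine ⟨z, ?_⟩
  rw [Formula.Realize, realize_plug, e] at hz
  refine (iff_of_eq (congrArg (fun v => BoundedFormula.Realize (goedelBinary i) v default) ?_)).2 hz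
  funext i
  fin_cases i <;> rfl

theorem DeltaEmb.closedUnary (h : DeltaEmb j) [ZF K] (i : Fin 5) : M ⊨ closedUnary i := by
  simp only [Sentence.Realize, Formula.Realize, AMCSpectrum.closedUnary, realize_allF, realize_exF,
    realize_plug]
  intro x
  obtain ⟨z, hz, -⟩ := goedelUnary_total i (j x)
  have e : ∀ {N : Type u} (x z : N), (fun i => Sum.elim (Sum.elim ![x] fun _ : Fin 1 => z)
      (default : Fin 0 → N) (![Sum.inl (Sum.inr 0), Sum.inl (Sum.inl 0)] i)) = ![z, x] := by
    intro N x z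
    funext i
    fin_cases i <;> rfl
  have e' : j ∘ ![x] = ![j x] := by
    funext i
    fin_cases i
    rfl
  obtain ⟨z, hz⟩ := h.witness_one_d0 (m := 1) ((D0.goedelUnary i).plug
    ![Sum.inl (Sum.inr 0), Sum.inl (Sum.inl 0)]) ![x]
    ⟨z, by rw [Formula.Realize, realize_plug, e', e, hz]⟩
  refine ⟨z, ?_⟩
  rw [Formula.Realize, realize_plug, e] at hz
  refine (iff_of_eq (congrArg (fun v => BoundedFormula.Realize (goedelUnary i) v default) ?_)).2 hz
  funext i
  fin_cases i <;> rfl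

/-- Replacement transfers to `M` for predicates that are `∃ Δ₀` in `K`. -/
theorem DeltaEmb.replacement (h : DeltaEmb j) [ZF K] {Ψ : K → K → Prop}
    (hΨ : (deltaClass K).Ex fun v : Fin 2 → K => Ψ (v 0) (v 1)) (htot : ∀ x, ∃ y, Ψ x y) (X : M) :
    ∃ f, FunOnS f X ∧ ∀ x y, PairInS f x y → Ψ (j x) (j y) := by
  have := h.ep
  obtain ⟨β, _, P, ⟨φ, hφ, hr⟩, hP⟩ := hΨ
  obtain ⟨m, ⟨e⟩⟩ := Finite.exists_equiv_fin β
  -- The existential witnesses become quantified variables to be bounded by a third free variable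
  -- `D`, besides `x` and `y`.
  obtain ⟨φ', hφ', hr'⟩ := hφ.exists_subst.{u} (β := Fin 3) (m := m)
    (Sum.elim (Sum.elim (fun i => Sum.inl i.castSucc) fun b => Sum.inr (e b)) Fin.elim0)
  obtain ⟨χ, hχ, hrχ⟩ := exists_bounded_exs (K := K) (2 : Fin 3) hφ'
  have key : ∀ x y D : K, χ.Realize ![x, y, D] ↔ ∃ ys : β → K, (∀ b, ys b ∊ D) ∧
      P (Sum.elim ![x, y] ys) := by
    intro x y D
    rw [hrχ]
    have aux : ∀ zs : Fin m → K, φ'.Realize ![x, y, D] zs ↔ P (Sum.elim ![x, y] (zs ∘ e)) := by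
      intro zs
      rw [hr', hr]
      refine iff_of_eq (congrArg₂ (BoundedFormula.Realize φ) ?_ (Subsingleton.elim _ _))
      funext a
      rcases a with a | a
      · fin_cases a <;> rfl
      · rfl
    simp only [aux]
    constructor
    · rintro ⟨zs, hzs, hP⟩
      exact ⟨zs ∘ e, fun b => hzs _, hP⟩
    · rintro ⟨ys, hys, hP⟩
      refine ⟨ys ∘ e.symm, fun i => hys _, ?_⟩
      rwa [Function.comp_assoc, Equiv.symm_comp_self, Function.comp_id]
  have hΨχ : ∀ x y D : K, χ.Realize ![x, y, D] → Ψ x y := by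
    intro x y D hχ
    obtain ⟨ys, -, h⟩ := (key x y D).1 hχ
    exact (hP ![x, y]).2 ⟨ys, h⟩
  obtain ⟨f, D, hf, hfD⟩ := exists_collect (χ := χ) (fun x y D D' hD h => by
      obtain ⟨ys, hys, h⟩ := (key x y D).1 h
      exact (key x y D').2 ⟨ys, fun b => hD _ (hys b), h⟩) (j X) (fun x _ => by
      obtain ⟨y, hy⟩ := htot x
      obtain ⟨ys, hys⟩ := (hP ![x, y]).1 hy
      obtain ⟨D, hD⟩ := exists_finite_set (ys ∘ e.symm)
      exact ⟨y, D, (key x y D).2 ⟨ys, fun b => by simpa using hD (e b), hys⟩⟩)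
  let X' : (Fin 1 ⊕ Fin 2) ⊕ Fin 0 := Sum.inl (Sum.inl 0)
  let f' : (Fin 1 ⊕ Fin 2) ⊕ Fin 0 := Sum.inl (Sum.inr 0)
  let D' : (Fin 1 ⊕ Fin 2) ⊕ Fin 0 := Sum.inl (Sum.inr 1)
  -- `θ` says, with parameter `X`, that `f` is a function on `X` and `D` bounds its values and their
  -- witnesses. It is Δ₀, so the pair `f, D` found in `K` can be replaced by one from `M`.
  let θ : LSet.Formula (Fin 1 ⊕ Fin 2) := isFunOn f' X' ⊓
    allF fun x => mem x X'↟ ⟹ exF fun y => mem y D'↟↟ ⊓ (pairIn f'↟↟ x↟ y ⊓ plug χ ![x↟, y, D'↟↟])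
  have hθ : D0.{u} θ := (D0.isFunOn _ _).inf (D0.ball _ (f := fun x => exF fun y => mem y D'↟↟ ⊓
    (pairIn f'↟↟ x↟ y ⊓ plug χ ![x↟, y, D'↟↟])) (D0.bex _ ((D0.pairIn _ _ _).inf (hχ.d0.plug _))))
  have hvec : ∀ {k : ℕ} (v : Fin 1 ⊕ Fin 2 → K) (xs : Fin k → K) (a b c : (Fin 1 ⊕ Fin 2) ⊕ Fin k),
      (fun i => Sum.elim v xs (![a, b, c] i)) = ![Sum.elim v xs a, Sum.elim v xs b, Sum.elim v xs c] := by
    intro k v xs a b c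
    funext i
    fin_cases i <;> rfl
  have hθr : ∀ v : Fin 1 ⊕ Fin 2 → K, θ.Realize v ↔ FunOnS (v (Sum.inr 0)) (v (Sum.inl 0)) ∧
      ∀ x, x ∊ v (Sum.inl 0) → ∃ y, y ∊ v (Sum.inr 1) ∧ PairInS (v (Sum.inr 0)) x y ∧
        χ.Realize ![x, y, v (Sum.inr 1)] := by
    intro v
    simp only [θ, Formula.Realize, BoundedFormula.realize_inf, realize_isFunOn, realize_allF,
      BoundedFormula.realize_imp, realize_mem, realize_exF, realize_pairIn, realize_plug, hvec,
      elim_up, elim_last]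
    exact Iff.rfl
  obtain ⟨θ', hθ', hrθ⟩ := hθ
  obtain ⟨ys, hys⟩ := h.witness 1 1 θ' hθ' ![X] ⟨![f, D], (hrθ K _ default).1 ((hθr _).2 ⟨hf, hfD⟩)⟩
  have hys := (hθr _).1 ((hrθ K _ default).2 hys)
  change FunOnS (j (ys 0)) (j X) ∧ ∀ x, x ∊ j X → ∃ y, y ∊ j (ys 1) ∧ PairInS (j (ys 0)) x y ∧
    χ.Realize ![x, y, j (ys 1)] at hys
  refine ⟨ys 0, ?_, fun x y hxy => ?_⟩
  · have := (h.absolute_d0 (D0.isFunOn.{u} (α := Fin 2) (n := 0) (Sum.inl 0) (Sum.inl 1)) ![ys 0, X]).2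
      ((realize_isFunOn _ _).2 hys.1)
    exact (realize_isFunOn _ _).1 this
  · have hxy' : PairInS (j (ys 0)) (j x) (j y) := (realize_pairIn _ _ _).1
      ((h.absolute_d0 (D0.pairIn.{u} (α := Fin 3) (n := 0) (Sum.inl 0) (Sum.inl 1) (Sum.inl 2))
        ![ys 0, x, y]).1 ((realize_pairIn _ _ _).2 hxy))
    have hx : j x ∊ j X := by
      obtain ⟨p, hp, hpf⟩ := hxy'
      obtain ⟨a, b, ha, hab⟩ := hys.1.1 p hpf
      rw [pairS_iff] at hp hab
      rw [(op_inj.1 (hp.symm.trans hab)).1]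
      exact ha
    -- The value provided by `θ` equals `j y`, since `j (ys 0)` is a function.
    obtain ⟨y', -, hy', hχ'⟩ := hys.2 _ hx
    obtain ⟨b, hb⟩ := hys.1.2 _ hx
    rw [(hb _).1 hxy', ← (hb _).1 hy']
    exact hΨχ _ _ _ hχ'

end Transfer

variable {R : LSet.Theory} {A : Set (Form LSet × Fin 2)}

theorem deltaInterp_of_model {K : Type u} [LSet.Structure K] [(morley LSet A).Structure K]
    [(incl A).IsExpansionOn K] (hK : K ⊨ setMorleyTheory A) : DeltaInterp A K :=
  fun _ _ h _ v => relMap_relSymb hK h v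

theorem realize_extensionality {M : Type u} [LSet.Structure M] [EP M] : M ⊨ extensionality := by
  simp only [Sentence.Realize, Formula.Realize, extensionality, realize_allF,
    BoundedFormula.realize_imp, BoundedFormula.realize_iff, realize_mem, realize_eqF, elim_up,
    elim_last]
  exact EP.ext

/-- `M` embeds Σ₁-elementarily into a model `K` of `R + T_{∈,A}`, hence of ZFC, and each axiom
reflects from `K`. -/
theorem modelCompanion_realize (hR : ∀ σ ∈ ZFC, R ⊨ᵇ σ) (hA : deltaZero ⊆ A)
    {S : (morley LSet A).Theory} (hS : IsModelCompanion.{u} S (expand R A))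
    (M : Type u) [(morley LSet A).Structure M] [Nonempty M] (hM : M ⊨ S) :
    M ⊨ (incl A).onSentence extensionality ∧
    M ⊨ (incl A).onSentence foundation ∧
    M ⊨ (incl A).onSentence choice ∧
    (∀ i, M ⊨ (incl A).onSentence (closedBinary i)) ∧
    (∀ i, M ⊨ (incl A).onSentence (closedUnary i)) ∧
    ∀ ψ : (morley LSet deltaZero).Formula (Fin 2), BoundedFormula.IsExistential ψ →
      (expand R A ⊨ᵇ (allF fun x => exF fun y =>
        plug ((morleyMono hA).onFormula ψ) ![x↟, y] : (morley LSet A).Sentence)) →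
      M ⊨ replacement (incl A) (n := 0) ((morleyMono hA).onFormula ψ) := by
  obtain ⟨K, _, _, j, hK, hj⟩ := hS.exists_embedding M hM
  let _ : LSet.Structure M := (incl A).reduct M
  have : (incl A).IsExpansionOn M := LHom.isExpansionOn_reduct _ _
  let _ : LSet.Structure K := (incl A).reduct K
  have : (incl A).IsExpansionOn K := LHom.isExpansionOn_reduct _ _
  let _ : (morley LSet deltaZero).Structure K := (morleyMono hA).reduct K
  have : (morleyMono hA).IsExpansionOn K := LHom.isExpansionOn_reduct _ _
  let _ : (morley LSet deltaZero).Structure M := (morleyMono hA).reduct M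
  have : (morleyMono hA).IsExpansionOn M := LHom.isExpansionOn_reduct _ _
  obtain ⟨hKR, hKT⟩ := model_of_expand hK
  have hZ := model_zfc hR hKR
  have := ZF.of_model hZ
  have h := DeltaEmb.of_embedding hA (deltaInterp_of_model hKT) j hj
  have := h.ep
  simp only [LHom.realize_onSentence]
  refine ⟨realize_extensionality, h.foundation,
    h.choice (hZ.realize_of_mem _ (by simp [ZFC])), h.closedBinary, h.closedUnary,
    fun ψ hψ htot => ?_⟩
  have e : ∀ {N : Type u} (v : Fin 2 → N), v = ![v 0, v 1] := by
    intro N v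
    funext i
    fin_cases i <;> rfl
  have htot' : ∀ x : K, ∃ y : K, ψ.Realize ![x, y] := by
    have := htot.realize_sentence K
    simp only [Sentence.Realize, Formula.Realize, realize_allF, realize_exF, realize_plug]
      at this
    intro x
    obtain ⟨y, hy⟩ := this x
    refine ⟨y, ?_⟩
    rw [e (fun i => _)] at hy
    exact ((LHom.realize_onFormula (morleyMono hA) ψ).1 hy)
  have hΨ : (deltaClass K).Ex fun v : Fin 2 → K => ψ.Realize ![v 0, v 1] := by
    have := (deltaClass_interprets hA hKT).formula hψ
    simpa only [← e] using this
  have hrep := h.replacement hΨ htot'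
  simp only [Sentence.Realize, replacement, BoundedFormula.realize_alls, realize_allF, realize_exF,
    BoundedFormula.realize_imp, BoundedFormula.realize_inf, LHom.realize_onBoundedFormula,
    realize_mem, realize_isFunOn, realize_pairIn, realize_plug, funcons_elim, elim_up, Sum.elim_inr,
    Fin.snoc_last, LHom.realize_onFormula]
  intro p X _
  obtain ⟨f, hf, hf'⟩ := hrep X
  refine ⟨f, hf, fun x y hxy => ?_⟩
  have h1 := (LHom.realize_onFormula (morleyMono hA) ψ).2 (hf' x y hxy)
  -- The reflected function has values with `ψ` true in `K`. As `ψ` is existential, Σ₁-elementarity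
  -- brings it down to `M`.
  have h2 := (hj 2 _ (isExistential_onBoundedFormula (morleyMono hA) hψ) ![x, y]).2 (by
    rw [e (j ∘ ![x, y])]
    exact h1)
  have h3 := (LHom.realize_onFormula (morleyMono hA) ψ).1 h2
  rw [e (Fin.cons _ _)]
  exact h3

end PartOne

end AMCSpectrum

namespace AMCSpectrum

/-! ## The structures `H_{λ⁺}` -/

section HPlus

/-- Consequence may be tested on models in the universe `u`, since lifting a structure changes none
of its sentences. -/
theorem models_iff {L : FirstOrder.Language.{0, 0}} {T : L.Theory} {σ : L.Sentence} :
    T ⊨ᵇ σ ↔ ∀ (M : Type u) [L.Structure M] [Nonempty M], M ⊨ T → M ⊨ σ := by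
  refine ⟨fun h M _ _ hM => h.realize_sentence M, fun h => ?_⟩
  rw [Theory.models_sentence_iff]
  intro M
  let _ : L.Structure (ULift.{u} M) := Equiv.ulift.symm.inducedStructure
  let e : M ≃[L] ULift.{u} M := Equiv.ulift.symm.inducedStructureEquiv
  have hM : ULift.{u} M ⊨ T := (StrongHomClass.theory_model e)
  exact (StrongHomClass.realize_sentence e σ).2 (h (ULift.{u} M) hM)

theorem realize_exUniqueF {L : FirstOrder.Language.{0, 0}} {M : Type u} [L.Structure M] {α : Type}
    {n k : ℕ} (φ : L.Formula (Fin (k + 1))) (g : Fin k → α ⊕ Fin n) (v : α → M) (xs : Fin n → M) :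
    (exUniqueF φ g).Realize v xs ↔ ∃ z, ∀ y,
      φ.Realize (Fin.cons y fun i => Sum.elim v xs (g i) : Fin (k + 1) → M) ↔ y = z := by
  simp only [exUniqueF, realize_exF, realize_allF, BoundedFormula.realize_iff, realize_plug,
    realize_eqF, funcons_elim, elim_up, Sum.elim_inr, Fin.snoc_last]

variable {R : LSet.Theory} {φ : LSet.Formula (Fin 1)}

theorem IsDefinableCardinal.exists_cardS (hφ : IsDefinableCardinal R φ) {M : Type u}
    [LSet.Structure M] [Nonempty M] (hM : M ⊨ R) :
    ∃ l, (∀ y : M, φ.Realize ![y] ↔ y = l) ∧ CardS l := by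
  have h1 := hφ.1.realize_sentence M
  have h2 := hφ.2.realize_sentence M
  rw [Sentence.Realize, Formula.Realize, realize_exUniqueF] at h1
  simp only [Sentence.Realize, Formula.Realize, realize_allF, BoundedFormula.realize_imp,
    realize_plug, realize_isCard, elim_last] at h2
  obtain ⟨l, hl⟩ := h1
  have hl' : ∀ y : M, φ.Realize ![y] ↔ y = l := fun y => by
    rw [← hl]
    refine iff_of_eq (congrArg _ ?_)
    funext i
    fin_cases i
    rfl
  refine ⟨l, hl', h2 l ?_⟩
  have := (hl' l).2 rfl
  rwa [Matrix.vec_single_eq_const] at this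

theorem IsDefinableInfiniteCardinal.exists_infCard (hφ : IsDefinableInfiniteCardinal R φ)
    {M : Type u} [LSet.Structure M] [ZF M] [Nonempty M] (hM : M ⊨ R) :
    ∃ l, (∀ y : M, φ.Realize ![y] ↔ y = l) ∧ InfCard l := by
  obtain ⟨l, hl, hc⟩ := hφ.1.exists_cardS hM
  have h := hφ.2.realize_sentence M
  simp only [Sentence.Realize, Formula.Realize, realize_allF, BoundedFormula.realize_imp,
    realize_plug, realize_isInfinite, elim_last] at h
  obtain ⟨w, hw, hwl⟩ := h l (by
    have := (hl l).2 rfl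
    rwa [Matrix.vec_single_eq_const] at this)
  rw [omegaS_iff] at hw
  exact ⟨l, hl, hc, by rwa [hw] at hwl⟩

variable {A : Set (Form LSet × Fin 2)}

theorem mem_hPlus {M : Type u} [LSet.Structure M] [ZF M] [(morley LSet A).Structure M]
    [(incl A).IsExpansionOn M] {l : M} (hl : ∀ y : M, φ.Realize ![y] ↔ y = l) (x : M) :
    x ∈ hPlus A φ M ↔ Hs l x := by
  simp only [hPlus, Set.mem_ofPred_eq, holds, LHom.realize_onFormula, hl]
  rw [exists_eq_left, ← inHPlusS_iff, Formula.Realize, realize_inHPlus]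
  rfl

theorem nonempty_of_deltaZero (hA : deltaZero ⊆ A) {M : Type u} [(morley LSet A).Structure M]
    (N : (morley LSet A).Substructure M) : Nonempty N :=
  ⟨⟨_, N.fun_mem (MorleyFunctions.default
    ⟨⟨0, isOmega (Sum.inl 0)⟩, hA (Or.inl (Or.inl (Or.inr rfl)))⟩) Fin.elim0 (fun i => i.elim0)⟩⟩

/-- Sentences that agree between the structures `H_{λ⁺}` and the models. -/
theorem hPlusTheory_models_iff (hA : deltaZero ⊆ A)
    (hex : ∀ (M : Type u) [(morley LSet A).Structure M] [Nonempty M], M ⊨ expand R A →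
      ∃ N : (morley LSet A).Substructure M, (N : Set M) = hPlus A φ M)
    {σ : (morley LSet A).Sentence}
    (hσ : ∀ (M : Type u) [(morley LSet A).Structure M] [Nonempty M], M ⊨ expand R A →
      ∀ N : (morley LSet A).Substructure M, (N : Set M) = hPlus A φ M → (N ⊨ σ ↔ M ⊨ σ)) :
    hPlusTheory.{u} R A φ ⊨ᵇ σ ↔ expand R A ⊨ᵇ σ := by
  constructor
  · intro h
    rw [models_iff.{u}]
    intro M _ _ hM
    obtain ⟨N, hN⟩ := hex M hM
    have := nonempty_of_deltaZero hA N
    have hN' : N ⊨ hPlusTheory.{u} R A φ := ⟨fun τ hτ => hτ M hM N hN⟩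
    exact (hσ M hM N hN).1 (h.realize_sentence N)
  · intro h
    refine Theory.models_sentence_of_mem fun M _ _ hM N hN => ?_
    exact (hσ M hM N hN).2 (h.realize_sentence M)

/-- The negation is put into existential form, and the variables are renamed along `s`, so that the
definition of Σ₁-elementarity, which speaks of variables in `Fin n`, applies to sentences. -/
theorem isUniversal_exists_not {L : FirstOrder.Language.{0, 0}} {α β : Type} (s : α → β) {n : ℕ}
    {σ : L.BoundedFormula α n} (h : σ.IsUniversal) : ∃ τ : L.BoundedFormula β n, τ.IsExistential ∧
      ∀ (M : Type u) [L.Structure M] (v : β → M) (xs : Fin n → M),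
        τ.Realize v xs ↔ ¬ σ.Realize (v ∘ s) xs := by
  have hqf : ∀ {n : ℕ} {σ : L.BoundedFormula α n}, σ.IsQF →
      (σ.subst fun a => (Term.var (s a) : L.Term β)).IsQF := by
    intro n σ h
    induction h with
    | falsum => exact .falsum
    | of_isAtomic h =>
      cases h with
      | equal t₁ t₂ => exact (BoundedFormula.IsAtomic.equal _ _).isQF
      | rel r ts => exact (BoundedFormula.IsAtomic.rel _ _).isQF
    | imp _ _ ih₁ ih₂ => exact ih₁.imp ih₂
  induction h with
  | of_isQF h =>
    refine ⟨_, (hqf h).not.isExistential, fun M _ v xs => ?_⟩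
    rw [BoundedFormula.realize_not, BoundedFormula.realize_subst]
    rfl
  | all _ ih =>
    obtain ⟨τ, hτ, h⟩ := ih
    exact ⟨_, hτ.ex, fun M _ v xs => by simp [h]⟩

theorem realize_universal_substructure {L : FirstOrder.Language.{0, 0}} {M : Type u} [L.Structure M]
    (N : L.Substructure M) {σ : L.Sentence} (hσ : BoundedFormula.IsUniversal σ) (h : M ⊨ σ) :
    N ⊨ σ := by
  refine BoundedFormula.IsUniversal.realize_embedding hσ N.subtype ?_
  rw [Subsingleton.elim (N.subtype ∘ default) default, Subsingleton.elim (N.subtype ∘ default) default]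
  exact h

theorem IsSigmaOneElementary.realize_universal {L : FirstOrder.Language.{0, 0}} {M : Type u}
    [L.Structure M] {N : L.Substructure M} (hN : IsSigmaOneElementary N) {σ : L.Sentence}
    (hσ : BoundedFormula.IsUniversal σ) : N ⊨ σ ↔ M ⊨ σ := by
  refine ⟨fun h => ?_, realize_universal_substructure N hσ⟩
  by_contra hM
  obtain ⟨τ, hτ, hr⟩ := isUniversal_exists_not.{u} (Empty.elim : Empty → Fin 0) hσ
  have hτM : Formula.Realize τ fun i => ((Fin.elim0 i : N) : M) := by
    rw [Formula.Realize, hr]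
    rwa [Subsingleton.elim (_ ∘ Empty.elim) default]
  have hτN := (hN 0 τ hτ Fin.elim0).2 hτM
  rw [Formula.Realize, hr, Subsingleton.elim (_ ∘ Empty.elim) default] at hτN
  exact hτN h

theorem DeltaEmb.deltaInterp {M K : Type u} [LSet.Structure M] [(morley LSet A).Structure M]
     [LSet.Structure K] [(morley LSet A).Structure K]
    {j : M ↪[morley LSet A] K} (h : DeltaEmb j) (hK : DeltaInterp A K) : DeltaInterp A M := by
  intro n ψ hmem hψ v
  rw [h.absolute_formula hψ, ← hK n ψ hmem hψ]
  exact (j.map_rel _ v).symm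

variable {M : Type u} [LSet.Structure M] [(morley LSet A).Structure M] [(incl A).IsExpansionOn M]

theorem realize_surjectiveImages (c : (morley LSet A).Constants) : M ⊨ surjectiveImages c ↔
    ∀ x : M, (∃ y, y ∊ x) → ∃ f, SurjS f (Structure.funMap c default : M) x := by
  simp only [Sentence.Realize, Formula.Realize, surjectiveImages, realize_allF,
    BoundedFormula.realize_imp, BoundedFormula.realize_bdEqual, Term.realize_var, Sum.elim_inr,
    Fin.snoc_last, LHom.realize_onBoundedFormula, realize_nonemptyF, realize_exF, realize_isSurj,
    elim_up, Term.realize_constants]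
  rw [forall_eq]
  rfl

theorem IsSigmaOneElementary.deltaEmb (hA : deltaZero ⊆ A) (hM : DeltaInterp A M)
    {N : (morley LSet A).Substructure M} (hN : IsSigmaOneElementary N) [LSet.Structure N]
    [(incl A).IsExpansionOn N] : DeltaEmb (Subtype.val : N → M) :=
  DeltaEmb.of_embedding hA hM N.subtype fun n φ hφ v => hN n φ hφ v

theorem modelCompanion_surjectiveImages (hR : ∀ σ ∈ ZFC, R ⊨ᵇ σ) (hA : deltaZero ⊆ A)
    {S : (morley LSet A).Theory} (hS : IsModelCompanion.{u} S (expand R A))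
    (hφ : IsDefinableCardinal R φ) (hφA : ((⟨0, φ⟩ : Form LSet), (1 : Fin 2)) ∈ A)
    (hH : ∀ (M : Type u) [(morley LSet A).Structure M] [Nonempty M], M ⊨ expand R A →
      ∃ N : (morley LSet A).Substructure M, (N : Set M) = hPlus A φ M ∧ IsSigmaOneElementary N) :
    S ⊨ᵇ surjectiveImages (MorleyFunctions.funSymb φ hφA) := by
  have hmodel : ∀ (M : Type u) [(morley LSet A).Structure M] [Nonempty M], M ⊨ expand R A →
      ∀ N : (morley LSet A).Substructure M, (N : Set M) = hPlus A φ M → IsSigmaOneElementary N := by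
    intro M _ _ hM N hN
    obtain ⟨N', hN', h⟩ := hH M hM
    rwa [SetLike.coe_injective (hN.trans hN'.symm)]
  -- Universal sentences agree between `H_{λ⁺}` and the ambient model, so `S` is also the model
  -- companion of the common theory of the structures `H_{λ⁺}`.
  have hc : IsModelCompanion.{u} S (hPlusTheory.{u} R A φ) := by
    refine ⟨hS.1.trans ?_, hS.2⟩
    ext σ
    refine and_congr_right fun hσ => (hPlusTheory_models_iff hA (fun M _ _ hM => ?_) ?_).symm
    · obtain ⟨N, hN, -⟩ := hH M hM
      exact ⟨N, hN⟩
    · exact fun M _ _ hM N hN => (hmodel M hM N hN).realize_universal hσ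
  have key : ∀ (M : Type u) [(morley LSet A).Structure M] [Nonempty M], M ⊨ expand R A →
      ∀ N : (morley LSet A).Substructure M, (N : Set M) = hPlus A φ M →
        ∃ (_ : LSet.Structure N) (_ : (incl A).IsExpansionOn N), EP N ∧ DeltaInterp A N ∧
          N ⊨ surjectiveImages (MorleyFunctions.funSymb φ hφA) := by
    intro M _ _ hM N hN
    let _ : LSet.Structure M := (incl A).reduct M
    have : (incl A).IsExpansionOn M := LHom.isExpansionOn_reduct _ _
    let _ : LSet.Structure N := (incl A).reduct N
    have : (incl A).IsExpansionOn N := LHom.isExpansionOn_reduct _ _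
    obtain ⟨hMR, hMT⟩ := model_of_expand hM
    have := ZF.of_model (model_zfc hR hMR)
    have hd := (hmodel M hM N hN).deltaEmb hA (deltaInterp_of_model hMT)
    refine ⟨inferInstance, inferInstance, hd.ep,
      DeltaEmb.deltaInterp (j := N.subtype) hd (deltaInterp_of_model hMT),
      (realize_surjectiveImages _).2 fun x ⟨y, hy⟩ => ?_⟩
    obtain ⟨l, hl, -⟩ := hφ.exists_cardS hMR
    have hx : Hs l (x : M) := (mem_hPlus hl (x : M)).1
      (by have := x.2; rwa [← SetLike.mem_coe, hN] at this)
    have hcl : ((Structure.funMap (L := morley LSet A) (MorleyFunctions.funSymb φ hφA)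
        (default : Fin 0 → N) : N) : M) = l := by
      refine (N.subtype.map_fun (n := 0) _ _).trans (funMap_funSymb hMT hφA _ fun y => ?_)
      rw [← hl]
      refine iff_of_eq (congrArg _ ?_)
      funext i
      fin_cases i
      rfl
    -- A surjection from `λ` exists in `M` because `x` has size at most `λ`. Being one is a
    -- Δ₀-property, so Σ₁-elementarity gives one inside `H_{λ⁺}`.
    obtain ⟨f, hf⟩ := hx.sm.exists_surjS ⟨(y : M), (hd.mem_iff _ _).2 hy⟩
    obtain ⟨f, hf⟩ := hd.witness_one_d0 (m := 2) (D0.isSurj (Sum.inl (Sum.inr 0))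
      (Sum.inl (Sum.inl 0)) (Sum.inl (Sum.inl 1)))
      ![Structure.funMap (L := morley LSet A) (MorleyFunctions.funSymb φ hφA)
        (default : Fin 0 → N), x] ⟨f, (realize_isSurj _ _ _).2 (by
          change SurjS f ((Structure.funMap (L := morley LSet A) (MorleyFunctions.funSymb φ hφA)
            (default : Fin 0 → N) : N) : M) (x : M)
          rwa [hcl])⟩
    exact ⟨f, (realize_isSurj _ _ _).1 hf⟩
  rw [models_iff.{u}]
  intro M _ _ hM
  obtain ⟨K, _, _, j, hK, hj⟩ := hc.exists_embedding M hM
  let _ : LSet.Structure M := (incl A).reduct M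
  have : (incl A).IsExpansionOn M := LHom.isExpansionOn_reduct _ _
  let _ : LSet.Structure K := (incl A).reduct K
  have : (incl A).IsExpansionOn K := LHom.isExpansionOn_reduct _ _
  -- `K` satisfies the common theory but need not be some `H_{λ⁺}`. What the transfer needs is
  -- therefore read off from sentences true in all these structures: the axioms for the
  -- Δ₀-predicates, extensionality and pairing.
  have hKd : DeltaInterp A K := by
    intro n ψ hmem hψ
    refine (realize_axZero hmem).1 (hK.realize_of_mem _ fun N _ _ hN H hH => ?_)
    obtain ⟨_, _, -, h, -⟩ := key N hN H hH
    exact (realize_axZero hmem).2 (h n ψ hmem hψ)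
  have : EP K := by
    refine ⟨?_, ?_⟩
    · have : K ⊨ (incl A).onSentence extensionality := hK.realize_of_mem _ fun N _ _ hN H hH => by
        obtain ⟨_, _, h, -⟩ := key N hN H hH
        exact (LHom.realize_onSentence _ _ _).2 realize_extensionality
      rw [LHom.realize_onSentence] at this
      simpa only [Sentence.Realize, Formula.Realize, extensionality, realize_allF,
        BoundedFormula.realize_imp, BoundedFormula.realize_iff, realize_mem, realize_eqF, elim_up,
        elim_last] using this
    · have : K ⊨ (incl A).onSentence AMCSpectrum.pairing := hK.realize_of_mem _ fun N _ _ hN H hH => by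
        obtain ⟨_, _, h, -⟩ := key N hN H hH
        rw [LHom.realize_onSentence]
        simp only [Sentence.Realize, Formula.Realize, AMCSpectrum.pairing, realize_allF,
          realize_exF, realize_isUPair, elim_up, elim_last]
        exact EP.pairing
      rw [LHom.realize_onSentence] at this
      simpa only [Sentence.Realize, Formula.Realize, AMCSpectrum.pairing, realize_allF,
          realize_exF, realize_isUPair, elim_up, elim_last] using this
  have hKs : K ⊨ surjectiveImages (MorleyFunctions.funSymb φ hφA) :=
    hK.realize_of_mem _ fun N _ _ hN H hH => by
      obtain ⟨_, _, -, -, h⟩ := key N hN H hH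
      exact h
  have hd := DeltaEmb.of_embedding hA hKd j hj
  refine (realize_surjectiveImages _).2 ?_
  have hKs := (realize_surjectiveImages _).1 hKs
  rintro x ⟨y, hy⟩
  obtain ⟨f, hf⟩ := hKs (j x) ⟨j y, (hd.mem_iff _ _).2 hy⟩
  obtain ⟨f, hf⟩ := hd.witness_one_d0 (m := 2) (D0.isSurj (Sum.inl (Sum.inr 0))
    (Sum.inl (Sum.inl 0)) (Sum.inl (Sum.inl 1)))
    ![Structure.funMap (L := morley LSet A) (MorleyFunctions.funSymb φ hφA)
      (default : Fin 0 → M), x] ⟨f, (realize_isSurj _ _ _).2 (by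
        have e := j.map_fun (n := 0) (MorleyFunctions.funSymb φ hφA) (default : Fin 0 → M)
        rw [Subsingleton.elim (j ∘ default) default] at e
        change SurjS f (j (Structure.funMap (L := morley LSet A) (MorleyFunctions.funSymb φ hφA)
          (default : Fin 0 → M))) (j x)
        exact e.symm ▸ hf)⟩
  exact ⟨f, (realize_isSurj _ _ _).1 hf⟩

end HPlus

end AMCSpectrum

namespace AMCSpectrum

/-! ## Reflection to `H_{k⁺}` -/

section Reflection

variable {M : Type u} [LSet.Structure M]

/-- Inside the transitive set `t`, the set `X` contains `k` and its elements, and is closed under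
witnesses for the demands `ds`; and `app p` is the (injective) transitive collapse of `X`. -/
structure Hull [ZF M] (k : M) (ds : List Demand) (t X p : M) : Prop where
  trans : TransS t
  sub : ∀ x, x ∊ X → x ∊ t
  base : ∀ x, x ∊ suc k → x ∊ X
  wit : ∀ d ∈ ds, ∀ v : Fin d.1 → M, (∀ i, v i ∊ X) →
    (∃ y, y ∊ t ∧ d.2.Realize (Fin.cons y v : Fin _ → M)) →
    ∃ y, y ∊ X ∧ d.2.Realize (Fin.cons y v : Fin _ → M)
  inj : ∀ x y, x ∊ X → y ∊ X → app p x = app p y → x = y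
  collapse : ∀ x, x ∊ X → ∀ z, z ∊ app p x ↔ ∃ y, y ∊ X ∧ y ∊ x ∧ z = app p y

variable [ZF M] {k t X p : M} {ds ds' : List Demand}

theorem Hull.mono (h : Hull k ds t X p) (hd : ds' ⊆ ds) : Hull k ds' t X p :=
  ⟨h.trans, h.sub, h.base, fun d hd' => h.wit d (hd hd'), h.inj, h.collapse⟩

theorem Hull.self_mem (h : Hull k ds t X p) : k ∊ X := h.base k (by simp)

theorem Hull.mem_iff (h : Hull k ds t X p) {x y : M} (hx : x ∊ X) (hy : y ∊ X) :
    app p x ∊ app p y ↔ x ∊ y := by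
  rw [h.collapse y hy]
  constructor
  · rintro ⟨z, hz, hzy, e⟩
    rwa [h.inj x z hx hz e]
  · exact fun hxy => ⟨x, hx, hxy, rfl⟩

/-- By ∈-induction, the collapse does not move the elements of a transitive set contained in the
hull. -/
theorem Hull.app_eq (h : Hull k ds t X p) {s : M} (hs : TransS s) (hsX : ∀ x, x ∊ s → x ∊ X) {x : M}
    (hx : x ∊ s) : app p x = x := by
  by_contra hne
  obtain ⟨y, hy, hy', hmin⟩ := exists_minimal (P := fun x => app p x ≠ x) (X := s) ⟨x, hx, hne⟩
  refine hy' (ZF.ext _ _ fun z => ?_)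
  have hm : ∀ z, z ∊ y → app p z = z := fun z hz => by
    by_contra h'
    exact hmin z hz (hs y hy z hz) h'
  rw [h.collapse y (hsX y hy)]
  constructor
  · rintro ⟨w, -, hwy, rfl⟩
    rwa [hm w hwy]
  · exact fun hz => ⟨z, hsX z (hs y hy z hz), hz, (hm z hz).symm⟩

theorem Hull.app_self (h : Hull k ds t X p) (hk : OrdS k) : app p k = k :=
  h.app_eq (ordS_suc hk).1 h.base (by simp)

/-- The demand for a witness of the last variable of a formula. -/
theorem exists_demand {α : Type} {n : ℕ} (χ : LSet.BoundedFormula α (n + 1)) : ∃ d : Demand,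
    ∀ (M : Type u) [LSet.Structure M] [ZF M] (k t X p : M) (ds : List Demand), Hull k ds t X p →
      d ∈ ds → ∀ (v : α → M) (xs : Fin n → M), (∀ a, v a ∊ X) → (∀ i, xs i ∊ X) →
      (∃ y, y ∊ t ∧ χ.Realize v (Fin.snoc xs y : Fin _ → M)) →
      ∃ y, y ∊ X ∧ χ.Realize v (Fin.snoc xs y : Fin _ → M) := by
  obtain ⟨m, ψ, s, hψ⟩ := exists_formula_fin.{u} χ.toFormula
  let r : α ⊕ Fin (n + 1) → (α ⊕ Fin n) ⊕ Unit := Sum.elim (Sum.inl ∘ Sum.inl)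
    (Fin.snoc (α := fun _ => (α ⊕ Fin n) ⊕ Unit) (Sum.inl ∘ Sum.inr) (Sum.inr ()))
  let q : Fin m → Fin (m + 1) := fun i => Sum.elim (fun _ => i.succ) (fun _ => 0) (r (s i))
  refine ⟨⟨m, ψ.relabel q⟩, fun M _ _ k t X p ds h hd v xs hv hxs hy => ?_⟩
  -- The positions belonging to the witness variable also need a parameter in the hull. They are
  -- filled with `k`, which `q` ignores because it sends these positions to `0`.
  let w : Fin m → M := fun i => Sum.elim (Sum.elim v xs) (fun _ => k) (r (s i))
  have key : ∀ y : M, (ψ.relabel q).Realize (Fin.cons y w : Fin (m + 1) → M) ↔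
      χ.Realize v (Fin.snoc xs y : Fin _ → M) := by
    intro y
    have e : (Fin.cons y w : Fin (m + 1) → M) ∘ q = Sum.elim v (Fin.snoc xs y : Fin _ → M) ∘ s := by
      funext i
      have : ∀ z, Sum.elim v (Fin.snoc xs y : Fin _ → M) z =
          Sum.elim (Sum.elim v xs) (fun _ => y) (r z) := by
        rintro (a | i)
        · rfl
        · refine Fin.lastCases ?_ (fun i => ?_) i <;> simp [r]
      simp only [Function.comp_apply, this, q, w]
      rcases hz : r (s i) with z | z
      · simp only [Sum.elim_inl, Fin.cons_succ]
        rw [hz, Sum.elim_inl]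
      · simp
    rw [Formula.realize_relabel, e, ← hψ, BoundedFormula.realize_toFormula, Sum.elim_comp_inl,
      Sum.elim_comp_inr]
  have hw : ∀ i, w i ∊ X := by
    intro i
    simp only [w]
    rcases r (s i) with (a | j) | z
    exacts [hv a, hxs j, h.self_mem]
  obtain ⟨y, hyX, hyr⟩ := h.wit _ hd w hw (hy.imp fun y hy => ⟨hy.1, (key y).2 hy.2⟩)
  exact ⟨y, hyX, (key y).1 hyr⟩

/-- The collapse preserves a `Δ₀`-formula, if the hull meets finitely many demands. -/
theorem IsDeltaZero.exists_demands {α : Type} {n : ℕ} {φ : LSet.BoundedFormula α n}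
    (h : IsDeltaZero φ) : ∃ ds : List Demand,
      ∀ (M : Type u) [LSet.Structure M] [ZF M] (k t X p : M), Hull k ds t X p →
        ∀ (v : α → M) (xs : Fin n → M), (∀ a, v a ∊ X) → (∀ i, xs i ∊ X) →
        (φ.Realize v xs ↔ φ.Realize (app p ∘ v) (app p ∘ xs)) := by
  have helim : ∀ {M : Type u} [LSet.Structure M] [ZF M] {α : Type} {n : ℕ} {p X : M} (x : α ⊕ Fin n)
      {v : α → M} {xs : Fin n → M}, (∀ a, v a ∊ X) → (∀ i, xs i ∊ X) → Sum.elim v xs x ∊ X ∧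
        Sum.elim (app p ∘ v) (app p ∘ xs) x = app p (Sum.elim v xs x) := by
    rintro M _ _ α n p X (x | x) v xs hv hxs
    exacts [⟨hv x, rfl⟩, ⟨hxs x, rfl⟩]
  have hsnoc : ∀ {M : Type u} [LSet.Structure M] [ZF M] {n : ℕ} {p X y : M} {xs : Fin n → M},
      (∀ i, xs i ∊ X) → y ∊ X → (∀ i, (Fin.snoc xs y : Fin (n + 1) → M) i ∊ X) ∧
        app p ∘ (Fin.snoc xs y : Fin (n + 1) → M) = Fin.snoc (app p ∘ xs) (app p y) := by
    intro M _ _ n p X y xs hxs hy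
    refine ⟨fun i => ?_, Fin.comp_snoc _ _ _⟩
    refine Fin.lastCases ?_ (fun i => ?_) i
    · rwa [Fin.snoc_last]
    · rw [Fin.snoc_castSucc]
      exact hxs i
  induction h with
  | falsum => exact ⟨[], fun M _ _ k t X p h v xs hv hxs => Iff.rfl⟩
  | eq x y =>
    refine ⟨[], fun M _ _ k t X p h v xs hv hxs => ?_⟩
    rw [realize_eqF, realize_eqF, (helim x hv hxs).2, (helim y hv hxs).2]
    exact ⟨congrArg _, h.inj _ _ (helim (p := p) x hv hxs).1 (helim (p := p) y hv hxs).1⟩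
  | mem x y =>
    refine ⟨[], fun M _ _ k t X p h v xs hv hxs => ?_⟩
    rw [realize_mem, realize_mem, (helim x hv hxs).2, (helim y hv hxs).2,
      h.mem_iff (helim (p := p) x hv hxs).1 (helim (p := p) y hv hxs).1]
  | imp _ _ ih₁ ih₂ =>
    obtain ⟨ds₁, h₁⟩ := ih₁
    obtain ⟨ds₂, h₂⟩ := ih₂
    refine ⟨ds₁ ++ ds₂, fun M _ _ k t X p h v xs hv hxs => ?_⟩
    exact imp_congr (h₁ M k t X p (h.mono (List.subset_append_left _ _)) v xs hv hxs)
      (h₂ M k t X p (h.mono (List.subset_append_right _ _)) v xs hv hxs)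
  | ball x _ ih =>
    rename_i n φ _
    obtain ⟨ds, hds⟩ := ih
    -- The demand asks for counterexamples to the bounded quantifier. They lie in `t` because `t` is
    -- transitive, so the hull contains one if there is any.
    obtain ⟨d, hd⟩ := exists_demand.{u} (AMCSpectrum.mem (Sum.inr (Fin.last n)) x↟ ⊓ ∼φ)
    refine ⟨d :: ds, fun M _ _ k t X p h v xs hv hxs => ?_⟩
    have ih := fun y hy => hds M k t X p (h.mono (List.subset_cons_self _ _)) v _ hv
      (hsnoc (p := p) (y := y) hxs hy).1
    have hx := (helim (p := p) x hv hxs).1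
    simp only [realize_allF, BoundedFormula.realize_imp, realize_mem, elim_up, elim_last,
      (helim x hv hxs).2]
    constructor
    · intro H z hz
      obtain ⟨y, hy, hyx, rfl⟩ := (h.collapse _ hx z).1 hz
      have := (ih y hy).1 (H y hyx)
      rwa [(hsnoc hxs hy).2] at this
    · intro H y hy
      by_contra hn
      obtain ⟨z, hz, hzr⟩ := hd M k t X p _ h (List.mem_cons_self ..) v xs hv hxs
        ⟨y, h.trans _ (h.sub _ hx) y hy, by simp [hy, hn]⟩
      simp only [BoundedFormula.realize_inf, realize_mem, elim_up, elim_last,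
        BoundedFormula.realize_not] at hzr
      refine hzr.2 ((ih z hz).2 ?_)
      rw [(hsnoc hxs hz).2]
      exact H _ ((h.mem_iff hz hx).2 hzr.1)
  | bex x _ ih =>
    rename_i n φ _
    obtain ⟨ds, hds⟩ := ih
    obtain ⟨d, hd⟩ := exists_demand.{u} (AMCSpectrum.mem (Sum.inr (Fin.last n)) x↟ ⊓ φ)
    refine ⟨d :: ds, fun M _ _ k t X p h v xs hv hxs => ?_⟩
    have ih := fun y hy => hds M k t X p (h.mono (List.subset_cons_self _ _)) v _ hv
      (hsnoc (p := p) (y := y) hxs hy).1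
    have hx := (helim (p := p) x hv hxs).1
    simp only [realize_exF, BoundedFormula.realize_inf, realize_mem, elim_up, elim_last,
      (helim x hv hxs).2]
    constructor
    · rintro ⟨y, hy, hr⟩
      obtain ⟨z, hz, hzr⟩ := hd M k t X p _ h (List.mem_cons_self ..) v xs hv hxs
        ⟨y, h.trans _ (h.sub _ hx) y hy, by simp [hy, hr]⟩
      simp only [BoundedFormula.realize_inf, realize_mem, elim_up, elim_last] at hzr
      refine ⟨_, (h.mem_iff hz hx).2 hzr.1, ?_⟩
      have := (ih z hz).1 hzr.2
      rwa [(hsnoc hxs hz).2] at this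
    · rintro ⟨z, hz, hr⟩
      obtain ⟨y, hy, hyx, rfl⟩ := (h.collapse _ hx z).1 hz
      refine ⟨y, hyx, (ih y hy).2 ?_⟩
      rwa [(hsnoc hxs hy).2]

/-- Injectivity of the collapse of an extensional set. -/
theorem collapse_injective
    (hext : ∀ x y, x ∊ X → y ∊ X → (∃ z, z ∊ x ∧ ¬ z ∊ y) → ∃ z, z ∊ X ∧ z ∊ x ∧ ¬ z ∊ y)
    (hp : ∀ x, x ∊ X → ∀ z, z ∊ app p x ↔ ∃ y, y ∊ X ∧ y ∊ x ∧ z = app p y) {x y : M} (hx : x ∊ X)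
    (hy : y ∊ X) (h : app p x = app p y) : x = y := by
  by_contra hne
  obtain ⟨x, hx, ⟨y, hy, hne, h⟩, hmin⟩ := exists_minimal
    (P := fun x => ∃ y, y ∊ X ∧ x ≠ y ∧ app p x = app p y) (X := X) ⟨x, hx, y, hy, hne, h⟩
  have hmin' : ∀ z w, z ∊ x → z ∊ X → w ∊ X → app p z = app p w → z = w := fun z w hz hzX hw e => by
    by_contra hzw
    exact hmin z hz hzX ⟨w, hw, hzw, e⟩
  have h1 : ∀ z, z ∊ x → z ∊ y := by
    by_contra! hc
    obtain ⟨z, hz, hzx, hzy⟩ := hext x y hx hy hc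
    obtain ⟨w, hw, hwy, e⟩ := (hp y hy _).1 (h ▸ (hp x hx _).2 ⟨z, hz, hzx, rfl⟩)
    exact hzy (hmin' z w hzx hz hw e ▸ hwy)
  have h2 : ∀ z, z ∊ y → z ∊ x := by
    by_contra! hc
    obtain ⟨z, hz, hzy, hzx⟩ := hext y x hy hx hc
    obtain ⟨w, hw, hwx, e⟩ := (hp x hx _).1 (h ▸ (hp y hy _).2 ⟨z, hz, hzy, rfl⟩)
    exact hzx (hmin' w z hwx hw hz e.symm ▸ hwx)
  exact hne (ZF.ext _ _ fun z => ⟨h1 z, h2 z⟩)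

theorem InfCard.exists_sm_of_fin (hk : InfCard k) : ∀ {m : ℕ} (v : Fin m → M),
    ∃ x, (∀ y, y ∊ suc k → y ∊ x) ∧ Sm k x ∧ ∀ i, v i ∊ x
  | 0, _ => ⟨suc k, fun _ h => h, hk.sm_cup (Sm.refl k) (hk.sm_upair k k), Fin.rec0⟩
  | m + 1, v => by
    obtain ⟨x, h, hs, hv⟩ := hk.exists_sm_of_fin fun i : Fin m => v i.succ
    refine ⟨cup x (upair (v 0) (v 0)), fun y hy => by simp [h y hy], hk.sm_cup hs (hk.sm_upair _ _),
      fun i => ?_⟩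
    refine Fin.cases (by simp) (fun i => by simp [hv i]) i

/-- One extra demand, for elements of `x \ y`, makes the hull extensional and its collapse
injective. The collapsed hull is transitive and covered by `k`, so all values of the collapse are in
`H_{k⁺}`. -/
theorem InfCard.exists_collapsed_hull (hk : InfCard k) (ds : List Demand) {α : Type} [Finite α]
    (v : α → M) : ∃ t X p, Hull k ds t X p ∧ (∀ a, v a ∊ X) ∧ ∀ x, x ∊ X → Hs k (app p x) := by
  obtain ⟨m, ⟨e⟩⟩ := Finite.exists_equiv_fin α
  obtain ⟨x₀, hx₀, hs, hv⟩ := hk.exists_sm_of_fin (v ∘ e.symm)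
  obtain ⟨t, ht, hxt⟩ := exists_transS x₀
  let d : Demand := ⟨2, AMCSpectrum.mem (Sum.inl 0) (Sum.inl 1) ⊓
    ∼(AMCSpectrum.mem (Sum.inl 0) (Sum.inl 2))⟩
  obtain ⟨X, hXt, hxX, hX, hw⟩ := hk.exists_hull t x₀ hxt ⟨k, hx₀ k (by simp)⟩ hs (d :: ds)
  obtain ⟨p, hp⟩ := exists_collapse X (fun y x => y ∊ x) fun Y _ hY => by
    obtain ⟨y, hy, h⟩ := ZF.found Y hY
    exact ⟨y, hy, fun z hz hzy => h ⟨z, hz, hzy⟩⟩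
  have hd : ∀ x y z : M, d.2.Realize (Fin.cons z ![x, y] : Fin 3 → M) ↔ z ∊ x ∧ ¬ z ∊ y := by
    intro x y z
    simp only [d, Formula.Realize, BoundedFormula.realize_inf, BoundedFormula.realize_not,
      realize_mem, Sum.elim_inl]
    exact Iff.rfl
  have hext : ∀ x y, x ∊ X → y ∊ X → (∃ z, z ∊ x ∧ ¬ z ∊ y) → ∃ z, z ∊ X ∧ z ∊ x ∧ ¬ z ∊ y := by
    rintro x y hx hy ⟨z, hz⟩
    obtain ⟨z', hz', h⟩ := hw d (List.mem_cons_self ..) ![x, y]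
      (fun i => by fin_cases i <;> assumption)
      ⟨z, ht x (hXt x hx) z hz.1, (hd x y z).2 hz⟩
    exact ⟨z', hz', (hd x y z').1 h⟩
  refine ⟨t, X, p, ⟨ht, hXt, fun x hx => hxX x (hx₀ x hx), fun d hd => hw d (List.mem_cons_of_mem _ hd),
    fun x y hx hy => collapse_injective hext hp hx hy, hp⟩, fun a => hxX _ ?_, fun x hx => ?_⟩
  · have := hv (e a)
    simpa using this
  · refine ⟨img (app p) X, ?_, fun y hy => ?_, hX.img _⟩
    · intro y hy z hz
      obtain ⟨w, hw, rfl⟩ := mem_img.1 hy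
      obtain ⟨w', hw', -, rfl⟩ := (hp w hw z).1 hz
      exact mem_img.2 ⟨w', hw', rfl⟩
    · obtain ⟨w, hw, -, rfl⟩ := (hp x hx y).1 hy
      exact mem_img.2 ⟨w, hw, rfl⟩

/-- The predicates preserved by the collapse of sufficiently closed hulls. -/
def reflectClass (k : M) : BoolClass M where
  Q {α} P := ∃ ds : List Demand, ∀ t X p, Hull k ds t X p → ∀ v : α → M, (∀ a, v a ∊ X) →
    (P v ↔ P (app p ∘ v))
  bot := ⟨[], fun _ _ _ _ _ _ => Iff.rfl⟩
  imp := by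
    rintro α P P' ⟨ds, h⟩ ⟨ds', h'⟩
    exact ⟨ds ++ ds', fun t X p H v hv => imp_congr
      (h t X p (H.mono (List.subset_append_left _ _)) v hv)
      (h' t X p (H.mono (List.subset_append_right _ _)) v hv)⟩
  reindex := by
    rintro α β P s ⟨ds, h⟩
    exact ⟨ds, fun t X p H v hv => h t X p H (v ∘ s) fun a => hv _⟩
  eq a b := ⟨[], fun t X p H v hv => ⟨congrArg _, H.inj _ _ (hv a) (hv b)⟩⟩

theorem reflectClass_d0 {α : Type} {φ : LSet.Formula α} (h : D0.{u} φ) :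
    (reflectClass k).Q fun v : α → M => φ.Realize v := by
  obtain ⟨ψ, hψ, hr⟩ := h
  obtain ⟨ds, hds⟩ := hψ.exists_demands.{u}
  refine ⟨ds, fun t X p H v hv => ?_⟩
  change BoundedFormula.Realize φ v _ ↔ BoundedFormula.Realize φ (app p ∘ v) _
  rw [hr, hr, hds M k t X p H v _ hv fun i => i.elim0]
  exact iff_of_eq (congrArg _ (Subsingleton.elim _ _))

/-- The collapse fixes `k`, because `k ∪ {k}` is a transitive subset of the hull; hence `k` may
occur as a parameter. -/
theorem reflectClass_param (hk : OrdS k) {α : Type} {P : (Option α → M) → Prop}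
    (h : (reflectClass k).Q P) : (reflectClass k).Q fun v : α → M => P fun o => o.elim k v := by
  obtain ⟨ds, h⟩ := h
  refine ⟨ds, fun t X p H v hv => ?_⟩
  refine (h t X p H _ fun o => by cases o; exacts [H.self_mem, hv _]).trans
    (iff_of_eq (congrArg P ?_))
  funext o
  cases o
  exacts [H.app_self hk, rfl]

/-- An arbitrary formula about elements of a transitive set that is enumerated by `k`. -/
theorem reflectClass_cover (hk : OrdS k) {α : Type} (s f : α) {m : ℕ} (x : Fin m → α)
    (χ : LSet.Formula (Fin m)) : (reflectClass k).Q fun v : α → M =>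
      (TransS (v s) ∧ SurjS (v f) k (v s) ∧ ∀ i, v (x i) ∊ v s) ∧ χ.Realize fun i => v (x i) := by
  have h1 : (reflectClass k).Q fun v : α → M => TransS (v s) := by
    have := reflectClass_d0 (k := k) (D0.isTransitive.{u} (α := α) (n := 0) (Sum.inl s))
    simpa only [Formula.Realize, realize_isTransitive, Sum.elim_inl] using this
  have h2 : (reflectClass k).Q fun v : α → M => SurjS (v f) k (v s) := by
    have := reflectClass_param hk (reflectClass_d0 (k := k) (D0.isSurj.{u} (α := Option α) (n := 0)
      (Sum.inl (some f)) (Sum.inl none) (Sum.inl (some s))))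
    simpa only [Formula.Realize, realize_isSurj, Sum.elim_inl, Option.elim_some, Option.elim_none] using this
  have h3 : ∀ i, (reflectClass k).Q fun v : α → M => v (x i) ∊ v s := fun i => by
    have := reflectClass_d0 (k := k) (D0.mem.{u} (α := α) (n := 0) (Sum.inl (x i)) (Sum.inl s))
    simpa only [Formula.Realize, realize_mem, Sum.elim_inl] using this
  obtain ⟨ds, h⟩ := (reflectClass k).and h1 ((reflectClass k).and h2 ((reflectClass k).all_fin h3))
  -- The demand is for the value of a function at an argument. Since `f` and the elements of `k` are
  -- in the hull, all of `s` is; the collapse fixes the elements of `s`, so any formula `χ` about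
  -- them is unchanged.
  obtain ⟨d, hd⟩ := exists_demand.{u} (α := Fin 2) (n := 0)
    (pairIn (Sum.inl 0) (Sum.inl 1) (Sum.inr (Fin.last 0)))
  refine ⟨d :: ds, fun t X p H v hv => ?_⟩
  have hc := h t X p (H.mono (List.subset_cons_self _ _)) v hv
  refine (and_congr_right fun hcov => ?_).trans (and_congr_left' hc)
  obtain ⟨hs, hf, hx⟩ := hcov
  have hsX : ∀ y, y ∊ v s → y ∊ X := by
    intro y hy
    obtain ⟨a, ha, hay⟩ := hf.2 y hy
    have hyt : y ∊ t := H.trans _ (H.sub _ (hv s)) y hy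
    obtain ⟨z, hz, hr⟩ := hd M k t X p _ H (List.mem_cons_self ..) ![v f, a] Fin.elim0
      (fun i => by
        fin_cases i
        exacts [hv f, H.base a (by simp [ha])]) (fun i => i.elim0)
      ⟨y, hyt, (realize_pairIn _ _ _).2 (by rw [elim_last]; exact hay)⟩
    have hr' : PairInS (v f) a z := by
      have := (realize_pairIn _ _ _).1 hr
      rwa [elim_last] at this
    obtain ⟨b, hb⟩ := hf.1.1.2 a ha
    rwa [(hb y).1 hay, ← (hb z).1 hr']
  refine iff_of_eq (congrArg _ ?_)
  funext i
  exact (H.app_eq hs hsX (hx i)).symm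

end Reflection

end AMCSpectrum

namespace AMCSpectrum

/-! ## Translation to the language of set theory -/

section Translation

variable {L : FirstOrder.Language.{0, 0}} {ρ : ∀ {n : ℕ}, L.Relations n → LSet.Formula (Fin n)}
  {γ : ∀ {n : ℕ}, L.Functions n → LSet.Formula (Fin (n + 1))}

/-- The formulas `ρ` and `γ` define the relations and the graphs of the functions of `M`. -/
structure Translates (ρ : ∀ {n : ℕ}, L.Relations n → LSet.Formula (Fin n))
    (γ : ∀ {n : ℕ}, L.Functions n → LSet.Formula (Fin (n + 1))) (M : Type u) [LSet.Structure M]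
    [L.Structure M] : Prop where
  rel : ∀ {n : ℕ} (r : L.Relations n) (v : Fin n → M), Structure.RelMap r v ↔ (ρ r).Realize v
  func : ∀ {n : ℕ} (f : L.Functions n) (v : Fin n → M) (y : M), Structure.funMap f v = y ↔
    (γ f).Realize (Fin.cons y v : Fin (n + 1) → M)

/-- Values described by formulas `χ i` are substituted into `θ` by quantifying over them. With it
nested terms are eliminated in favour of the graphs of functions. -/
theorem exists_formula_values {β β' : Type} {n : ℕ} (g : β → β') (χ : Fin n → LSet.Formula (Option β))
    (θ : LSet.Formula (β' ⊕ Fin n)) : ∃ ψ : LSet.Formula β', ∀ (M : Type u) [LSet.Structure M]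
      (w : β' → M), ψ.Realize w ↔ ∃ ys : Fin n → M,
        (∀ i, (χ i).Realize fun o => o.elim (ys i) (w ∘ g)) ∧ θ.Realize (Sum.elim w ys) := by
  refine ⟨Formula.iExs (Fin n) (BoundedFormula.iInf (fun i => (χ i).relabel
    fun o => o.elim (Sum.inr i) (Sum.inl ∘ g)) ⊓ θ), fun M _ v => ?_⟩
  rw [Formula.realize_iExs]
  refine exists_congr fun ys => ?_
  rw [Formula.realize_inf]
  refine and_congr_left' ?_
  rw [Formula.Realize, BoundedFormula.realize_iInf]
  refine forall_congr' fun i => ?_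
  refine Formula.realize_relabel.trans (iff_of_eq (congrArg _ ?_))
  funext o
  cases o <;> rfl

theorem exists_translation_term {β : Type} (t : L.Term β) : ∃ χ : LSet.Formula (Option β),
    ∀ (M : Type u) [LSet.Structure M] [L.Structure M], Translates ρ γ M → ∀ (v : β → M) (y : M),
      χ.Realize (fun o => o.elim y v) ↔ y = t.realize v := by
  induction t with
  | var b =>
    refine ⟨Term.equal (Term.var none) (Term.var (some b)), fun M _ _ _ v y => ?_⟩
    rw [Formula.realize_equal]
    rfl
  | @func n f ts ih =>
    choose χ hχ using ih
    obtain ⟨ψ, hψ⟩ := exists_formula_values.{u} some χ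
      ((γ f).relabel (Fin.cons (Sum.inl none) Sum.inr : Fin (n + 1) → Option β ⊕ Fin n))
    refine ⟨ψ, fun M _ _ hM v y => ?_⟩
    have h1 : (fun o : Option β => o.elim y v) ∘ some = v := rfl
    rw [hψ, h1, Term.realize_func, eq_comm, hM.func]
    simp only [hχ _ M hM, ← funext_iff]
    rw [exists_eq_left, Formula.realize_relabel]
    refine iff_of_eq (congrArg _ ?_)
    funext i
    refine Fin.cases ?_ (fun i => ?_) i <;> rfl

/-- Formulas over a substructure whose domain is defined by `δ`. -/
theorem exists_translation (δ : LSet.Formula (Fin 1)) {α : Type} {n : ℕ} (φ : L.BoundedFormula α n) :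
    ∃ χ : LSet.Formula (α ⊕ Fin n), ∀ (M : Type u) [LSet.Structure M] [L.Structure M],
      Translates ρ γ M → ∀ N : L.Substructure M, (∀ x, x ∈ N ↔ δ.Realize ![x]) →
        ∀ (v : α → N) (xs : Fin n → N),
          φ.Realize v xs ↔ χ.Realize (Subtype.val ∘ Sum.elim v xs) := by
  have hval : ∀ {M : Type u} [L.Structure M] {N : L.Substructure M} {β : Type} (t : L.Term β)
      (v : β → N), ((t.realize v : N) : M) = t.realize (Subtype.val ∘ v) := fun {M} _ {N} {β} t v =>
    (HomClass.realize_term (F := _ ↪[L] M) N.subtype).symm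
  induction φ with
  | falsum => exact ⟨⊥, fun M _ _ _ N _ v xs => Iff.rfl⟩
  | equal t₁ t₂ =>
    obtain ⟨χ₁, h₁⟩ := exists_translation_term.{u} (ρ := ρ) (γ := γ) t₁
    obtain ⟨χ₂, h₂⟩ := exists_translation_term.{u} (ρ := ρ) (γ := γ) t₂
    obtain ⟨ψ, hψ⟩ := exists_formula_values.{u} id ![χ₁, χ₂]
      (Term.equal (Term.var (Sum.inr 0)) (Term.var (Sum.inr 1)))
    refine ⟨ψ, fun M _ _ hM N hN v xs => ?_⟩
    rw [hψ, BoundedFormula.Realize, ← Subtype.coe_inj, hval, hval]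
    simp only [Fin.forall_fin_two, Matrix.cons_val_zero, Matrix.cons_val_one, h₁ M hM, h₂ M hM,
      Formula.realize_equal, Term.realize_var, Sum.elim_inr, Function.comp_id]
    exact ⟨fun h => ⟨![_, _], ⟨rfl, rfl⟩, h⟩, fun ⟨ys, ⟨e₁, e₂⟩, e⟩ => by rwa [e₁, e₂] at e⟩
  | rel r ts =>
    choose χ hχ using fun i => exists_translation_term.{u} (ρ := ρ) (γ := γ) (ts i)
    obtain ⟨ψ, hψ⟩ := exists_formula_values.{u} id χ ((ρ r).relabel Sum.inr)
    refine ⟨ψ, fun M _ _ hM N hN v xs => ?_⟩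
    simp only [hψ, hχ _ M hM, ← funext_iff, Function.comp_id]
    rw [exists_eq_left, Formula.realize_relabel, Sum.elim_comp_inr, ← hM.rel]
    simp only [← hval]
    exact Iff.rfl
  | imp _ _ ih₁ ih₂ =>
    obtain ⟨χ₁, h₁⟩ := ih₁
    obtain ⟨χ₂, h₂⟩ := ih₂
    exact ⟨χ₁.imp χ₂, fun M _ _ hM N hN v xs =>
      (imp_congr (h₁ M hM N hN v xs) (h₂ M hM N hN v xs)).trans Formula.realize_imp.symm⟩
  | @all n φ ih =>
    obtain ⟨χ, h⟩ := ih
    let s : α ⊕ Fin (n + 1) → (α ⊕ Fin n) ⊕ Unit := Sum.elim (Sum.inl ∘ Sum.inl)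
      (Fin.snoc (α := fun _ => (α ⊕ Fin n) ⊕ Unit) (Sum.inl ∘ Sum.inr) (Sum.inr ()))
    -- Quantifiers over the substructure are relativized to `δ`, while symbols keep their meaning in
    -- the ambient model.
    refine ⟨Formula.iAlls Unit ((δ.relabel fun _ => Sum.inr ()).imp (χ.relabel s)),
      fun M _ _ hM N hN v xs => ?_⟩
    rw [Formula.realize_iAlls, BoundedFormula.realize_all]
    have hs : ∀ (x : N) (i : Unit → M), i () = x → Sum.elim (Subtype.val ∘ Sum.elim v xs) i ∘ s =
        Subtype.val ∘ Sum.elim v (Fin.snoc xs x : Fin (n + 1) → N) := by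
      intro x i hi
      funext z
      rcases z with a | z
      · rfl
      · refine Fin.lastCases ?_ (fun z => ?_) z <;> simp [s, hi]
    have hδ : ∀ i : Unit → M, (δ.relabel fun _ => Sum.inr ()).Realize
        (Sum.elim ((Subtype.val : N → M) ∘ Sum.elim v xs) i) ↔ i () ∈ N := by
      intro i
      rw [hN, Formula.realize_relabel, Matrix.vec_single_eq_const]
      exact Iff.rfl
    simp only [Formula.realize_imp, hδ, Formula.realize_relabel]
    constructor
    · intro H i hi
      rw [hs ⟨i (), hi⟩ i rfl, ← h M hM N hN]
      exact H _
    · intro H x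
      have := H (fun _ => x) x.2
      rwa [hs x _ rfl, ← h M hM N hN] at this

end Translation

end AMCSpectrum

namespace AMCSpectrum

/-! ## The signature for `H_{λ⁺}` -/

section Cover

/-- `χ(x₁, …, xₙ)` holds, and the `xᵢ` belong to the transitive set `s`, which is the image of `λ`
under `f`. The variables are `s, f, x₁, …, xₙ`. -/
noncomputable def coverFormula (φ : LSet.Formula (Fin 1)) {n : ℕ} (χ : LSet.Formula (Fin n)) :
    LSet.Formula (Fin (n + 2)) :=
  exF fun l => plug φ (fun _ => l) ⊓
    ((isTransitive (Sum.inl 0) ⊓ (isSurj (Sum.inl 1) l (Sum.inl 0) ⊓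
      BoundedFormula.iInf fun i : Fin n => mem (Sum.inl i.succ.succ) (Sum.inl 0))) ⊓
      plug χ fun i => Sum.inl i.succ.succ)

/-- The pairs giving the signature for `H_{λ⁺}`. -/
def coverSet (φ : LSet.Formula (Fin 1)) : Set (Form LSet × Fin 2) :=
  deltaZero ∪ {a | ∃ (n : ℕ) (χ : LSet.Formula (Fin n)), a = (⟨n + 1, coverFormula φ χ⟩, 0)}

variable {φ : LSet.Formula (Fin 1)}

theorem deltaZero_subset_coverSet : deltaZero ⊆ coverSet φ := Set.subset_union_left

theorem coverFormula_mem {n : ℕ} (χ : LSet.Formula (Fin n)) :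
    ((⟨n + 1, coverFormula φ χ⟩ : Form LSet), (0 : Fin 2)) ∈ coverSet φ := Or.inr ⟨n, χ, rfl⟩

theorem coverSet_one {a : Form LSet} (h : (a, (1 : Fin 2)) ∈ coverSet φ) : (a, (1 : Fin 2)) ∈ deltaZero := by
  rcases h with h | ⟨n, χ, h⟩
  · exact h
  · simp at h

/-- The formulas defining the relations of `∈_A`. -/
def relFormula {A : Set (Form LSet × Fin 2)} :
    ∀ {n : ℕ}, (morley LSet A).Relations n → LSet.Formula (Fin n)
  | _, MorleyRelations.base r => Relations.formula r Term.var
  | _, MorleyRelations.relSymb ψ _ => ψ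

/-- The formulas defining the graphs of the functions of `∈_A`. -/
def funFormula {A : Set (Form LSet × Fin 2)} :
    ∀ {n : ℕ}, (morley LSet A).Functions n → LSet.Formula (Fin (n + 1))
  | _, MorleyFunctions.base f => f.elim
  | _, MorleyFunctions.funSymb ψ _ => ψ
  | _, MorleyFunctions.default _ => ∼(nonemptyF (Sum.inl 0))

variable {M : Type u} [LSet.Structure M] {l : M}

theorem realize_coverFormula (hl : ∀ y : M, φ.Realize ![y] ↔ y = l) {n : ℕ} (χ : LSet.Formula (Fin n))
    (v : Fin (n + 2) → M) : (coverFormula φ χ).Realize v ↔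
      (TransS (v 0) ∧ SurjS (v 1) l (v 0) ∧ ∀ i : Fin n, v i.succ.succ ∊ v 0) ∧
        χ.Realize fun i => v i.succ.succ := by
  simp only [Formula.Realize, coverFormula, realize_exF, BoundedFormula.realize_inf, realize_plug,
    realize_isTransitive, realize_isSurj, BoundedFormula.realize_iInf, realize_mem, elim_last,
    Sum.elim_inl]
  simp only [← Matrix.vec_single_eq_const]
  exact ⟨fun ⟨y, hy, h⟩ => (hl y).1 hy ▸ h, fun h => ⟨l, (hl l).2 rfl, h⟩⟩

variable [ZF M]

section Structure

variable [(morley LSet (coverSet φ)).Structure M] [(incl (coverSet φ)).IsExpansionOn M]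

theorem translates_coverSet (hT : M ⊨ setMorleyTheory (coverSet φ)) :
    Translates (L := morley LSet (coverSet φ)) relFormula funFormula M := by
  refine ⟨fun r v => ?_, fun f v y => ?_⟩
  · cases r with
    | base r => exact (relMap_base r v).trans (Formula.realize_rel (R := r) (ts := Term.var)).symm
    | relSymb ψ h => exact relMap_relSymb hT h v
  · cases f with
    | base f => exact f.elim
    | funSymb ψ h =>
      obtain ⟨z, hz, -⟩ := (deltaZero_one (M := M) (coverSet_one h)).2 v
      rw [funMap_funSymb hT h v hz, eq_comm]
      exact (hz y).symm
    | default h =>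
      rw [← defaultConst_eq hT h]
      simp only [funFormula, Formula.Realize, BoundedFormula.realize_not, realize_nonemptyF]
      rfl

theorem reflectClass_interprets (hT : M ⊨ setMorleyTheory (coverSet φ))
    (hl : ∀ y : M, φ.Realize ![y] ↔ y = l) (hk : InfCard l) :
    (reflectClass l).Interprets (morley LSet (coverSet φ)) := by
  have hd : ∀ {α : Type} {P : (α → M) → Prop}, (deltaClass M).Q P → (reflectClass l).Q P := by
    rintro α P ⟨ψ, hψ, hP⟩
    rw [funext fun v => propext (hP v)]
    exact reflectClass_d0 hψ.d0
  refine ⟨fun {n} r => ?_, fun {n} f => ?_⟩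
  · cases r with
    | base r =>
      rw [funext fun v => propext (relMap_base (A := coverSet φ) r v)]
      exact hd (deltaClass_rel r)
    | relSymb ψ h =>
      rw [funext fun v => propext (relMap_relSymb hT h v)]
      rcases h with h | ⟨m, χ, h⟩
      · exact hd ⟨ψ, deltaZero_zero.1 h, fun v => Iff.rfl⟩
      · simp only [Prod.mk.injEq, Sigma.mk.injEq, and_true] at h
        obtain ⟨rfl, h⟩ := h
        obtain rfl := eq_of_heq h
        rw [funext fun v => propext (realize_coverFormula hl χ v)]
        exact reflectClass_cover hk.ordS 0 1 (fun i => i.succ.succ) χ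
  · cases f with
    | base f => exact f.elim
    | funSymb ψ h => exact hd (exists_graph_funSymb hT h (coverSet_one h))
    | default h => exact hd (exists_graph_default hT h)

theorem exists_substructure_hPlus (hT : M ⊨ setMorleyTheory (coverSet φ))
    (hl : ∀ y : M, φ.Realize ![y] ↔ y = l) (hk : InfCard l) :
    ∃ N : (morley LSet (coverSet φ)).Substructure M, (N : Set M) = hPlus (coverSet φ) φ M := by
  refine ⟨⟨hPlus (coverSet φ) φ M, fun {n} f v hv => ?_⟩, rfl⟩
  simp only [mem_hPlus hl] at hv ⊢
  cases f with
  | base f => exact f.elim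
  | funSymb ψ h =>
    obtain ⟨z, hz, hc⟩ := (deltaZero_one (M := M) (coverSet_one h)).2 v
    rw [funMap_funSymb hT h v hz]
    exact hc l hk hv
  | default h =>
    have := (defaultConst_eq hT h v emp).1 (by simp)
    exact this ▸ hk.hs_emp

variable {N : (morley LSet (coverSet φ)).Substructure M}

/-- A universal formula that fails in `M` fails in `H_{λ⁺}`. -/
theorem exists_not_realize_substructure (hT : M ⊨ setMorleyTheory (coverSet φ))
    (hl : ∀ y : M, φ.Realize ![y] ↔ y = l) (hk : InfCard l)
    (hN : ∀ x, x ∈ N ↔ Hs l x) {α : Type} [Finite α] {n : ℕ}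
    {σ : (morley LSet (coverSet φ)).BoundedFormula α n} (hσ : σ.IsUniversal) {v : α → M}
    {xs : Fin n → M} (h : ¬ σ.Realize v xs) :
    ∃ (v' : α → N) (xs' : Fin n → N), ¬ σ.Realize v' xs' := by
  have hne : Nonempty M := ⟨l⟩
  induction hσ with
  | of_isQF hσ =>
    -- The negated quantifier-free part says that there are `ys` with `P`, where `P` is preserved by
    -- collapses of hulls meeting `ds`. The hull taken below contains the failing tuple and the
    -- `ys`, and the collapsed tuple fails in `H_{λ⁺}`.
    obtain ⟨β, _, P, ⟨ds, hP⟩, hiff⟩ := ((reflectClass_interprets hT hl hk).qf hσ).2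
    obtain ⟨ys, hys⟩ := (hiff (Sum.elim v xs)).1
      (by simpa only [Sum.elim_comp_inl, Sum.elim_comp_inr] using h)
    obtain ⟨t, X, p, H, hv, hs⟩ := hk.exists_collapsed_hull ds (Sum.elim (Sum.elim v xs) ys)
    let w : α ⊕ Fin _ → N := fun a => ⟨app p (Sum.elim v xs a), (hN _).2 (hs _ (hv (Sum.inl a)))⟩
    refine ⟨w ∘ Sum.inl, w ∘ Sum.inr, fun hr => ?_⟩
    refine (hiff (app p ∘ Sum.elim v xs)).2 ⟨app p ∘ ys, ?_⟩ (hσ.realize_embedding N.subtype |>.2 hr)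
    rw [← Sum.comp_elim]
    exact (hP t X p H _ hv).1 hys
  | all _ ih =>
    rw [BoundedFormula.realize_all] at h
    push Not at h
    obtain ⟨x, hx⟩ := h
    obtain ⟨v', xs', h'⟩ := ih hx
    refine ⟨v', Fin.init xs', fun hr => h' ?_⟩
    have := BoundedFormula.realize_all.1 hr (xs' (Fin.last _))
    rwa [Fin.snoc_init_self] at this

theorem realize_boolUniversal (hT : M ⊨ setMorleyTheory (coverSet φ))
    (hl : ∀ y : M, φ.Realize ![y] ↔ y = l) (hk : InfCard l)
    (hN : ∀ x, x ∈ N ↔ Hs l x) {σ : (morley LSet (coverSet φ)).Sentence} (hσ : IsBoolUniversal σ) :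
    N ⊨ σ ↔ M ⊨ σ := by
  induction hσ with
  | univ hσ =>
    refine ⟨fun h => ?_, realize_universal_substructure N hσ⟩
    by_contra hn
    obtain ⟨v, xs, h'⟩ := exists_not_realize_substructure hT hl hk hN hσ hn
    rw [Subsingleton.elim v default, Subsingleton.elim xs default] at h'
    exact h' h
  | imp _ _ ih₁ ih₂ => exact imp_congr ih₁ ih₂

end Structure

/-- `χ(x₁, …, xₙ)` as an existential formula over `H_{λ⁺}`. -/
noncomputable def coverEx (φ : LSet.Formula (Fin 1)) {n : ℕ} (χ : LSet.Formula (Fin n)) :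
    (morley LSet (coverSet φ)).Formula (Fin n) :=
  exF fun s => exF fun f => Relations.boundedFormula (L := morley LSet (coverSet φ))
    (MorleyRelations.relSymb (coverFormula φ χ) (coverFormula_mem χ))
    (Fin.cons (Term.var s↟) (Fin.cons (Term.var f) fun i => Term.var (Sum.inl i)))

theorem realize_coverEx {N : Type u} [(morley LSet (coverSet φ)).Structure N] {n : ℕ}
    (χ : LSet.Formula (Fin n)) (v : Fin n → N) : (coverEx φ χ).Realize v ↔
      ∃ s f : N, Structure.RelMap (L := morley LSet (coverSet φ))
        (MorleyRelations.relSymb (coverFormula φ χ) (coverFormula_mem χ))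
        (Fin.cons s (Fin.cons f v : Fin (n + 1) → N) : Fin (n + 2) → N) := by
  simp only [Formula.Realize, coverEx, realize_exF]
  refine exists_congr fun s => exists_congr fun f =>
    BoundedFormula.realize_rel.trans (iff_of_eq (congrArg _ ?_))
  funext i
  refine Fin.cases ?_ (fun i => Fin.cases ?_ (fun i => ?_) i) i
  · exact (elim_up (Sum.inr (Fin.last 0)) f).trans (elim_last s)
  · exact elim_last f
  · rfl

variable [(morley LSet (coverSet φ)).Structure M] [(incl (coverSet φ)).IsExpansionOn M]
  {N : (morley LSet (coverSet φ)).Substructure M}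

/-- The empty set is thrown in so that `s` is nonempty and `λ` maps onto it. The surjection is a
subset of `λ × s`, hence itself in `H_{λ⁺}`. -/
theorem InfCard.exists_cover (hk : InfCard l) {n : ℕ} (v : Fin n → M) (hv : ∀ i, Hs l (v i)) :
    ∃ s f, Hs l s ∧ Hs l f ∧ TransS s ∧ SurjS f l s ∧ ∀ i, v i ∊ s := by
  have hset : ∀ {n : ℕ} (v : Fin n → M), (∀ i, Hs l (v i)) → ∃ d, Hs l d ∧ emp ∊ d ∧ ∀ i, v i ∊ d := by
    intro n
    induction n with
    | zero => exact fun _ _ => ⟨upair emp emp, hk.hs_upair hk.hs_emp hk.hs_emp, by simp, Fin.rec0⟩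
    | succ n ih =>
      intro v hv
      obtain ⟨d, hd, he, h⟩ := ih (fun i => v i.succ) fun i => hv _
      refine ⟨cup d (upair (v 0) (v 0)), hk.hs_cup hd (hk.hs_upair (hv 0) (hv 0)), by simp [he],
        fun i => ?_⟩
      refine Fin.cases (by simp) (fun i => by simp [h i]) i
  obtain ⟨d, ⟨s, hs, hds, hsm⟩, he, hd⟩ := hset v hv
  obtain ⟨f, hf⟩ := hsm.exists_surjS ⟨emp, hds _ he⟩
  have hs' : Hs l s := ⟨s, hs, fun _ h => h, hsm⟩
  have hl' : Hs l l := ⟨l, hk.ordS.1, fun _ h => h, Sm.refl l⟩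
  refine ⟨s, f, hs', (hk.hs_prd hl' hs').subset fun p hp => ?_, hs, hf, fun i => hds _ (hd i)⟩
  obtain ⟨a, b, ha, hp'⟩ := hf.1.1.1 p hp
  rw [pairS_iff] at hp'
  subst hp'
  exact op_mem_prd.2 ⟨ha, hf.1.2 a b (pairInS_iff.2 hp)⟩

/-- The new predicates keep in `H_{λ⁺}` their meaning from `M`, and every tuple has a cover in
`H_{λ⁺}`. So an existential formula over `H_{λ⁺}` expresses the truth of `χ` in all of `M`. -/
theorem realize_coverEx_substructure (hT : M ⊨ setMorleyTheory (coverSet φ))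
    (hl : ∀ y : M, φ.Realize ![y] ↔ y = l) (hk : InfCard l) (hN : ∀ x, x ∈ N ↔ Hs l x) {n : ℕ}
    (χ : LSet.Formula (Fin n)) (v : Fin n → N) :
    (coverEx φ χ).Realize v ↔ χ.Realize ((Subtype.val : N → M) ∘ v) := by
  have key : ∀ s f : N, Structure.RelMap (L := morley LSet (coverSet φ))
      (MorleyRelations.relSymb (coverFormula φ χ) (coverFormula_mem χ))
      (Fin.cons s (Fin.cons f v : Fin (n + 1) → N) : Fin (n + 2) → N) ↔
      (TransS (s : M) ∧ SurjS (f : M) l s ∧ ∀ i, (v i : M) ∊ s) ∧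
        χ.Realize ((Subtype.val : N → M) ∘ v) := fun s f =>
    ((N.subtype.map_rel _ _).symm.trans (relMap_relSymb hT (coverFormula_mem χ) _)).trans
      (realize_coverFormula hl χ _)
  rw [realize_coverEx]
  simp only [key]
  constructor
  · rintro ⟨s, f, -, h⟩
    exact h
  · intro h
    obtain ⟨s, f, hs, hf, hs', hf', hv⟩ := hk.exists_cover (fun i => (v i : M)) fun i => (hN _).1 (v i).2
    exact ⟨⟨s, (hN s).2 hs⟩, ⟨f, (hN f).2 hf⟩, ⟨hs', hf', hv⟩, h⟩

end Cover

end AMCSpectrum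

namespace AMCSpectrum

/-! ## The absolute model companion -/

section Companion

variable {R : LSet.Theory} {φ : LSet.Formula (Fin 1)}

/-- Membership in `H_{λ⁺}`. -/
def hPlusFormula (φ : LSet.Formula (Fin 1)) : LSet.Formula (Fin 1) :=
  exF fun l => plug φ (fun _ => l) ⊓ inHPlus l (Sum.inl 0)

theorem realize_hPlusFormula {M : Type u} [LSet.Structure M] [ZF M] {l : M}
    (hl : ∀ y : M, φ.Realize ![y] ↔ y = l) (v : Fin 1 → M) :
    (hPlusFormula φ).Realize v ↔ Hs l (v 0) := by
  simp only [Formula.Realize, hPlusFormula, realize_exF, BoundedFormula.realize_inf, realize_plug,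
    realize_inHPlus, inHPlusS_iff, elim_last, Sum.elim_inl]
  simp only [← Matrix.vec_single_eq_const]
  exact ⟨fun ⟨y, hy, h⟩ => (hl y).1 hy ▸ h, fun h => ⟨l, (hl l).2 rfl, h⟩⟩

/-- The models of `R + T_{∈,A}` are models of ZFC, in which `H_{λ⁺}` is given by `Hs`. -/
theorem exists_infCard_of_expand {A : Set (Form LSet × Fin 2)} (hR : ∀ σ ∈ ZFC, R ⊨ᵇ σ)
    (hφ : IsDefinableInfiniteCardinal R φ) {M : Type u} [LSet.Structure M]
    [(morley LSet A).Structure M] [(incl A).IsExpansionOn M] [Nonempty M] (hM : M ⊨ expand R A) :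
    ∃ (_ : ZF M) (l : M), M ⊨ setMorleyTheory A ∧ (∀ y : M, φ.Realize ![y] ↔ y = l) ∧ InfCard l ∧
      ∀ x : M, x ∈ hPlus A φ M ↔ Hs l x := by
  obtain ⟨hMR, hT⟩ := model_of_expand hM
  have hZ := ZF.of_model (model_zfc hR hMR)
  obtain ⟨l, hl, hk⟩ := hφ.exists_infCard hMR
  exact ⟨hZ, l, hT, hl, hk, mem_hPlus hl⟩

/-- Each formula over `H_{λ⁺}` translates to an ∈-formula about the ambient model, and `coverEx`
turns this into an existential formula over `H_{λ⁺}`. The equivalence is a sentence of the common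
theory, so it holds in all its models. Hence embeddings preserve every formula and, applying this to
its negation, reflect it. -/
theorem isModelComplete_hPlusTheory (hR : ∀ σ ∈ ZFC, R ⊨ᵇ σ)
    (hφ : IsDefinableInfiniteCardinal R φ) :
    IsModelComplete.{u} (hPlusTheory.{u} R (coverSet φ) φ) := by
  have key : ∀ (n : ℕ) (ψ : (morley LSet (coverSet φ)).Formula (Fin n)),
      ∃ χ : LSet.Formula (Fin n), ∀ (K : Type u) [(morley LSet (coverSet φ)).Structure K] [Nonempty K],
        K ⊨ hPlusTheory.{u} R (coverSet φ) φ → ∀ v : Fin n → K,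
          ψ.Realize v ↔ (coverEx φ χ).Realize v := by
    intro n ψ
    obtain ⟨χ, hχ⟩ := exists_translation.{u} (L := morley LSet (coverSet φ)) (ρ := relFormula)
      (γ := funFormula) (hPlusFormula φ) ψ
    let χ' : LSet.Formula (Fin n) := χ.relabel (Sum.elim id Fin.elim0)
    let σ : (morley LSet (coverSet φ)).Sentence :=
      BoundedFormula.alls (n := n) (plug ψ Sum.inr ⇔ plug (coverEx φ χ') Sum.inr)
    have hσ : ∀ (K : Type u) [(morley LSet (coverSet φ)).Structure K], K ⊨ σ ↔ ∀ v : Fin n → K,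
        ψ.Realize v ↔ (coverEx φ χ').Realize v := by
      intro K _
      rw [Sentence.Realize, BoundedFormula.realize_alls]
      refine forall_congr' fun v => ?_
      rw [BoundedFormula.realize_iff, realize_plug, realize_plug]
      rfl
    refine ⟨χ', fun K _ _ hK => (hσ K).1 (hK.realize_of_mem σ fun M _ _ hM N hN => (hσ N).2 fun v => ?_)⟩
    let _ : LSet.Structure M := (incl (coverSet φ)).reduct M
    have : (incl (coverSet φ)).IsExpansionOn M := LHom.isExpansionOn_reduct _ _
    obtain ⟨_, l, hT, hl, hk, hmem⟩ := exists_infCard_of_expand hR hφ hM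
    have hN' : ∀ x, x ∈ N ↔ Hs l x := fun x => by rw [← SetLike.mem_coe, hN, hmem]
    rw [realize_coverEx_substructure hT hl hk hN', Formula.Realize,
      hχ M (translates_coverSet hT) N (fun x => (hN' x).trans (realize_hPlusFormula hl ![x]).symm),
      Formula.realize_relabel]
    refine iff_of_eq (congrArg _ ?_)
    funext i
    rcases i with i | i
    · rfl
    · exact i.elim0
  have up : ∀ (M N : Type u) [(morley LSet (coverSet φ)).Structure M]
      [(morley LSet (coverSet φ)).Structure N] [Nonempty M] [Nonempty N],
      M ⊨ hPlusTheory.{u} R (coverSet φ) φ → N ⊨ hPlusTheory.{u} R (coverSet φ) φ →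
      ∀ (f : M ↪[morley LSet (coverSet φ)] N) (n : ℕ) (ψ : (morley LSet (coverSet φ)).Formula (Fin n))
        (v : Fin n → M), ψ.Realize v → ψ.Realize (f ∘ v) := by
    intro M N _ _ _ _ hM hN f n ψ v h
    obtain ⟨χ, hχ⟩ := key n ψ
    obtain ⟨s, g, hr⟩ := (realize_coverEx χ v).1 ((hχ M hM v).1 h)
    refine (hχ N hN _).2 ((realize_coverEx χ _).2 ⟨f s, f g, ?_⟩)
    have := (f.map_rel _ _).2 hr
    rwa [Fin.comp_cons, Fin.comp_cons] at this
  intro M N _ _ _ _ hM hN f n ψ v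
  refine ⟨fun h => ?_, up M N hM hN f n ψ v⟩
  by_contra hn
  exact up M N hM hN f n ψ.not v (Formula.realize_not.2 hn) h

theorem exists_substructure_of_expand (hR : ∀ σ ∈ ZFC, R ⊨ᵇ σ)
    (hφ : IsDefinableInfiniteCardinal R φ) (M : Type u) [(morley LSet (coverSet φ)).Structure M]
    [Nonempty M] (hM : M ⊨ expand R (coverSet φ)) :
    ∃ N : (morley LSet (coverSet φ)).Substructure M, (N : Set M) = hPlus (coverSet φ) φ M := by
  let _ : LSet.Structure M := (incl (coverSet φ)).reduct M
  have : (incl (coverSet φ)).IsExpansionOn M := LHom.isExpansionOn_reduct _ _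
  obtain ⟨_, l, hT, hl, hk, -⟩ := exists_infCard_of_expand hR hφ hM
  exact exists_substructure_hPlus hT hl hk

theorem isAbsoluteModelCompanion_hPlusTheory (hR : ∀ σ ∈ ZFC, R ⊨ᵇ σ)
    (hφ : IsDefinableInfiniteCardinal R φ) :
    IsAbsoluteModelCompanion.{u} (hPlusTheory.{u} R (coverSet φ) φ) (expand R (coverSet φ)) := by
  refine ⟨?_, isModelComplete_hPlusTheory hR hφ⟩
  ext σ
  refine and_congr_right fun hσ => hPlusTheory_models_iff deltaZero_subset_coverSet
    (exists_substructure_of_expand hR hφ) fun M _ _ hM N hN => ?_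
  let _ : LSet.Structure M := (incl (coverSet φ)).reduct M
  have : (incl (coverSet φ)).IsExpansionOn M := LHom.isExpansionOn_reduct _ _
  obtain ⟨_, l, hT, hl, hk, hmem⟩ := exists_infCard_of_expand hR hφ hM
  exact realize_boolUniversal hT hl hk (fun x => by rw [← SetLike.mem_coe, hN, hmem]) hσ

/-- Membership in `H_{λ⁺}` and the symbols of its signature are given by ∈-formulas in `M`, and
`coverEx` makes any such relation on `H_{κ⁺}` definable there without parameters. -/
theorem isDefinableIn_hPlus (hR : ∀ σ ∈ ZFC, R ⊨ᵇ σ) {ψ : LSet.Formula (Fin 1)}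
    (hφ : IsDefinableInfiniteCardinal R φ) (hψ : IsDefinableInfiniteCardinal R ψ) (M : Type u)
    [(morley LSet (coverSet φ)).Structure M] [(morley LSet (coverSet ψ)).Structure M] [Nonempty M]
    (hM : M ⊨ expand R (coverSet φ)) (hM' : M ⊨ expand R (coverSet ψ))
    (hmem : ∀ x y : M,
      holds (A := coverSet φ) (mem (Sum.inl 0) (Sum.inl 1) : LSet.Formula (Fin 2)) ![x, y] ↔
        holds (A := coverSet ψ) (mem (Sum.inl 0) (Sum.inl 1) : LSet.Formula (Fin 2)) ![x, y])
    (hlt : ∃ l k : M, holds (A := coverSet φ) φ ![l] ∧ holds (A := coverSet φ) ψ ![k] ∧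
      holds (A := coverSet φ) (mem (Sum.inl 0) (Sum.inl 1) : LSet.Formula (Fin 2)) ![l, k])
    (N : (morley LSet (coverSet ψ)).Substructure M) (hN : (N : Set M) = hPlus (coverSet ψ) ψ M) :
    IsDefinableIn (A := coverSet φ) (hPlus (coverSet φ) φ M) N := by
  let _ : LSet.Structure M := (incl (coverSet φ)).reduct M
  have : (incl (coverSet φ)).IsExpansionOn M := LHom.isExpansionOn_reduct _ _
  -- Both expansions have the same membership relation, so they are expansions of one and the same
  -- ∈-structure.
  have : (incl (coverSet ψ)).IsExpansionOn M := by
    refine ⟨fun f => f.elim, fun r v => ?_⟩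
    cases r
    have hv : v = ![v 0, v 1] := by
      funext i
      fin_cases i <;> rfl
    have hr := hmem (v 0) (v 1)
    unfold holds at hr
    rw [LHom.realize_onFormula] at hr
    have h1 : ((incl (coverSet ψ)).onFormula (mem (Sum.inl 0) (Sum.inl 1) :
        LSet.Formula (Fin 2))).Realize ![v 0, v 1] ↔ Structure.RelMap
          ((incl (coverSet ψ)).onRelation SetRel.mem) ![v 0, v 1] := by
      let _ : LSet.Structure M := (incl (coverSet ψ)).reduct M
      have : (incl (coverSet ψ)).IsExpansionOn M := LHom.isExpansionOn_reduct _ _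
      rw [LHom.realize_onFormula]
      exact realize_mem _ _
    rw [hv]
    exact propext (h1.symm.trans (hr.symm.trans (realize_mem _ _)))
  obtain ⟨_, l, hT, hl, hk, hmemφ⟩ := exists_infCard_of_expand hR hφ hM
  obtain ⟨_, k, hT', hl', hk', hmemψ⟩ := exists_infCard_of_expand hR hψ hM'
  have hN' : ∀ x, x ∈ N ↔ Hs k x := fun x => by rw [← SetLike.mem_coe, hN, hmemψ]
  have hlk : l ∊ k := by
    obtain ⟨l', k', h1, h2, h3⟩ := hlt
    simp only [holds, LHom.realize_onFormula, hl, hl'] at h1 h2 h3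
    subst h1 h2
    exact (realize_mem _ _).1 h3
  have hdef : ∀ {n : ℕ} (P : (Fin n → M) → Prop) (χ : LSet.Formula (Fin n)), (∀ v, P v ↔ χ.Realize v) →
      (∅ : Set N).Definable (morley LSet (coverSet ψ)) {v : Fin n → N | P fun i => v i} := by
    intro n P χ hP
    rw [Set.empty_definable_iff]
    refine ⟨coverEx ψ χ, ?_⟩
    ext v
    exact (hP _).trans (realize_coverEx_substructure hT' hl' hk' hN' χ v).symm
  have hall : ∀ {n : ℕ} (χ : LSet.Formula (Fin n)) (v : Fin n → M),
      ((∀ i, v i ∈ hPlus (coverSet φ) φ M) ∧ χ.Realize v) ↔ (BoundedFormula.iInf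
        (fun i => (hPlusFormula φ).relabel fun _ => i) ⊓ χ : LSet.Formula (Fin n)).Realize v := by
    intro n χ v
    rw [Formula.realize_inf]
    refine and_congr_left' ?_
    rw [Formula.Realize, BoundedFormula.realize_iInf]
    refine forall_congr' fun i => ?_
    rw [hmemφ]
    exact (realize_hPlusFormula hl fun _ => v i).symm.trans Formula.realize_relabel.symm
  have htr := translates_coverSet hT
  refine ⟨fun x hx => ?_, ?_, fun n r => ?_, fun n f => ?_⟩
  · exact (hN' x).2 (((hmemφ x).1 hx).mono (hk'.ordS.1 l hlk))
  · exact hdef (fun v => v 0 ∈ hPlus (coverSet φ) φ M) (hPlusFormula φ)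
      fun v => (hmemφ _).trans (realize_hPlusFormula hl v).symm
  · exact hdef (fun v => (∀ i, v i ∈ hPlus (coverSet φ) φ M) ∧ Structure.RelMap r v) _
      fun v => (and_congr_right fun _ => htr.rel r v).trans (hall _ v)
  · refine hdef (fun v => (∀ i, v i ∈ hPlus (coverSet φ) φ M) ∧
      Structure.funMap f (fun i => v i.succ) = v 0) _
      fun v => (and_congr_right fun _ => ?_).trans (hall (funFormula f) v)
    rw [htr.func]
    exact iff_of_eq (congrArg _ (Fin.cons_self_tail v))

end Companion

end AMCSpectrum

theorem mainTheorem1 (R : LSet.Theory) (hR : ∀ σ ∈ ZFC, R ⊨ᵇ σ) :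
    -- part (i)
    (∀ (A : Set (Form LSet × Fin 2)) (hA : deltaZero ⊆ A) (S : (morley LSet A).Theory),
      IsModelCompanion.{u} S (expand R A) →
      ∀ (M : Type u) [(morley LSet A).Structure M] [Nonempty M], M ⊨ S →
        M ⊨ (incl A).onSentence extensionality ∧
        M ⊨ (incl A).onSentence foundation ∧
        M ⊨ (incl A).onSentence choice ∧
        (∀ i, M ⊨ (incl A).onSentence (closedBinary i)) ∧
        (∀ i, M ⊨ (incl A).onSentence (closedUnary i)) ∧
        ∀ ψ : (morley LSet deltaZero).Formula (Fin 2), BoundedFormula.IsExistential ψ →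
          (expand R A ⊨ᵇ (allF fun x => exF fun y =>
            plug ((morleyMono hA).onFormula ψ) ![x↟, y] : (morley LSet A).Sentence)) →
          M ⊨ replacement (incl A) (n := 0) ((morleyMono hA).onFormula ψ)) ∧
    -- (ii)
    (∀ (A : Set (Form LSet × Fin 2)), deltaZero ⊆ A → ∀ (S : (morley LSet A).Theory),
      IsModelCompanion.{u} S (expand R A) →
      ∀ φ : LSet.Formula (Fin 1), IsDefinableCardinal R φ →
      ∀ hφ : ((⟨0, φ⟩ : Form LSet), (1 : Fin 2)) ∈ A,
      (∀ (M : Type u) [(morley LSet A).Structure M] [Nonempty M], M ⊨ expand R A →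
        ∃ N : (morley LSet A).Substructure M,
          (N : Set M) = hPlus A φ M ∧ IsSigmaOneElementary N) →
      S ⊨ᵇ surjectiveImages (MorleyFunctions.funSymb φ hφ)) ∧
    -- (iii)
    (∃ 𝒜 : LSet.Formula (Fin 1) → Set (Form LSet × Fin 2),
      (∀ φ, IsDefinableInfiniteCardinal R φ →
        deltaZero ⊆ 𝒜 φ ∧
        (∀ (M : Type u) [(morley LSet (𝒜 φ)).Structure M] [Nonempty M], M ⊨ expand R (𝒜 φ) →
          ∃ N : (morley LSet (𝒜 φ)).Substructure M, (N : Set M) = hPlus (𝒜 φ) φ M) ∧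
        IsAbsoluteModelCompanion.{u} (hPlusTheory.{u} R (𝒜 φ) φ) (expand R (𝒜 φ))) ∧
      (∀ φ ψ, IsDefinableInfiniteCardinal R φ → IsDefinableInfiniteCardinal R ψ →
        ∀ (M : Type u) [(morley LSet (𝒜 φ)).Structure M] [(morley LSet (𝒜 ψ)).Structure M]
          [Nonempty M], M ⊨ expand R (𝒜 φ) → M ⊨ expand R (𝒜 ψ) →
        (∀ x y : M, holds (A := 𝒜 φ) (mem (Sum.inl 0) (Sum.inl 1) : LSet.Formula (Fin 2)) ![x, y] ↔
          holds (A := 𝒜 ψ) (mem (Sum.inl 0) (Sum.inl 1) : LSet.Formula (Fin 2)) ![x, y]) →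
        (∃ l k : M, holds (A := 𝒜 φ) φ ![l] ∧ holds (A := 𝒜 φ) ψ ![k] ∧
          holds (A := 𝒜 φ) (mem (Sum.inl 0) (Sum.inl 1) : LSet.Formula (Fin 2)) ![l, k]) →
        ∀ N : (morley LSet (𝒜 ψ)).Substructure M, (N : Set M) = hPlus (𝒜 ψ) ψ M →
          IsDefinableIn (A := 𝒜 φ) (hPlus (𝒜 φ) φ M) N)) := by
  refine ⟨fun A hA S hS M _ _ hM => modelCompanion_realize hR hA hS M hM,
    fun A hA S hS φ hφ hφA hH => modelCompanion_surjectiveImages hR hA hS hφ hφA hH,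
    coverSet, fun φ hφ => ⟨deltaZero_subset_coverSet, exists_substructure_of_expand hR hφ,
      isAbsoluteModelCompanion_hPlusTheory hR hφ⟩, fun φ ψ hφ hψ M _ _ _ hM hM' hmem hlt N hN =>
      isDefinableIn_hPlus hR hφ hψ M hM hM' hmem hlt N hN⟩
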